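/- **Setting.** Let $\mathcal C^*$ be an $r$-dimensional based cochain complex over $\mathbb F_2$: finite bases $C^0,\dots,C^r$, spaces $\mathcal C^j=\mathbb F_2^{C^j}$, coboundary maps $\delta:\mathcal C^j\to\mathcal C^{j+1}$ with $\delta^2=0$. For basis elements write $x\triangleleft y$ (incident) if $y$ occurs in $\delta(x)$, let $\preceq$ be the partial order generated by $\triangleleft$, and for a cochain $c$ write $x\preceq c$ if $x\preceq y$ for all $y\in\operatorname{supp}(c)$. $\mathcal C^*$ has locality $w\ge 1$ if every basis element is comparable to at most $w$ basis elements (itself included). $|\cdot|$ is Hamming weight. For $m\in\mathbb N$, $\mathcal C^*$ has an *$(m,0)$-small-set flip decoder at level $j$* if * for every nonzero $e\in\mathcal C^j$ with $|e|\le m$ there is $c^0\in C^0$ such that either some $c\in\mathcal C^{j-1}$ with $c^0\preceq c$ has $|e+\delta c|<|e|$, or some $c\in\mathcal C^j$ with $c^0\preceq c$ has $|\delta(e+c)|<|\delta e|$; and * for every $e\in\mathcal C^j$ with $\delta e\neq0$ and $|e|\le m$ there are $c^0\in C^0$ and $c\in\mathcal C^j$ with $c^0\preceq c$ and $|\delta(e+c)|<|\delta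 e|$. For a set $I$ of degrees, the connectivity graph $G^{\mathcal C}_I$ has vertex set $\bigsqcup_{j\in I}C^j$, two distinct vertices being adjacent if they lie above a common element of $C^0$ or below a common element of $C^r$. For a graph $G$ and $\eta,\gamma>0$, let $\mathcal E(G,\eta,\gamma)$ be the family of all vertex sets $S$ contained in a connected subgraph $G'\subseteq G$ with $|V(G')|\ge\eta$ and $|S|/|V(G')|\ge\gamma$. A set is $\mathcal E$-avoiding if it contains no member of $\mathcal E$; $\mathcal E^{\sqcup T}$ consists of the sets $S\times\{t\}$ with $S\in\mathcal E$, $t\in[T]$. Members of a family that contain non-qubits are ignored. An adaptive Clifford circuit of space $N$ and time $T$ performs, in each of $T$ time steps, a (noiseless) classical computation on a classical register and then Clifford gates (one-qubit Paulis, $H$, $S$, $CNOT$, one-qubit Pauli measurements, resets to $|0\rangle$ or $|+\rangle$) on disjoint sets of the $N$ qubits; the measurement outcomes are written to the register, and the other gates are controlled by its bits. A Pauli fault $\mathcal F=(\mathcal F_1,\dots,\mathcal F_T)$ inserts after step $t$ a superoperator $\mathcal F_t(\sigma)=F_t\sigma F_t'$ with Pauli operators $F_t,F_t'$; its support is the set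 of space-time locations on which it acts nontrivially. Let $\operatorname{Enc}$ be an encoding isometry of $k$ qubits into a block of physical qubits. A Pauli $\mathcal E$-deviation of an encoded state (possibly entangled with an unencoded reference system) is an operator which, after everything but the block and the reference system is traced out, is proportional to (possibly a zero multiple of) $F\,\cdot\,F'$ applied to that state, for Pauli operators $F,F'$ on the block such that the set of qubits on which $F$ or $F'$ acts nontrivially is $\mathcal E$-avoiding. A *Pauli fault-tolerant gadget preparing the logical pure state $\psi$*, for bad sets $\mathcal E_{\rm run}^{\sqcup T}$ and output bad sets $\mathcal E_{\rm out}$, is a circuit such that for every state $\rho$ of a reference system of any number of qubits, every operator $\sigma$ on the qubits, the classical register and the reference system whose classical register is a mixture of computational basis states and whose reduction to the reference system is proportional to $\rho$, and every Pauli fault with $\mathcal E_{\rm run}^{\sqcup T}$-avoiding support, the faulty circuit maps $\sigma$ to a Pauli $\mathcal E_{\rm out}$-deviation of $\operatorname{Enc}(|\psi\rangle\langle\psi|)\otimes\rho$. The CSS code of level $i$ has the $n=|C^i|$ qubits $C^i$; a CSS encoding map is a linear isomorphism $\operatorname{Enc}:\mathbb F_2^k\to H^i(\mathcal C)$, which induces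 the isometry $|x\rangle\mapsto|\operatorname{Enc}(x)\rangle$, the uniform superposition over the cocycles in the coset $\operatorname{Enc}(x)$. **Proposition.** There is an absolute constant $K$ such that the following holds. Let $1\le i\le r-2$, let $\mathcal C^*$ be an $r$-dimensional based cochain complex of locality $w$ with an $(m,0)$-small-set flip decoder at level $i+1$, and let $\operatorname{Enc}$ be a CSS encoding map for the code of level $i$. Let $G_{\rm run}$ be a finite graph that contains $G^{\mathcal C}_{\{i,i+1,i+2\}}$ as a subgraph and in which any two incident elements of $C^i\sqcup C^{i+1}\sqcup C^{i+2}$ are adjacent (automatic if every basis element lies above some element of $C^0$, or every one lies below some element of $C^r$). Let $$0<\eta\le m,\qquad 0<\gamma\le\frac1{50w^7(w+10)2^{w+10}},$$ $$\mathcal E_{\rm run}=\mathcal E(G_{\rm run},\eta,\gamma),\qquad \mathcal E_{\rm out}=\mathcal E\bigl(G_{\rm run},\eta,100w^7(w+10)2^{w+10}\gamma\bigr).$$ Then there is an adaptive Clifford circuit of space $N\le Knw$ and time $T\le Kw$, with qubits a set $S$ satisfying $C^i\subseteq S\subseteq C^i\sqcup C^{i+1}$, which with bad sets $\mathcal E_{\rm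 run}^{\sqcup T}$ and output bad sets $\mathcal E_{\rm out}$ is a Pauli fault-tolerant gadget preparing the logical state $|+^k\rangle$ of the level-$i$ code. It is single-shot: it resets the data qubits $C^i$ to $|+\rangle$ and the ancilla qubits $S\cap C^{i+1}$ to $|0\rangle$; couples each incident pair of a data and an ancilla qubit by exactly one $CNOT$ controlled by the data qubit; measures all ancilla qubits once in the $Z$ basis, giving a syndrome $s\in\mathcal C^{i+1}$ (zero outside $S$); computes $a\in\mathcal C^{i+1}$ as an output of small-set flip decoding on $\delta(s)$, which starts at $a=0$ and, as long as possible, replaces $a$ by some $a+c$ with $c\in\mathcal C^{i+1}$, $c^0\preceq c$ for some $c^0\in C^0$, and $|\delta(s)+\delta(a+c)|<|\delta(s)+\delta(a)|$; computes a solution $x\in\mathcal C^i$ of the linear system $\delta(x)=s+a$ if there is one; and applies the Pauli $X^x$. The same holds, with the same bounds, for the logical state $|0^k\rangle$ of the level-$i$ code with the roles of the complex and its dual exchanged: $2\le i\le r-1$, locality $w$, the chain complex $\mathcal C_*$ (viewed as the cochain complex with degree-$j$ basis $C^{r-j}$ and coboundary map $\delta^{\top}$) has an $(m,0)$-small-set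 flip decoder at its level $r-i+1$, $\{i,i+1,i+2\}$ is replaced by $\{i,i-1,i-2\}$, the ancilla qubits lie in $C^{i-1}$, and $|+\rangle,|0\rangle$, the Pauli bases $X,Z$ and control and target of the $CNOT$s are exchanged. -/

import Mathlib

open scoped Matrix Kronecker ComplexOrder

/-- The family of bad sets of a graph: all `S ⊆ V` lying in a connected subgraph `G' ⊆ G` with `|V(G')| ≥ η` and `|S| / |V(G')| ≥ γ`. -/
def badSets {V : Type*} (G : SimpleGraph V) (η γ : ℝ) : Set (Set V) :=
  {S | ∃ G' : G.Subgraph, G'.Connected ∧ S ⊆ G'.verts ∧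
    η ≤ (G'.verts.ncard : ℝ) ∧ γ ≤ (S.ncard : ℝ) / (G'.verts.ncard : ℝ)}

/-- A set is avoiding for a family if it contains no member of the family. -/
def Avoids {V : Type*} (E : Set (Set V)) (S : Set V) : Prop :=
  ∀ A ∈ E, ¬ A ⊆ S

/-- Disjoint union of `T` copies of a family of sets, one for each time step. -/
def timeCopies {V : Type*} (E : Set (Set V)) (T : ℕ) : Set (Set (V × Fin T)) :=
  {A | ∃ t : Fin T, ∃ B ∈ E, A = B ×ˢ {t}}

/-! ### Based cochain complexes over `𝔽₂` -/

/-- An `r`-dimensional based (co)chain complex over `𝔽₂`: a finite set `X` of basis elements graded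
by degrees `0, …, r`, with the matrix `δ` of the total coboundary map (`δ c' c` is the coefficient of
`c'` in the coboundary of the basis element `c`).  The boundary map is the transpose of `δ`. -/
structure BasedCochainComplex (X : Type*) [Fintype X] (r : ℕ) where
  deg : X → ℕ
  deg_le : ∀ x, deg x ≤ r
  δ : Matrix X X (ZMod 2)
  deg_eq : ∀ x y, δ y x ≠ 0 → deg y = deg x + 1
  δ_sq : δ * δ = 0

namespace BasedCochainComplex

variable {X : Type*} [Fintype X] {r : ℕ} (C : BasedCochainComplex X r)

/-- The dual complex, i.e. the chain complex of `C` regarded as a cochain complex: degree `i` becomes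
degree `r - i` and the coboundary map of the dual is the boundary map of `C`. -/
def dual : BasedCochainComplex X r where
  deg x := r - C.deg x
  deg_le _ := Nat.sub_le _ _
  δ := C.δᵀ
  deg_eq x y h := by
    have h1 := C.deg_eq y x h
    have h2 := C.deg_le x
    have h3 := C.deg_le y
    omega
  δ_sq := by rw [← Matrix.transpose_mul, C.δ_sq, Matrix.transpose_zero]

/-- The basis `C^j` of the space of `j`-cochains. -/
abbrev Level (j : ℕ) : Type _ := {x : X // C.deg x = j}

/-- The space of `j`-cochains. -/
abbrev Cochain (j : ℕ) : Type _ := C.Level j → ZMod 2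

/-- The component of the coboundary map from `j`-cochains to `l`-cochains; it is `δ_j` for
`l = j + 1` and zero for every other `l`. -/
def cob (j l : ℕ) : C.Cochain j →ₗ[ZMod 2] C.Cochain l :=
  (C.δ.submatrix (Subtype.val : C.Level l → X) (Subtype.val : C.Level j → X)).mulVecLin

/-- `x ◁ y`: the basis element `x` occurs in the boundary of the basis element `y`. -/
def Incident (x y : X) : Prop := C.δ y x ≠ 0

/-- The partial order `x ⪯ y` on basis elements generated by incidence. -/
def Below (x y : X) : Prop := Relation.ReflTransGen C.Incident x y

/-- `x ⪯ c` for a basis element `x` and a cochain `c`: every basis element in the support of `c`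
lies above `x`. -/
def BelowCochain (x : X) {j : ℕ} (c : C.Cochain j) : Prop :=
  ∀ y : C.Level j, c y ≠ 0 → C.Below x y

/-- Locality `w`: every basis element is comparable to at most `w` basis elements. -/
def HasLocality (w : ℕ) : Prop :=
  ∀ x : X, {y : X | C.Below y x ∨ C.Below x y}.ncard ≤ w

/-- The `i`-cocycles. -/
def cocycles (i : ℕ) : Submodule (ZMod 2) (C.Cochain i) := LinearMap.ker (C.cob i (i + 1))

/-- The `i`-coboundaries (zero for `i = 0`, since `C.cob 0 0 = 0`). -/
def coboundaries (i : ℕ) : Submodule (ZMod 2) (C.Cochain i) := LinearMap.range (C.cob (i - 1) i)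

/-- The `i`-cohomology. -/
abbrev Cohomology (i : ℕ) : Type _ :=
  ↥(C.cocycles i) ⧸ (C.coboundaries i).submoduleOf (C.cocycles i)

/-- The level-`I` connectivity graph: its vertices are the basis elements with degree in `I`, and
two of them are joined if they lie above a common element of `C^0` or below a common element of
`C^r`. -/
def connectivityGraph (I : Set ℕ) : SimpleGraph {x : X // C.deg x ∈ I} where
  Adj x y := x ≠ y ∧
    ((∃ z, C.deg z = 0 ∧ C.Below z x ∧ C.Below z y) ∨
      (∃ z, C.deg z = r ∧ C.Below x z ∧ C.Below y z))
  symm := ⟨fun _ _ h => ⟨h.1.symm, h.2.imp (fun ⟨z, a, b, c⟩ => ⟨z, a, c, b⟩)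
    (fun ⟨z, a, b, c⟩ => ⟨z, a, c, b⟩)⟩⟩
  loopless := ⟨fun _ h => h.1 rfl⟩

/-! ### Small-set flip decoders -/

/-- `m`-small-set error-flip decoder at level `i` (the first alternative is void at level `0`, where
there are no `(i-1)`-cochains and `C.cob (0 - 1) 0 = 0`). -/
def HasErrorFlipDecoder (m i : ℕ) : Prop :=
  ∀ e : C.Cochain i, e ≠ 0 → hammingNorm e ≤ m →
    ∃ z, C.deg z = 0 ∧
      ((∃ c : C.Cochain (i - 1), C.BelowCochain z c ∧
          hammingNorm (e + C.cob (i - 1) i c) < hammingNorm e) ∨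
        (∃ c : C.Cochain i, C.BelowCochain z c ∧
          hammingNorm (C.cob i (i + 1) (e + c)) < hammingNorm (C.cob i (i + 1) e)))

/-- `(m, γ)`-small-set syndrome-flip decoder at level `i`.  The errors `e` are those with a nonzero
coboundary: a zero syndrome has no weight to be reduced. -/
def HasSyndromeFlipDecoder (m : ℕ) (γ : ℝ) (i : ℕ) : Prop :=
  ∀ e : C.Cochain i, C.cob i (i + 1) e ≠ 0 → hammingNorm e ≤ m →
    ∀ f : C.Cochain (i + 1), (hammingNorm f : ℝ) ≤ γ * hammingNorm (C.cob i (i + 1) e) →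
      ∃ z, C.deg z = 0 ∧ ∃ c : C.Cochain i, C.BelowCochain z c ∧
        hammingNorm (C.cob i (i + 1) (e + c) + f) < hammingNorm (C.cob i (i + 1) e + f)

/-- `(m, γ)`-small-set flip decoder at level `i`. -/
def HasSmallSetFlipDecoder (m : ℕ) (γ : ℝ) (i : ℕ) : Prop :=
  C.HasErrorFlipDecoder m i ∧ C.HasSyndromeFlipDecoder m γ i

/-- One iteration of the loop of the small-set flip decoding algorithm run on a syndrome
`s ∈ C^{i+1}`: the current guess `a` is replaced by `a + c`. -/
def SSFlipStep {i : ℕ} (s : C.Cochain (i + 1)) (a a' : C.Cochain i) : Prop :=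
  ∃ z, C.deg z = 0 ∧ ∃ c : C.Cochain i, C.BelowCochain z c ∧ a' = a + c ∧
    hammingNorm (s + C.cob i (i + 1) a') < hammingNorm (s + C.cob i (i + 1) a)

/-- `a` is a possible output of the small-set flip decoding algorithm on the syndrome `s`: it is
reached from `0` by iterations of the loop, and no further iteration is possible. -/
def IsSSFlipOutput {i : ℕ} (s : C.Cochain (i + 1)) (a : C.Cochain i) : Prop :=
  Relation.ReflTransGen (C.SSFlipStep s) 0 a ∧ ∀ a', ¬ C.SSFlipStep s a a'

/-- The level-`i` cells as a subset of a set of cells containing them. -/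
def levelEmb {i : ℕ} {S : Finset X} (h : ∀ x, C.deg x = i → x ∈ S) : C.Level i ↪ ↥S where
  toFun x := ⟨x.1, h x.1 x.2⟩
  inj' x y hxy := Subtype.ext (congrArg (fun q : ↥S => q.1) hxy)

/-- Given a placement `ι` of the cells with degree in `I` as vertices of a graph, and a set `B` of
cells (via `e`), a family of sets of vertices induces a family of subsets of `B`; members of the
family containing vertices outside of `B` are ignored. -/
def inducedBad {V B : Type*} {I : Set ℕ} (ι : {x : X // C.deg x ∈ I} → V) (e : B → X)
    (E : Set (Set V)) : Set (Set B) :=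
  {A | ι '' (Subtype.val ⁻¹' (e '' A)) ∈ E}

end BasedCochainComplex

/-! ### Qubits, Pauli operators and Clifford gates -/

/-- Labels of the computational basis states of a register of qubits indexed by `V`. -/
abbrev Bits (V : Type*) : Type _ := V → ZMod 2

/-- Operators on a register of qubits indexed by `V` together with a reference system whose
computational basis is `R`. -/
abbrev Op (V R : Type*) : Type _ := Matrix (Bits V × R) (Bits V × R) ℂ

/-- Names of the single-qubit Pauli matrices. -/
inductive Pauli
  | I
  | X
  | Y
  | Z

namespace Pauli

/-- The single-qubit Pauli matrices. -/
noncomputable def mat : Pauli → Matrix (ZMod 2) (ZMod 2) ℂ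
  | I => 1
  | X => Matrix.of fun a b => if a = b then 0 else 1
  | Y => Matrix.of fun a b => if a = b then 0 else if b = 0 then Complex.I else -Complex.I
  | Z => Matrix.of fun a b => if a = b then (if a = 0 then 1 else -1) else 0

/-- The tensor product of single-qubit Pauli matrices. -/
noncomputable def tensor {V : Type*} [Fintype V] (P : V → Pauli) : Matrix (Bits V) (Bits V) ℂ :=
  Matrix.of fun x y => ∏ v, (P v).mat (x v) (y v)

end Pauli

/-- The operator acting as `A` on the qubit `q` and as the identity on the other qubits. -/
noncomputable def onQubit {V : Type*} [Fintype V] [DecidableEq V] (q : V)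
    (A : Matrix (ZMod 2) (ZMod 2) ℂ) : Matrix (Bits V) (Bits V) ℂ :=
  Matrix.of fun x y => if ∀ v, v ≠ q → x v = y v then A (x q) (y q) else 0

/-- `σ ↦ (A ⊗ 1) σ (B ⊗ 1)`, with the identity on the reference system. -/
noncomputable def sandwich {V R : Type*} [Fintype V] [DecidableEq V] [Fintype R] [DecidableEq R]
    (A B : Matrix (Bits V) (Bits V) ℂ) (σ : Op V R) : Op V R :=
  (A ⊗ₖ (1 : Matrix R R ℂ)) * σ * (B ⊗ₖ (1 : Matrix R R ℂ))

/-- Clifford gates. -/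
inductive CliffordGate (V : Type*)
  | pauli (P : Pauli) (q : V)
  | hadamard (q : V)
  | phase (q : V)
  | cnot (control target : V) (h : control ≠ target)
  | measure (P : Pauli) (hP : P ≠ Pauli.I) (q : V)
  | resetZero (q : V)
  | resetPlus (q : V)

namespace CliffordGate

variable {V : Type*}

/-- The set of qubits on which a gate acts. -/
def qubits : CliffordGate V → Set V
  | pauli _ q => {q}
  | hadamard q => {q}
  | phase q => {q}
  | cnot c t _ => {c, t}
  | measure _ _ q => {q}
  | resetZero q => {q}
  | resetPlus q => {q}

variable [Fintype V] [DecidableEq V]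

/-- The operator of the Hadamard gate on one qubit. -/
noncomputable def hadamardMat : Matrix (ZMod 2) (ZMod 2) ℂ :=
  Matrix.of fun a b => ((Real.sqrt 2 : ℝ) : ℂ)⁻¹ * (if a = 1 ∧ b = 1 then -1 else 1)

/-- The operator `S = √Z` on one qubit. -/
noncomputable def phaseMat : Matrix (ZMod 2) (ZMod 2) ℂ :=
  Matrix.of fun a b => if a = b then (if a = 0 then 1 else Complex.I) else 0

/-- The operator `|x, y⟩ ↦ |x, x + y⟩` on the qubits `c, t`. -/
noncomputable def cnotMat (c t : V) : Matrix (Bits V) (Bits V) ℂ :=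
  Matrix.of fun x y => if x = Function.update y t (y t + y c) then 1 else 0

/-- The projection `(1 + (-1)^b P) / 2` onto the states with measurement outcome `b` of the Pauli
`P` on the qubit `q`. -/
noncomputable def proj (P : Pauli) (q : V) (b : ZMod 2) : Matrix (Bits V) (Bits V) ℂ :=
  onQubit q ((2 : ℂ)⁻¹ • (1 + (if b = 0 then (1 : ℂ) else -1) • P.mat))

/-- The one-qubit operator `|0⟩⟨b|`. -/
noncomputable def ketZeroBra (b : ZMod 2) : Matrix (ZMod 2) (ZMod 2) ℂ :=
  Matrix.of fun x y => if x = 0 ∧ y = b then 1 else 0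

/-- The one-qubit operator `|+⟩⟨b|`. -/
noncomputable def ketPlusBra (b : ZMod 2) : Matrix (ZMod 2) (ZMod 2) ℂ :=
  Matrix.of fun _ y => if y = b then ((Real.sqrt 2 : ℝ) : ℂ)⁻¹ else 0

/-- The quantum channel of a gate.  (For a measurement this is the channel that forgets the outcome;
the outcome is recorded by `CliffordGate.apply` below.) -/
noncomputable def channel {R : Type*} [Fintype R] [DecidableEq R] :
    CliffordGate V → Op V R → Op V R
  | pauli P q, σ => sandwich (onQubit q P.mat) (onQubit q P.mat)ᴴ σ
  | hadamard q, σ => sandwich (onQubit q hadamardMat) (onQubit q hadamardMat)ᴴ σ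
  | phase q, σ => sandwich (onQubit q phaseMat) (onQubit q phaseMat)ᴴ σ
  | cnot c t _, σ => sandwich (cnotMat c t) (cnotMat c t)ᴴ σ
  | measure P _ q, σ => ∑ b : ZMod 2, sandwich (proj P q b) (proj P q b)ᴴ σ
  | resetZero q, σ =>
      ∑ b : ZMod 2, sandwich (onQubit q (ketZeroBra b)) (onQubit q (ketZeroBra b))ᴴ σ
  | resetPlus q, σ =>
      ∑ b : ZMod 2, sandwich (onQubit q (ketPlusBra b)) (onQubit q (ketPlusBra b))ᴴ σ

end CliffordGate

/-! ### Adaptive Clifford circuits -/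

/-- An operator on the qubits `V`, an `M`-bit classical register and a reference system, whose
classical register is a computational basis state: `∑ x, σ x ⊗ |x⟩⟨x|`. -/
abbrev CQOp (V : Type*) (M : ℕ) (R : Type*) : Type _ := Bits (Fin M) → Op V R

/-- Gate number `i` of a time step.  A measurement is always performed, and its outcome overwrites the
classical bit `i`; any other gate is applied if the classical bit `i` is `1`. -/
noncomputable def CliffordGate.apply {V R : Type*} [Fintype V] [DecidableEq V] [Fintype R]
    [DecidableEq R] {M : ℕ} (i : Fin M) : CliffordGate V → CQOp V M R → CQOp V M R
  | .measure P _ q, σ => fun y =>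
      ∑ x : Bits (Fin M), if Function.update x i (y i) = y then
        sandwich (CliffordGate.proj P q (y i)) (CliffordGate.proj P q (y i))ᴴ (σ x) else 0
  | g, σ => fun x => if x i = 1 then g.channel (σ x) else σ x

/-- A time step on the qubits `V` with `M` classical bits: a classical computation on the classical
register followed by Clifford gates on disjoint sets of qubits. -/
structure TimeStep (V : Type*) (M : ℕ) where
  classical : Bits (Fin M) → Bits (Fin M)
  numGates : ℕ
  numGates_le : numGates ≤ M
  gate : Fin numGates → CliffordGate V
  disjoint : ∀ g h, g ≠ h → Disjoint (gate g).qubits (gate h).qubits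

namespace TimeStep

variable {V : Type*} {M : ℕ}

/-- The classical bit associated with a gate. -/
def bit (s : TimeStep V M) (g : Fin s.numGates) : Fin M := Fin.castLE s.numGates_le g

/-- The action of a time step. -/
noncomputable def apply [Fintype V] [DecidableEq V] {R : Type*} [Fintype R] [DecidableEq R]
    (s : TimeStep V M) (σ : CQOp V M R) : CQOp V M R :=
  (List.finRange s.numGates).foldl (fun τ g => (s.gate g).apply (s.bit g) τ)
    (fun y => ∑ x : Bits (Fin M), if s.classical x = y then σ x else 0)

end TimeStep

/-- An adaptive Clifford circuit on the qubits `V`, using quantum space `|V|`, classical space `M` and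
time `T`. -/
structure AdaptiveCircuit (V : Type*) [Fintype V] where
  M : ℕ
  space_le : Fintype.card V ≤ M
  T : ℕ
  step : Fin T → TimeStep V M

/-- A Pauli superoperator `σ ↦ F σ F'` on the qubits `V`. -/
structure PauliSuperop (V : Type*) where
  left : V → Pauli
  right : V → Pauli

namespace PauliSuperop

variable {V : Type*}

/-- The set of qubits on which a Pauli superoperator acts nontrivially. -/
def support (F : PauliSuperop V) : Set V := {v | F.left v ≠ Pauli.I ∨ F.right v ≠ Pauli.I}

/-- The action of a Pauli superoperator. -/
noncomputable def apply [Fintype V] [DecidableEq V] {R : Type*} [Fintype R] [DecidableEq R]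
    (F : PauliSuperop V) (σ : Op V R) : Op V R :=
  sandwich (Pauli.tensor F.left) (Pauli.tensor F.right) σ

end PauliSuperop

/-- The support (fault path) of a Pauli fault: one Pauli superoperator after each time step. -/
def faultSupport {V : Type*} {T : ℕ} (F : Fin T → PauliSuperop V) : Set (V × Fin T) :=
  {p | p.1 ∈ (F p.2).support}

/-- The circuit `Q` corrupted by the Pauli fault `F`: after every time step `t` the superoperator
`F t` is applied to the qubits; the classical register is never corrupted. -/
noncomputable def AdaptiveCircuit.run {V : Type*} [Fintype V] [DecidableEq V] {R : Type*} [Fintype R]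
    [DecidableEq R] (Q : AdaptiveCircuit V) (F : Fin Q.T → PauliSuperop V) (σ : CQOp V Q.M R) :
    CQOp V Q.M R :=
  (List.finRange Q.T).foldl (fun τ t x => (F t).apply ((Q.step t).apply τ x)) σ

/-! ### Decorated codes and Pauli fault-tolerant gadgets -/

/-- A decorated code: a quantum code with physical qubits `B` and `k` logical qubits, given through its
encoding isometry, together with a family of bad sets of physical qubits. -/
structure DecoratedCode (B : Type*) [Fintype B] [DecidableEq B] (k : ℕ) where
  enc : Matrix (Bits B) (Bits (Fin k)) ℂ
  isometry : encᴴ * enc = 1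
  bad : Set (Set B)

/-- The trivial decorated code on `0` qubits. -/
def DecoratedCode.trivial : DecoratedCode (Fin 0) 0 where
  enc := 1
  isometry := by simp
  bad := ∅

/-- The encoding channel `Enc ⊗ 𝓘`. -/
noncomputable def DecoratedCode.encode {B : Type*} [Fintype B] [DecidableEq B] {k : ℕ} {R : Type*}
    [Fintype R] [DecidableEq R] (D : DecoratedCode B k) (ρ : Op (Fin k) R) : Op B R :=
  (D.enc ⊗ₖ (1 : Matrix R R ℂ)) * ρ * (D.enc ⊗ₖ (1 : Matrix R R ℂ))ᴴ

/-- Partial trace over the qubits of `V` outside of the block `B`. -/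
noncomputable def traceOut {B V R : Type*} [Fintype B] [Fintype V] [DecidableEq V]
    (e : B ↪ V) (σ : Op V R) : Op B R :=
  open Classical in
  Matrix.of fun a b => ∑ x : Bits V, ∑ y : Bits V,
    if x ∘ e = a.1 ∧ y ∘ e = b.1 ∧ (∀ v, v ∉ Set.range e → x v = y v) then
      σ (x, a.2) (y, b.2) else 0

/-- `σ` is a Pauli deviation of the encoded state `Enc(ρ)`, where the code block is the set of qubits
`e : B ↪ V`: after the classical register and the other qubits are traced out, `σ` is proportional to
a Pauli superoperator of avoiding support applied to `Enc(ρ)`. -/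
def IsPauliDeviation {B V R : Type*} [Fintype B] [DecidableEq B] [Fintype V] [DecidableEq V]
    [Fintype R] [DecidableEq R] {k M : ℕ} (D : DecoratedCode B k) (e : B ↪ V)
    (ρ : Op (Fin k) R) (σ : CQOp V M R) : Prop :=
  ∃ F : PauliSuperop B, Avoids D.bad F.support ∧
    ∃ c : ℂ, traceOut e (∑ x, σ x) = c • F.apply (D.encode ρ)

/-- The superoperator `O ⊗ 𝓘` acting on the qubits and trivially on the reference system. -/
def tensorId {K L R : Type*}
    (O : Matrix (Bits K) (Bits K) ℂ →ₗ[ℂ] Matrix (Bits L) (Bits L) ℂ) (ρ : Op K R) : Op L R :=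
  Matrix.of fun a b => O (Matrix.of fun x y => ρ (x, a.2) (y, b.2)) a.1 b.1

/-- `((Q, bad), Din, Dout)` is a Pauli fault-tolerant gadget (without classical input and output) for
the channel `O`. -/
def IsPauliFaultTolerantGadget {V Bin Bout : Type*} [Fintype V] [DecidableEq V]
    [Fintype Bin] [DecidableEq Bin] [Fintype Bout] [DecidableEq Bout] {kin kout : ℕ}
    (Q : AdaptiveCircuit V) (bad : Set (Set (V × Fin Q.T)))
    (Din : DecoratedCode Bin kin) (ein : Bin ↪ V)
    (Dout : DecoratedCode Bout kout) (eout : Bout ↪ V)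
    (O : Matrix (Bits (Fin kin)) (Bits (Fin kin)) ℂ →ₗ[ℂ]
      Matrix (Bits (Fin kout)) (Bits (Fin kout)) ℂ) : Prop :=
  ∀ (ℓ : ℕ) (ρ : Op (Fin kin) (Bits (Fin ℓ))), ρ.PosSemidef → ρ.trace = 1 →
    ∀ σ : CQOp V Q.M (Bits (Fin ℓ)), IsPauliDeviation Din ein ρ σ →
      ∀ F : Fin Q.T → PauliSuperop V, Avoids bad (faultSupport F) →
        IsPauliDeviation Dout eout (tensorId O ρ) (Q.run F σ)

/-- The channel from `0` qubits to `k` qubits that prepares the pure state `ψ`. -/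
noncomputable def prepareChannel {k : ℕ} (ψ : Bits (Fin k) → ℂ) :
    Matrix (Bits (Fin 0)) (Bits (Fin 0)) ℂ →ₗ[ℂ] Matrix (Bits (Fin k)) (Bits (Fin k)) ℂ :=
  (Matrix.traceLinearMap (Bits (Fin 0)) ℂ ℂ).smulRight (Matrix.vecMulVec ψ (star ψ))

/-- The state `|+^k⟩`. -/
noncomputable def plusState (k : ℕ) : Bits (Fin k) → ℂ :=
  fun _ => (((Real.sqrt 2 : ℝ) : ℂ)⁻¹) ^ k

/-- The state `|0^k⟩`. -/
def zeroState (k : ℕ) : Bits (Fin k) → ℂ :=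
  fun x => if x = 0 then 1 else 0

/-! ### The CSS code of a level of a cochain complex -/

namespace BasedCochainComplex

variable {X : Type*} [Fintype X] {r : ℕ} (C : BasedCochainComplex X r)

theorem cob_cob (j l : ℕ) (c : C.Cochain j) : C.cob l (l + 1) (C.cob j l c) = 0 := by
  by_cases hl : l = j + 1
  · subst hl
    have h : (C.δ.submatrix (Subtype.val : C.Level (j + 1 + 1) → X)
          (Subtype.val : C.Level (j + 1) → X)) *
        (C.δ.submatrix (Subtype.val : C.Level (j + 1) → X) (Subtype.val : C.Level j → X)) = 0 := by
      ext z x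
      have h2 := congrFun (congrFun C.δ_sq z.1) x.1
      rw [Matrix.mul_apply, Matrix.zero_apply] at h2
      rw [Matrix.mul_apply, Matrix.zero_apply, ← h2,
        ← Finset.sum_filter_of_ne (p := fun y => C.deg y = j + 1)]
      · rw [← Finset.sum_subtype_of_mem (f := fun y => C.δ z.1 y * C.δ y x.1)
          (p := fun y => C.deg y = j + 1)
          (s := Finset.univ.filter fun y => C.deg y = j + 1) (by simp)]
        refine Finset.sum_congr ?_ fun _ _ => rfl
        ext y
        simp [y.2]
      · intro y _ hy
        rw [C.deg_eq x.1 y (right_ne_zero_of_mul hy), x.2]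
    simp only [cob, Matrix.mulVecLin_apply, Matrix.mulVec_mulVec, h, Matrix.zero_mulVec]
  · have h : C.cob j l c = 0 := by
      ext y
      simp only [cob, Matrix.mulVecLin_apply, Matrix.mulVec, dotProduct, Matrix.submatrix_apply,
        Pi.zero_apply]
      refine Finset.sum_eq_zero fun x _ => ?_
      by_cases hx : C.δ y.1 x.1 = 0
      · simp [hx]
      · exact absurd (by have := C.deg_eq _ _ hx; rw [x.2, y.2] at this; exact this) hl
    rw [h, map_zero]

theorem coboundaries_le (i : ℕ) : C.coboundaries i ≤ C.cocycles i := by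
  rintro _ ⟨c, rfl⟩
  exact C.cob_cob _ _ c

/-- The cosets: `z` is a cocycle that represents the cohomology class `h`. -/
def Represents {i : ℕ} (z : C.Cochain i) (h : C.Cohomology i) : Prop :=
  ∃ hz : z ∈ C.cocycles i, Submodule.Quotient.mk ⟨z, hz⟩ = h

open Classical in
/-- The matrix of the encoding isometry `|x⟩ ↦ |Enc(x)⟩` of a CSS encoding map: `|Enc(x)⟩` is the
uniform superposition over the cocycles in the coset `Enc(x)`. -/
noncomputable def encMatrix {i k : ℕ} (Enc : (Fin k → ZMod 2) ≃ₗ[ZMod 2] C.Cohomology i) :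
    Matrix (Bits (C.Level i)) (Bits (Fin k)) ℂ :=
  Matrix.of fun z x => if C.Represents z (Enc x) then
    ((Real.sqrt (Nat.card (C.coboundaries i)) : ℝ) : ℂ)⁻¹ else 0

open Classical in
theorem card_represents {i : ℕ} (h : C.Cohomology i) :
    (Finset.univ.filter fun z : C.Cochain i => C.Represents z h).card =
      Nat.card (C.coboundaries i) := by
  obtain ⟨⟨z0, hz0⟩, rfl⟩ := Submodule.Quotient.mk_surjective _ h
  rw [Nat.card_eq_fintype_card, ← Fintype.card_subtype]
  have key : ∀ z : C.Cochain i, C.Represents z (Submodule.Quotient.mk ⟨z0, hz0⟩) ↔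
      z - z0 ∈ C.coboundaries i := by
    intro z
    constructor
    · rintro ⟨hz, h⟩
      rw [Submodule.Quotient.eq] at h
      exact h
    · intro hz
      have hz' : z ∈ C.cocycles i := by
        have := (C.cocycles i).add_mem (C.coboundaries_le i hz) hz0
        rwa [sub_add_cancel] at this
      refine ⟨hz', ?_⟩
      rw [Submodule.Quotient.eq]
      exact hz
  refine Fintype.card_congr ⟨fun z => ⟨z.1 - z0, (key _).1 z.2⟩,
    fun b => ⟨b.1 + z0, (key _).2 (by simp)⟩, fun z => ?_, fun b => ?_⟩
  · simp
  · simp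

theorem encMatrix_isometry {i k : ℕ} [DecidableEq (C.Level i)]
    (Enc : (Fin k → ZMod 2) ≃ₗ[ZMod 2] C.Cohomology i) :
    (C.encMatrix Enc)ᴴ * C.encMatrix Enc = 1 := by
  classical
  ext x y
  rw [Matrix.mul_apply]
  simp only [Matrix.conjTranspose_apply, encMatrix, Matrix.of_apply]
  by_cases hxy : x = y
  · subst hxy
    rw [Matrix.one_apply_eq]
    have hpos : 0 < Nat.card (C.coboundaries i) := Nat.card_pos
    have : ∀ z : Bits (C.Level i),
        star (if C.Represents z (Enc x) then
          ((Real.sqrt (Nat.card (C.coboundaries i)) : ℝ) : ℂ)⁻¹ else 0) *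
        (if C.Represents z (Enc x) then
          ((Real.sqrt (Nat.card (C.coboundaries i)) : ℝ) : ℂ)⁻¹ else 0) =
        if C.Represents z (Enc x) then ((Nat.card (C.coboundaries i) : ℕ) : ℂ)⁻¹ else 0 := by
      intro z
      split_ifs
      · rw [star_inv₀, Complex.star_def, Complex.conj_ofReal, ← mul_inv, ← Complex.ofReal_mul,
          Real.mul_self_sqrt (Nat.cast_nonneg _)]
        simp
      · simp
    simp only [this]
    have hc := C.card_represents (Enc x)
    rw [← Finset.sum_filter, Finset.sum_const, nsmul_eq_mul]
    have hc' : (Finset.univ.filter fun z : Bits (C.Level i) => C.Represents z (Enc x)).card =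
        Nat.card (C.coboundaries i) := by
      rw [← hc]
      convert rfl
    rw [hc']
    exact mul_inv_cancel₀ (by exact_mod_cast hpos.ne')
  · rw [Matrix.one_apply_ne hxy]
    refine Finset.sum_eq_zero fun z _ => ?_
    by_cases h1 : C.Represents z (Enc x)
    · by_cases h2 : C.Represents z (Enc y)
      · obtain ⟨_, h1⟩ := h1
        obtain ⟨_, h2⟩ := h2
        exact absurd (Enc.injective (h1.symm.trans h2)) hxy
      · simp [h2]
    · simp [h1]

/-- The CSS code associated to level `i` of the complex, decorated with a CSS encoding map, i.e. an
isomorphism `Enc : 𝔽₂^k ≃ H^i`, and a family of bad sets. -/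
noncomputable def decoratedCode {i k : ℕ} [DecidableEq (C.Level i)]
    (Enc : (Fin k → ZMod 2) ≃ₗ[ZMod 2] C.Cohomology i) (bad : Set (Set (C.Level i))) :
    DecoratedCode (C.Level i) k where
  enc := C.encMatrix Enc
  isometry := C.encMatrix_isometry Enc
  bad := bad

end BasedCochainComplex

/-! ### Single-shot state preparation circuits -/

/-- `plus`: preparation of `|+^k⟩`; `zero`: preparation of `|0^k⟩`, in which the roles of the Pauli
bases are exchanged. -/
inductive PrepBasis
  | plus
  | zero

namespace PrepBasis

variable {V : Type*}

/-- Initialization of a data qubit: `|+⟩`, resp. `|0⟩`. -/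
def resetData : PrepBasis → V → CliffordGate V
  | plus, q => .resetPlus q
  | zero, q => .resetZero q

/-- Initialization of an ancilla qubit: `|0⟩`, resp. `|+⟩`. -/
def resetAncilla : PrepBasis → V → CliffordGate V
  | plus, q => .resetZero q
  | zero, q => .resetPlus q

/-- The coupling of a data qubit `d` and an ancilla qubit `a`: a `CNOT` controlled by the data qubit,
resp. by the ancilla qubit. -/
def coupling : PrepBasis → (d a : V) → d ≠ a → CliffordGate V
  | plus, d, a, h => .cnot d a h
  | zero, d, a, h => .cnot a d h.symm

/-- Measurement of an ancilla qubit in the Pauli `Z`, resp. `X` basis. -/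
def readout : PrepBasis → V → CliffordGate V
  | plus, q => .measure .Z (by simp) q
  | zero, q => .measure .X (by simp) q

/-- Correction of a data qubit by the Pauli `X`, resp. `Z`. -/
def correction : PrepBasis → V → CliffordGate V
  | plus, q => .pauli .X q
  | zero, q => .pauli .Z q

end PrepBasis

/-- The circuit `Q`, whose qubits are the set `S` of basis elements of `D`, is a run of single-shot state
preparation at level `j` of `D`, with the elements of degree `j` as data qubits and the elements of
degree `j + 1` as ancilla qubits:
* the first time step resets all qubits;
* up to the last two time steps, each incident pair of a data qubit and an ancilla qubit is coupled
  exactly once, and nothing else is done (so that the ancilla qubits hold the syndrome `δ_j`);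
* the last but one time step measures all ancilla qubits, and is the only one with measurements;
* the last time step applies a Pauli correction to the data qubits.  It is computed from the measured
  syndrome `s` as a solution `x` of the linear system `δ x = s + dec (δ s)` whenever there is one,
  where `dec` is small-set flip decoding at level `j + 1`. -/
structure IsSingleShotPreparation {X : Type*} [Fintype X] {r : ℕ} (D : BasedCochainComplex X r)
    (j : ℕ) (b : PrepBasis) {S : Finset X} (Q : AdaptiveCircuit ↥S) : Prop where
  three_le : 3 ≤ Q.T
  deg_mem : ∀ q ∈ S, D.deg q = j ∨ D.deg q = j + 1
  data_mem : ∀ x, D.deg x = j → x ∈ S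
  /- Outside of the measurement step and the correction step, every gate is applied. -/
  unconditional : ∀ t : Fin Q.T, t.val + 2 < Q.T → ∀ x g, (Q.step t).classical x ((Q.step t).bit g) = 1
  init_gates : ∀ t : Fin Q.T, t.val = 0 → ∀ g, ∃ q : ↥S,
    (D.deg q.1 = j ∧ (Q.step t).gate g = b.resetData q) ∨
      (D.deg q.1 = j + 1 ∧ (Q.step t).gate g = b.resetAncilla q)
  init_all : ∀ t : Fin Q.T, t.val = 0 → ∀ q : ↥S, ∃ g, q ∈ ((Q.step t).gate g).qubits
  coupling_gates : ∀ t : Fin Q.T, 0 < t.val → t.val + 2 < Q.T → ∀ g, ∃ d a : ↥S, ∃ h : d ≠ a,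
    D.deg d.1 = j ∧ D.Incident d.1 a.1 ∧ (Q.step t).gate g = b.coupling d a h
  coupling_all : ∀ x y : X, D.deg x = j → D.Incident x y → ∃ d a : ↥S, ∃ h : d ≠ a,
    d.1 = x ∧ a.1 = y ∧
      ∃! p : (Σ t : Fin Q.T, Fin (Q.step t).numGates), (Q.step p.1).gate p.2 = b.coupling d a h
  readout_gates : ∀ t : Fin Q.T, t.val + 2 = Q.T → ∀ g, ∃ a : ↥S, D.deg a.1 = j + 1 ∧
    (Q.step t).gate g = b.readout a
  readout_all : ∀ t : Fin Q.T, t.val + 2 = Q.T → ∀ a : ↥S, D.deg a.1 = j + 1 → ∃ g,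
    (Q.step t).gate g = b.readout a
  correction_gates : ∀ t : Fin Q.T, t.val + 1 = Q.T → ∀ g, ∃ d : ↥S, D.deg d.1 = j ∧
    (Q.step t).gate g = b.correction d
  correction_all : ∀ t : Fin Q.T, t.val + 1 = Q.T → ∀ d : ↥S, D.deg d.1 = j → ∃ g,
    (Q.step t).gate g = b.correction d
  decoding : ∃ dec : D.Cochain (j + 2) → D.Cochain (j + 1),
    (∀ z, D.IsSSFlipOutput z (dec z)) ∧
    ∀ t t' : Fin Q.T, t.val + 2 = Q.T → t'.val + 1 = Q.T →
      ∀ (y : Bits (Fin Q.M)) (s : D.Cochain (j + 1)) (x : D.Cochain j),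
        /- `s` is the syndrome stored in the register `y` after the measurement: -/
        (∀ (a : D.Level (j + 1)) (h : a.1 ∈ S) g,
          (Q.step t).gate g = b.readout ⟨a.1, h⟩ → s a = y ((Q.step t).bit g)) →
        (∀ a : D.Level (j + 1), a.1 ∉ S → s a = 0) →
        /- `x` is the correction computed from `y`: -/
        (∀ (d : D.Level j) (h : d.1 ∈ S) g, (Q.step t').gate g = b.correction ⟨d.1, h⟩ →
          x d = (Q.step t').classical y ((Q.step t').bit g)) →
        (∃ x', D.cob j (j + 1) x' = s + dec (D.cob (j + 1) (j + 2) s)) →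
          D.cob j (j + 1) x = s + dec (D.cob (j + 1) (j + 2) s)

/-! Both preparations are one argument about a complex `D` and a level `j`. For `|0^k⟩` one passes
to the dual complex and describes states by their Hadamard transforms (`PrepBasis.frame`); this
exchanges the Pauli bases and reverses the `CNOT`s.

Quantum part. A fault `F · F'` acts independently on the two factors of a rank one operator, so each
factor is tracked separately as a Pauli error `Z^p X^u` applied to the vector of a run without
faults (`twisted`). A coupling copies shifts from data to ancilla qubits and phases from ancilla to
data qubits. As the couplings form a bipartite graph, an error never travels further than one
incidence from a fault (`ErrorFrom`). If `u` is the shift error on the ancilla qubits when they are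
measured and `s` is the outcome, then the data strings `x` that survive satisfy `δ x = s + u`.

Correction. Since `δ δ = 0`, this gives `δ s = δ u`, so the decoder sees nothing but `u`. The
combinatorial core `exists_sparse_cob_eq` says that its output `a` satisfies `u + a = δ g` for a
sparse cochain `g`. Thus `s + a = δ (x + g)` is solvable, and after the correction the data strings
are exactly the cocycles shifted by `g`, whatever `s` was. All syndromes therefore lead to the same
deviation, by some `g` on the left and some `g'` on the right. The ancilla qubits split off as a
tensor factor and are traced out to a scalar (`shift_corr_measured_eq_tensorVec`,
`traceOut_outputTerm`). The superposition of all cocycles is `Enc |+^k⟩`. In the dual case the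
cocycles of the dual complex are the orthogonal complement of the coboundaries, so their Hadamard
transform is the superposition of the coboundaries, which is `Enc |0^k⟩`.

Combinatorial part. Take the union of the stars of the cells of `u` and of the cells above the base
cell of each flip. In a component that contains a set `A` of error cells, the initial syndrome has
weight at most `w |A|` and each flip lowers it, so there are at most `w |A|` flips and at most `2 w²
|A|` vertices. Sparsity of `u` then excludes components of more than `m` vertices. The restriction
of `u + a` to a component thus has weight at most `m`. If its coboundary were nonzero, the
syndrome-flip property would provide one more flip, contrary to termination; so it is a cocycle. The
error-flip property writes it as the coboundary of a cochain living in a connected set of at most `4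
w³ |A|` vertices. By `IsSparse.spread`, replacing the sets `A` by such connected sets costs only a
constant factor in sparsity.

Constants. Faults of density `γ` in each of `2w + 4 ≤ 6w` steps have density `6wγ` together, their
incidence neighborhood has density `12w²γ`, and each of `g`, `g'` has density `96w⁵γ`. The sum is at
most `204w⁵γ`, well within the stated bound. -/

set_option linter.unusedSectionVars false

/-! ### Sparse vertex sets of a graph -/

section Sparse

variable {V : Type*}

/-- A set of vertices that is connected in `G`: it is nonempty, and it cannot be left out of a set that it
meets and that is closed under adjacency within it. -/
def IsConnectedSet (G : SimpleGraph V) (s : Set V) : Prop :=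
  s.Nonempty ∧ ∀ T : Set V, (s ∩ T).Nonempty →
    (∀ a ∈ s, ∀ b ∈ s, a ∈ T → G.Adj a b → b ∈ T) → s ⊆ T

/-- `A` contains less than a fraction `β` of every connected set of at least `η` vertices. -/
def IsSparse (G : SimpleGraph V) (η β : ℝ) (A : Set V) : Prop :=
  ∀ s, IsConnectedSet G s → η ≤ (s.ncard : ℝ) → ((A ∩ s).ncard : ℝ) < β * s.ncard

variable {G : SimpleGraph V}

theorem IsConnectedSet.union {s t : Set V} (hs : IsConnectedSet G s) (ht : IsConnectedSet G t)
    (h : (s ∩ t).Nonempty) : IsConnectedSet G (s ∪ t) := by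
  refine ⟨hs.1.mono Set.subset_union_left, fun T hT hcl => ?_⟩
  obtain ⟨z, hzs, hzt⟩ := h
  have h1 : (s ∩ T).Nonempty → s ⊆ T := fun h =>
    hs.2 T h fun a ha b hb => hcl a (Or.inl ha) b (Or.inl hb)
  have h2 : (t ∩ T).Nonempty → t ⊆ T := fun h =>
    ht.2 T h fun a ha b hb => hcl a (Or.inr ha) b (Or.inr hb)
  obtain ⟨x, hx | hx, hxT⟩ := hT
  · have hsT := h1 ⟨x, hx, hxT⟩
    exact Set.union_subset hsT (h2 ⟨z, hzt, hsT hzs⟩)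
  · have htT := h2 ⟨x, hx, hxT⟩
    exact Set.union_subset (h1 ⟨z, hzs, htT hzt⟩) htT

theorem IsConnectedSet.union_biUnion {ι : Type*} {s : Set V} (hs : IsConnectedSet G s)
    (F : Finset ι) (J : ι → Set V) (hJ : ∀ i ∈ F, IsConnectedSet G (J i))
    (hit : ∀ i ∈ F, (s ∩ J i).Nonempty) : IsConnectedSet G (s ∪ ⋃ i ∈ F, J i) := by
  classical
  induction F using Finset.induction_on with
  | empty => simpa using hs
  | insert i F hi ih =>
    have h1 := ih (fun k hk => hJ k (Finset.mem_insert_of_mem hk))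
      (fun k hk => hit k (Finset.mem_insert_of_mem hk))
    have h2 : s ∪ ⋃ k ∈ insert i F, J k = (s ∪ ⋃ k ∈ F, J k) ∪ J i := by
      rw [Finset.set_biUnion_insert, Set.union_comm (J i), Set.union_assoc]
    rw [h2]
    exact h1.union (hJ i (Finset.mem_insert_self _ _))
      ((hit i (Finset.mem_insert_self _ _)).mono
        (Set.inter_subset_inter_left _ Set.subset_union_left))

/-- A star is connected. -/
theorem isConnectedSet_of_center {s : Set V} (v : V) (hv : v ∈ s)
    (h : ∀ a ∈ s, a ≠ v → G.Adj v a) : IsConnectedSet G s := by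
  refine ⟨⟨v, hv⟩, ?_⟩
  rintro T ⟨x, hx, hxT⟩ hcl
  have hvT : v ∈ T := by
    by_cases hxv : x = v
    · exact hxv ▸ hxT
    · exact hcl x hx v hv hxT (h x hx hxv).symm
  intro a ha
  by_cases hav : a = v
  · exact hav ▸ hvT
  · exact hcl v hv a ha hvT (h a ha hav)

/-- Together with `IsConnectedSet.connected` this reduces bad sets to vertex sets: the edges of the
subgraph play no role, because the induced subgraph on the same vertices is connected as well. -/
theorem SimpleGraph.Subgraph.Connected.isConnectedSet {G' : G.Subgraph} (h : G'.Connected) :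
    IsConnectedSet G G'.verts := by
  rw [SimpleGraph.Subgraph.connected_iff'] at h
  refine ⟨?_, ?_⟩
  · obtain ⟨x⟩ := h.nonempty
    exact ⟨x.1, x.2⟩
  · rintro T ⟨x, hx, hxT⟩ hcl y hy
    have hr := h.preconnected ⟨x, hx⟩ ⟨y, hy⟩
    rw [SimpleGraph.reachable_iff_reflTransGen] at hr
    have key : ∀ z : G'.verts, Relation.ReflTransGen G'.coe.Adj ⟨x, hx⟩ z → z.1 ∈ T := by
      intro z hz
      induction hz with
      | refl => exact hxT
      | tail _ hab ih => exact hcl _ (Subtype.coe_prop _) _ (Subtype.coe_prop _) ih hab.adj_sub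
    exact key _ hr

theorem IsConnectedSet.connected {s : Set V} (h : IsConnectedSet G s) :
    ((⊤ : G.Subgraph).induce s).Connected := by
  rw [SimpleGraph.Subgraph.connected_iff', SimpleGraph.connected_iff_exists_forall_reachable]
  obtain ⟨⟨x, hx⟩, hs⟩ := h
  refine ⟨⟨x, hx⟩, ?_⟩
  have := hs {y | ∃ hy : y ∈ s, ((⊤ : G.Subgraph).induce s).coe.Reachable ⟨x, hx⟩ ⟨y, hy⟩}
    ⟨x, hx, hx, SimpleGraph.Reachable.refl _⟩ ?_
  · rintro ⟨w, hw⟩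
    exact (this hw).2
  · rintro a ha b hb ⟨_, hr⟩ hab
    refine ⟨hb, hr.trans (SimpleGraph.Adj.reachable ?_)⟩
    simp only [SimpleGraph.Subgraph.coe_adj, SimpleGraph.Subgraph.induce_adj,
      SimpleGraph.Subgraph.top_adj]
    exact ⟨ha, hb, hab⟩

theorem ncard_biUnion_le {ι : Type*} [Finite V] (F : Finset ι) (J : ι → Set V) :
    (⋃ i ∈ F, J i).ncard ≤ ∑ i ∈ F, (J i).ncard := by
  classical
  induction F using Finset.induction_on with
  | empty => simp
  | insert i F hi ih =>
    rw [Finset.set_biUnion_insert, Finset.sum_insert hi]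
    exact (Set.ncard_union_le _ _).trans (by omega)

theorem ncard_biUnion_eq {ι : Type*} [Finite V] (F : Finset ι) (J : ι → Set V)
    (hd : ∀ i k, i ≠ k → Disjoint (J i) (J k)) :
    (⋃ i ∈ F, J i).ncard = ∑ i ∈ F, (J i).ncard := by
  classical
  induction F using Finset.induction_on with
  | empty => simp
  | insert i F hi ih =>
    rw [Finset.set_biUnion_insert, Finset.sum_insert hi, Set.ncard_union_eq, ih]
    rw [Set.disjoint_iUnion₂_right]
    intro k hk
    exact hd i k fun h => hi (h ▸ hk)

namespace IsSparse

variable {η : ℝ}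

theorem mono [Finite V] {β β' : ℝ} {A A' : Set V} (h : IsSparse G η β A) (hA : A' ⊆ A)
    (hβ : β ≤ β') : IsSparse G η β' A' := by
  intro s hs hη
  have h1 := h s hs hη
  have h2 : ((A' ∩ s).ncard : ℝ) ≤ (A ∩ s).ncard := by
    exact_mod_cast Set.ncard_le_ncard (Set.inter_subset_inter_left _ hA) (Set.toFinite _)
  have h3 : β * s.ncard ≤ β' * s.ncard := by gcongr
  linarith

theorem union [Finite V] {β β' : ℝ} {A A' : Set V} (h : IsSparse G η β A)
    (h' : IsSparse G η β' A') : IsSparse G η (β + β') (A ∪ A') := by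
  intro s hs hη
  have h1 := h s hs hη
  have h2 := h' s hs hη
  have h3 : (((A ∪ A') ∩ s).ncard : ℝ) ≤ (A ∩ s).ncard + (A' ∩ s).ncard := by
    rw [Set.union_inter_distrib_right]
    exact_mod_cast Set.ncard_union_le _ _
  linarith

theorem iUnion_fin [Finite V] {β : ℝ} {T : ℕ} (hT : 0 < T) {A : Fin T → Set V}
    (h : ∀ t, IsSparse G η β (A t)) : IsSparse G η (T * β) (⋃ t, A t) := by
  intro s hs hη
  have h1 : ((⋃ t, A t) ∩ s).ncard ≤ ∑ t, (A t ∩ s).ncard := by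
    rw [Set.iUnion_inter]
    simpa using ncard_biUnion_le Finset.univ fun t => A t ∩ s
  -- The strict inequality needs at least one time step, whence the hypothesis `0 < T`.
  have h2 : (∑ t, ((A t ∩ s).ncard : ℝ)) < ∑ _t : Fin T, β * s.ncard :=
    Finset.sum_lt_sum_of_nonempty ⟨⟨0, hT⟩, Finset.mem_univ _⟩ fun t _ => h t s hs hη
  have h3 : (((⋃ t, A t) ∩ s).ncard : ℝ) ≤ ∑ t, ((A t ∩ s).ncard : ℝ) := by exact_mod_cast h1
  rw [Finset.sum_const, Finset.card_univ, Fintype.card_fin, nsmul_eq_mul] at h2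
  linarith

/-- Sparsity is inherited, up to a constant, by a union of connected sets that contain disjoint subsets of
a sparse set of proportional size. -/
theorem spread [Finite V] {ι : Type*} [Finite ι] {β k : ℝ} {A : Set V}
    (h : IsSparse G η β A) (J a : ι → Set V) (hJ : ∀ i, IsConnectedSet G (J i))
    (haA : ∀ i, a i ⊆ A) (haJ : ∀ i, a i ⊆ J i) (hd : ∀ i i', i ≠ i' → Disjoint (a i) (a i'))
    (hcard : ∀ i, ((J i).ncard : ℝ) ≤ k * (a i).ncard) (hkβ : k * β ≤ 1 / 2) (hk : 0 < k) :
    IsSparse G η (2 * k * β) (⋃ i, J i) := by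
  classical
  intro s hs hη
  have : Fintype ι := Fintype.ofFinite ι
  set F : Finset ι := Finset.univ.filter fun i => (s ∩ J i).Nonempty with hF
  -- Sparsity of `A` is tested on `s` enlarged by every `J i` that meets it. The added sets have
  -- less than `k β |U| ≤ |U| / 2` vertices, so `|U| ≤ 2 |s|`, and what `s` meets is less than `2 k
  -- β |s|`.
  have hs' : IsConnectedSet G (s ∪ ⋃ i ∈ F, J i) :=
    hs.union_biUnion F J (fun i _ => hJ i) fun i hi => (Finset.mem_filter.1 hi).2
  have hle : s.ncard ≤ (s ∪ ⋃ i ∈ F, J i).ncard :=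
    Set.ncard_le_ncard Set.subset_union_left (Set.toFinite _)
  have h1 := h _ hs' (hη.trans (by exact_mod_cast hle))
  set U := s ∪ ⋃ i ∈ F, J i with hU
  have h2 : ((⋃ i ∈ F, J i).ncard : ℝ) ≤ ∑ i ∈ F, ((J i).ncard : ℝ) := by
    exact_mod_cast ncard_biUnion_le F J
  have h3 : ∑ i ∈ F, ((J i).ncard : ℝ) ≤ k * ∑ i ∈ F, ((a i).ncard : ℝ) := by
    rw [Finset.mul_sum]
    exact Finset.sum_le_sum fun i _ => hcard i
  have h4 : ∑ i ∈ F, ((a i).ncard : ℝ) ≤ ((A ∩ U).ncard : ℝ) := by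
    have : ∑ i ∈ F, (a i).ncard ≤ (A ∩ U).ncard := by
      rw [← ncard_biUnion_eq F a hd]
      refine Set.ncard_le_ncard (Set.iUnion₂_subset fun i hi => ?_) (Set.toFinite _)
      refine Set.subset_inter (haA i) (((haJ i).trans ?_).trans Set.subset_union_right)
      exact Set.subset_biUnion_of_mem (u := J) (Finset.mem_coe.2 hi)
    exact_mod_cast this
  have h5 : (U.ncard : ℝ) ≤ s.ncard + (⋃ i ∈ F, J i).ncard := by
    exact_mod_cast Set.ncard_union_le _ _
  have h6 : (((⋃ i, J i) ∩ s).ncard : ℝ) ≤ (⋃ i ∈ F, J i).ncard := by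
    have : (⋃ i, J i) ∩ s ⊆ ⋃ i ∈ F, J i := by
      rintro x ⟨hx, hxs⟩
      obtain ⟨i, hi⟩ := Set.mem_iUnion.1 hx
      exact Set.mem_iUnion₂.2 ⟨i, Finset.mem_filter.2 ⟨Finset.mem_univ _, x, hxs, hi⟩, hi⟩
    exact_mod_cast Set.ncard_le_ncard this (Set.toFinite _)
  have h7 : k * ∑ i ∈ F, ((a i).ncard : ℝ) ≤ k * ((A ∩ U).ncard : ℝ) := by gcongr
  have h8 : k * ((A ∩ U).ncard : ℝ) < k * (β * U.ncard) := by gcongr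
  have h9 : k * β * U.ncard ≤ 1 / 2 * U.ncard := by gcongr
  -- The sign of `β` is not assumed, but a negative `β` contradicts the strict bound `h8`.
  have hβ : 0 ≤ k * β := by
    by_contra hneg
    push Not at hneg
    have : (0 : ℝ) ≤ k * ((A ∩ U).ncard : ℝ) := by positivity
    have h10 : k * β * U.ncard ≤ 0 := mul_nonpos_of_nonpos_of_nonneg hneg.le (by positivity)
    linarith
  have h10 : (U.ncard : ℝ) ≤ 2 * s.ncard := by linarith
  have h11 : k * β * U.ncard ≤ k * β * (2 * s.ncard) := by gcongr
  linarith

end IsSparse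

end Sparse

/-! ### Avoiding sets of qubits and sparse sets of vertices -/

namespace BasedCochainComplex

variable {X V B : Type*}

/-- The vertices at which the members of a set of cells are placed. -/
def placed {p : X → Prop} (ι : {x : X // p x} → V) (e : B → X) (A : Set B) : Set V :=
  ι '' (Subtype.val ⁻¹' (e '' A))

/-- If a connected set `s` contains too many vertices of `A`, the part of `A` placed in `s` is
itself a bad set, with the induced subgraph on `s` as witness. Conversely a bad subset of `A`
violates sparsity on the vertex set of its subgraph. -/
theorem avoids_inducedBad_iff [Fintype X] {r : ℕ} {C : BasedCochainComplex X r} {I : Set ℕ}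
    [Finite V] (G : SimpleGraph V) (ι : {x : X // C.deg x ∈ I} → V)
    (e : B → X) (η β : ℝ) (A : Set B) :
    Avoids (C.inducedBad ι e (badSets G η β)) A ↔ IsSparse G η β (placed ι e A) := by
  constructor
  · intro h s hs hη
    by_contra hlt
    push Not at hlt
    have hpos : (0 : ℝ) < s.ncard := by exact_mod_cast (Set.ncard_pos (Set.toFinite _)).2 hs.1
    refine h {a ∈ A | ∃ x : {x : X // C.deg x ∈ I}, x.1 = e a ∧ ι x ∈ s} ?_ (fun a ha => ha.1)
    have heq : ι '' (Subtype.val ⁻¹' (e '' {a ∈ A | ∃ x : {x : X // C.deg x ∈ I},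
        x.1 = e a ∧ ι x ∈ s})) = placed ι e A ∩ s := by
      ext v
      constructor
      · rintro ⟨x, ⟨a, ⟨ha, y, hy, hys⟩, hax⟩, rfl⟩
        have : y = x := Subtype.ext (hy.trans hax)
        exact ⟨⟨x, ⟨a, ha, hax⟩, rfl⟩, this ▸ hys⟩
      · rintro ⟨⟨x, ⟨a, ha, hax⟩, rfl⟩, hs⟩
        exact ⟨x, ⟨a, ⟨ha, x, hax.symm, hs⟩, hax⟩, rfl⟩
    show _ ∈ badSets G η β
    rw [heq]
    refine ⟨_, hs.connected, Set.inter_subset_right, hη, ?_⟩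
    rw [SimpleGraph.Subgraph.induce_verts, le_div_iff₀ hpos]
    exact hlt
  · rintro h A' ⟨G', hG', hsub, hη, hle⟩ hA'
    have h1 := h _ hG'.isConnectedSet hη
    have hpos : (0 : ℝ) < G'.verts.ncard := by
      exact_mod_cast (Set.ncard_pos (Set.toFinite _)).2 hG'.isConnectedSet.1
    rw [le_div_iff₀ hpos] at hle
    have h2 : (ι '' (Subtype.val ⁻¹' (e '' A'))).ncard ≤ (placed ι e A ∩ G'.verts).ncard := by
      refine Set.ncard_le_ncard (Set.subset_inter ?_ hsub) (Set.toFinite _)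
      exact Set.image_mono (Set.preimage_mono (Set.image_mono hA'))
    have h3 : ((ι '' (Subtype.val ⁻¹' (e '' A'))).ncard : ℝ) ≤
      (placed ι e A ∩ G'.verts).ncard := by exact_mod_cast h2
    linarith

theorem avoids_timeCopies {V : Type*} {E : Set (Set V)} {T : ℕ} {F : Fin T → PauliSuperop V}
    (h : Avoids (timeCopies E T) (faultSupport F)) (t : Fin T) : Avoids E (F t).support := by
  intro A hA hsub
  refine h (A ×ˢ {t}) ⟨t, A, hA, rfl⟩ ?_
  rintro ⟨v, t'⟩ ⟨hv, ht⟩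
  obtain rfl : t' = t := ht
  exact hsub hv

end BasedCochainComplex

/-! ### Hamming weights of restrictions -/

section Weight

variable {A : Type*} [Fintype A]

theorem hammingNorm_eq_card (f : A → ZMod 2) :
    hammingNorm f = (Finset.univ.filter fun x => f x ≠ 0).card := rfl

open Classical in
theorem hammingNorm_indicator_add_compl (S : Set A) (f : A → ZMod 2) :
    hammingNorm (S.indicator f) + hammingNorm (Sᶜ.indicator f) = hammingNorm f := by
  simp only [hammingNorm_eq_card]
  rw [← Finset.card_union_of_disjoint]
  · congr 1
    ext x
    by_cases hx : x ∈ S <;> simp [hx]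
  · rw [Finset.disjoint_filter]
    intro x _ h1 h2
    by_cases hx : x ∈ S <;> simp [hx] at h1 h2

theorem hammingNorm_add_le (f g : A → ZMod 2) :
    hammingNorm (f + g) ≤ hammingNorm f + hammingNorm g := by
  classical
  simp only [hammingNorm_eq_card]
  refine (Finset.card_le_card ?_).trans (Finset.card_union_le _ _)
  intro x hx
  simp only [Finset.mem_filter, Finset.mem_univ, true_and, Finset.mem_union, Pi.add_apply] at hx ⊢
  by_contra! h
  simp [h.1, h.2] at hx

/-- A change inside of `S` changes the weight as it changes the weight in `S`. -/
theorem hammingNorm_add_indicator (S : Set A) (f g : A → ZMod 2) (hg : ∀ x, g x ≠ 0 → x ∈ S) :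
    hammingNorm (f + g) + hammingNorm (S.indicator f) =
      hammingNorm f + hammingNorm (S.indicator (f + g)) := by
  have h1 := hammingNorm_indicator_add_compl S f
  have h2 := hammingNorm_indicator_add_compl S (f + g)
  have h3 : Sᶜ.indicator (f + g) = Sᶜ.indicator f := by
    ext x
    by_cases hx : x ∈ S
    · simp [hx]
    · have : g x = 0 := by
        by_contra h
        exact hx (hg x h)
      simp [hx, this]
  rw [h3] at h2
  omega

/-- Adding `g` to `f` does not increase the weight by more than adding it to a part of `f` does. -/
theorem hammingNorm_add_le_of_indicator (S : Set A) (f g : A → ZMod 2) :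
    hammingNorm (f + g) + hammingNorm (S.indicator f) ≤
      hammingNorm f + hammingNorm (S.indicator f + g) := by
  have h1 := hammingNorm_indicator_add_compl S f
  -- The triangle inequality is applied to this splitting, and the weight of `f` outside of `S`
  -- cancels.
  have h2 : f + g = (S.indicator f + g) + Sᶜ.indicator f := by
    rw [add_right_comm, Set.indicator_self_add_compl]
  have h3 := hammingNorm_add_le (S.indicator f + g) (Sᶜ.indicator f)
  rw [← h2] at h3
  omega

theorem hammingNorm_add_of_disjoint (f g : A → ZMod 2) (h : ∀ x, f x ≠ 0 → g x = 0) :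
    hammingNorm f ≤ hammingNorm (f + g) := by
  simp only [hammingNorm_eq_card]
  refine Finset.card_le_card fun x hx => ?_
  simp only [Finset.mem_filter, Finset.mem_univ, true_and, Pi.add_apply] at hx ⊢
  rw [h x hx, add_zero]
  exact hx

end Weight

/-! ### Neighborhoods of cells in the graph, and cocycles of small weight -/

namespace BasedCochainComplex

variable {X V : Type*} [Fintype X] {r : ℕ}

theorem exists_incident_of_cob_ne_zero (D : BasedCochainComplex X r) {j l : ℕ} {c : D.Cochain j}
    {y : D.Level l} (h : D.cob j l c y ≠ 0) : ∃ x, c x ≠ 0 ∧ D.Incident x.1 y.1 := by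
  simp only [cob, Matrix.mulVecLin_apply, Matrix.mulVec, dotProduct, Matrix.submatrix_apply] at h
  obtain ⟨x, _, hx⟩ := Finset.exists_ne_zero_of_sum_ne_zero h
  exact ⟨x, right_ne_zero_of_mul hx, left_ne_zero_of_mul hx⟩

theorem cob_apply (D : BasedCochainComplex X r) {j l : ℕ} (c : D.Cochain j) (y : D.Level l) :
    D.cob j l c y = ∑ x : D.Level j, D.δ y.1 x.1 * c x := rfl

theorem Incident.below {D : BasedCochainComplex X r} {x y : X} (h : D.Incident x y) :
    D.Below x y := Relation.ReflTransGen.single h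

theorem hammingNorm_cob_le (D : BasedCochainComplex X r) {w : ℕ} (hw : D.HasLocality w) {j l : ℕ}
    (c : D.Cochain j) : hammingNorm (D.cob j l c) ≤ hammingNorm c * w := by
  classical
  simp only [hammingNorm_eq_card]
  have hsub : (Finset.univ.filter fun y => D.cob j l c y ≠ 0) ⊆
      (Finset.univ.filter fun x => c x ≠ 0).biUnion
        fun x => Finset.univ.filter fun y : D.Level l => D.Incident x.1 y.1 := by
    intro y hy
    obtain ⟨x, hx, hxy⟩ := exists_incident_of_cob_ne_zero D (Finset.mem_filter.1 hy).2
    simp only [Finset.mem_biUnion, Finset.mem_filter, Finset.mem_univ, true_and]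
    exact ⟨x, hx, hxy⟩
  refine (Finset.card_le_card hsub).trans (Finset.card_biUnion_le_card_mul _ _ _ fun x _ => ?_)
  refine le_trans ?_ (hw x.1)
  rw [← Finset.card_map (Function.Embedding.subtype _), ← Set.ncard_coe_finset]
  refine Set.ncard_le_ncard ?_ (Set.toFinite _)
  intro y hy
  simp only [Finset.coe_map, Finset.coe_filter, Finset.mem_univ, true_and, Set.mem_image,
    Set.mem_ofPred_eq] at hy
  obtain ⟨y', hy', rfl⟩ := hy
  exact Or.inr (Incident.below hy')

/-- A placement of the cells of degree `j, j + 1, j + 2` as vertices of a graph, in which cells are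
adjacent if they are incident or lie above a common cell of degree `0`. -/
structure Placement (D : BasedCochainComplex X r) (j : ℕ) (G : SimpleGraph V) where
  p : X → Prop
  mem : ∀ x, D.deg x = j ∨ D.deg x = j + 1 ∨ D.deg x = j + 2 → p x
  pos : {x : X // p x} → V
  inj : Function.Injective pos
  adj_of_above : ∀ x y : {x : X // p x}, x ≠ y → ∀ z, D.deg z = 0 → D.Below z x.1 → D.Below z y.1 →
    G.Adj (pos x) (pos y)
  adj_of_incident : ∀ x y : {x : X // p x}, D.Incident x.1 y.1 → G.Adj (pos x) (pos y)

namespace Placement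

variable {D : BasedCochainComplex X r} {j : ℕ} {G : SimpleGraph V} (P : Placement D j G)

/-- The vertex of a cell of degree `j`. -/
def q0 (x : D.Level j) : V := P.pos ⟨x.1, P.mem _ (Or.inl x.2)⟩

/-- The vertex of a cell of degree `j + 1`. -/
def q1 (x : D.Level (j + 1)) : V := P.pos ⟨x.1, P.mem _ (Or.inr (Or.inl x.2))⟩

/-- The vertex of a cell of degree `j + 2`. -/
def q2 (x : D.Level (j + 2)) : V := P.pos ⟨x.1, P.mem _ (Or.inr (Or.inr x.2))⟩

theorem q1_injective : Function.Injective P.q1 := by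
  intro x y h
  have := P.inj h
  exact Subtype.ext (congrArg (fun q : {x // P.p x} => q.1) this)

/-- The vertices of the cells above `z`. -/
def above (z : X) : Set V := placed P.pos id {x | D.Below z x}

/-- The vertices of a cell and the cells incident to it. -/
def star (x : X) : Set V := placed P.pos id {y | y = x ∨ D.Incident x y ∨ D.Incident y x}

theorem q0_mem_above {z : X} {x : D.Level j} (h : D.Below z x.1) : P.q0 x ∈ P.above z :=
  ⟨_, ⟨x.1, h, rfl⟩, rfl⟩

theorem q1_mem_above {z : X} {x : D.Level (j + 1)} (h : D.Below z x.1) : P.q1 x ∈ P.above z :=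
  ⟨_, ⟨x.1, h, rfl⟩, rfl⟩

theorem q2_mem_above {z : X} {x : D.Level (j + 2)} (h : D.Below z x.1) : P.q2 x ∈ P.above z :=
  ⟨_, ⟨x.1, h, rfl⟩, rfl⟩

theorem ncard_placed_le {w : ℕ} (hw : D.HasLocality w) (x : X) (s : Set X)
    (hs : ∀ y ∈ s, D.Below y x ∨ D.Below x y) : (placed P.pos id s).ncard ≤ w := by
  refine le_trans ?_ (hw x)
  refine (Set.ncard_image_le (Set.toFinite _)).trans ?_
  rw [← Set.ncard_image_of_injective _ Subtype.val_injective]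
  refine Set.ncard_le_ncard ?_ (Set.toFinite _)
  rintro _ ⟨y, hy, rfl⟩
  rw [Set.image_id] at hy
  exact hs _ hy

theorem ncard_above_le {w : ℕ} (hw : D.HasLocality w) (z : X) : (P.above z).ncard ≤ w :=
  P.ncard_placed_le hw z _ fun _ hy => Or.inr hy

theorem ncard_star_le {w : ℕ} (hw : D.HasLocality w) (x : X) : (P.star x).ncard ≤ w := by
  refine P.ncard_placed_le hw x _ ?_
  rintro y (rfl | hy | hy)
  · exact Or.inl Relation.ReflTransGen.refl
  · exact Or.inr (Incident.below hy)
  · exact Or.inl (Incident.below hy)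

theorem isConnectedSet_above {z : X} (hz : D.deg z = 0) {v : V} (hv : v ∈ P.above z) :
    IsConnectedSet G (P.above z) := by
  refine isConnectedSet_of_center v hv ?_
  obtain ⟨x, hx, rfl⟩ := hv
  rintro _ ⟨y, hy, rfl⟩ hne
  rw [Set.image_id] at hx hy
  exact P.adj_of_above x y (fun h => hne (h ▸ rfl)) z hz hx hy

theorem pos_mem_star (x : {x : X // P.p x}) : P.pos x ∈ P.star x.1 :=
  ⟨_, ⟨x.1, Or.inl rfl, rfl⟩, rfl⟩

theorem q1_mem_star (x : D.Level (j + 1)) : P.q1 x ∈ P.star x.1 :=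
  P.pos_mem_star ⟨x.1, P.mem _ (Or.inr (Or.inl x.2))⟩

theorem q2_mem_star {x : X} {y : D.Level (j + 2)} (h : D.Incident x y.1) : P.q2 y ∈ P.star x :=
  ⟨_, ⟨y.1, Or.inr (Or.inl h), rfl⟩, rfl⟩

theorem isConnectedSet_star (x : {x : X // P.p x}) : IsConnectedSet G (P.star x.1) := by
  refine isConnectedSet_of_center _ (P.pos_mem_star x) ?_
  rintro _ ⟨y, hy, rfl⟩ hne
  rw [Set.image_id] at hy
  obtain hy | hy | hy := hy
  · exact absurd (congrArg P.pos (Subtype.ext hy)) hne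
  · exact P.adj_of_incident _ _ hy
  · exact (P.adj_of_incident _ _ hy).symm

/-- Cocycles of small weight are coboundaries of cochains that can be found in their vicinity. -/
theorem exists_cob_eq_of_small {w m : ℕ} (hw : D.HasLocality w)
    (hdec : D.HasErrorFlipDecoder m (j + 1)) (e : D.Cochain (j + 1))
    (he : D.cob (j + 1) (j + 2) e = 0) (hm : hammingNorm e ≤ m) (K : Set V)
    (hK : IsConnectedSet G K) (heK : ∀ x, e x ≠ 0 → P.q1 x ∈ K) [Finite V] :
    ∃ (g : D.Cochain j) (J : Set V), D.cob j (j + 1) g = e ∧ (∀ x, g x ≠ 0 → P.q0 x ∈ J) ∧ K ⊆ J ∧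
      IsConnectedSet G J ∧ J.ncard ≤ K.ncard + hammingNorm e * w := by
  induction hn : hammingNorm e using Nat.strong_induction_on generalizing e K with
  | _ n ih =>
    subst hn
    by_cases h0 : e = 0
    · exact ⟨0, K, by simp [h0], by simp, le_rfl, hK, by simp⟩
    · obtain ⟨z, hz, ⟨c, hc, hlt⟩ | ⟨c, -, hlt⟩⟩ := hdec e h0 hm
      · change D.Cochain j at c
        change hammingNorm (e + D.cob j (j + 1) c) < hammingNorm e at hlt
        have habove : ∀ x, D.cob j (j + 1) c x ≠ 0 → P.q1 x ∈ P.above z := by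
          intro x hx
          obtain ⟨y, hy, hyx⟩ := exists_incident_of_cob_ne_zero D hx
          exact P.q1_mem_above ((hc y hy).trans (Incident.below hyx))
        -- Adding a cochain disjoint from `e` cannot lower the weight, so `δ c` meets `e`. Hence the
        -- cells above `z` meet `K` and can be joined to it without losing connectedness.
        obtain ⟨x, hx, hx'⟩ : ∃ x, e x ≠ 0 ∧ D.cob j (j + 1) c x ≠ 0 := by
          by_contra! h
          exact absurd (hammingNorm_add_of_disjoint e _ h) (not_le.2 hlt)
        have hK' : IsConnectedSet G (K ∪ P.above z) :=
          hK.union (P.isConnectedSet_above hz (habove x hx')) ⟨_, heK x hx, habove x hx'⟩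
        obtain ⟨g, J, hg, hgJ, hKJ, hJ, hcard⟩ := ih _ hlt (e + D.cob j (j + 1) c)
          (by rw [map_add, he, D.cob_cob j (j + 1) c, add_zero]) (hlt.le.trans hm)
          (K ∪ P.above z) hK' (fun x hx => by
            by_cases hex : e x = 0
            · rw [Pi.add_apply, hex, zero_add] at hx
              exact Or.inr (habove x hx)
            · exact Or.inl (heK x hex)) rfl
        refine ⟨g + c, J, ?_, ?_, Set.subset_union_left.trans hKJ, hJ, ?_⟩
        · rw [map_add, hg, add_assoc, ZModModule.add_self, add_zero]
        · intro x hx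
          by_cases hgx : g x = 0
          · rw [Pi.add_apply, hgx, zero_add] at hx
            exact hKJ (Or.inr (P.q0_mem_above (hc x hx)))
          · exact hgJ x hgx
        · have h1 := Set.ncard_union_le K (P.above z)
          have h2 := P.ncard_above_le hw z
          -- Each step adds at most `w` vertices and lowers the weight by at least one, so the
          -- potential `|K| + w |e|` does not grow.
          have h3 : (hammingNorm (e + D.cob j (j + 1) c) + 1) * w ≤ hammingNorm e * w :=
            Nat.mul_le_mul_right _ hlt
          rw [add_mul, one_mul] at h3
          omega
      -- The second alternative would lower the weight of the coboundary of `e`, which is already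
      -- zero.
      · change _ < hammingNorm (D.cob (j + 1) (j + 2) e) at hlt
        rw [he, hammingNorm_zero] at hlt
        omega

end Placement

end BasedCochainComplex

/-! ### Sequences of flips and their localization -/

namespace BasedCochainComplex

variable {X V : Type*} [Fintype X] {r : ℕ} {D : BasedCochainComplex X r} {j : ℕ}

/-- A sequence of flips, each with a cell of degree `0` below it, that reduce the weight of the syndrome
`s` one after another. -/
def IsFlipSequence (D : BasedCochainComplex X r) {j : ℕ} :
    D.Cochain (j + 1) → List (X × D.Cochain j) → Prop
  | _, [] => True
  | s, f :: l => D.deg f.1 = 0 ∧ D.BelowCochain f.1 f.2 ∧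
      hammingNorm (s + D.cob j (j + 1) f.2) < hammingNorm s ∧
      IsFlipSequence D (s + D.cob j (j + 1) f.2) l

/-- A run of the decoder is turned into a list that remembers the flips and their base cells, so
that flips can be sorted by component and counted. The list starts from the residual syndrome at
`a`, which makes induction from the head possible. -/
theorem exists_flipSequence {s : D.Cochain (j + 1)} {a b : D.Cochain j}
    (h : Relation.ReflTransGen (D.SSFlipStep s) a b) :
    ∃ l, D.IsFlipSequence (s + D.cob j (j + 1) a) l ∧ b = a + (l.map Prod.snd).sum := by
  induction h using Relation.ReflTransGen.head_induction_on with
  | refl => exact ⟨[], trivial, by simp⟩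
  | head hab _ ih =>
    obtain ⟨l, hl, rfl⟩ := ih
    obtain ⟨z, hz, c, hc, rfl, hlt⟩ := hab
    refine ⟨(z, c) :: l, ⟨hz, hc, ?_, ?_⟩, ?_⟩
    · rwa [add_assoc, ← map_add]
    · rwa [add_assoc, ← map_add]
    · simp [add_assoc]

theorem IsFlipSequence.mem {s : D.Cochain (j + 1)} {l : List (X × D.Cochain j)}
    (h : D.IsFlipSequence s l) :
    ∀ f ∈ l, D.deg f.1 = 0 ∧ D.BelowCochain f.1 f.2 ∧ D.cob j (j + 1) f.2 ≠ 0 := by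
  induction l generalizing s with
  | nil => simp
  | cons f l ih =>
    intro f' hf'
    rcases List.mem_cons.1 hf' with rfl | hf'
    · refine ⟨h.1, h.2.1, fun h0 => ?_⟩
      have := h.2.2.1
      rw [h0, add_zero] at this
      exact lt_irrefl _ this
    · exact ih h.2.2.2 f' hf'

open Classical in
/-- If the coboundary of every flip lies inside of `S` or outside of `S`, the number of the former is at
most the weight of the syndrome in `S`. -/
theorem IsFlipSequence.length_filter_le {s : D.Cochain (j + 1)} {l : List (X × D.Cochain j)}
    (h : D.IsFlipSequence s l) (S : Set (D.Level (j + 1))) (p : X × D.Cochain j → Prop)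
    (hin : ∀ f ∈ l, p f → ∀ x, D.cob j (j + 1) f.2 x ≠ 0 → x ∈ S)
    (hout : ∀ f ∈ l, ¬ p f → ∀ x, D.cob j (j + 1) f.2 x ≠ 0 → x ∉ S) :
    (l.filter fun f => p f).length ≤ hammingNorm (S.indicator s) := by
  induction l generalizing s with
  | nil => simp
  | cons f l ih =>
    have h1 := ih h.2.2.2 (fun f' hf' => hin f' (List.mem_cons_of_mem _ hf'))
      (fun f' hf' => hout f' (List.mem_cons_of_mem _ hf'))
    -- A flip inside of `S` lowers the weight in `S` by as much as the total weight, hence by at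
    -- least one. A flip outside of `S` does not change the syndrome in `S`.
    by_cases hf : p f
    · rw [List.filter_cons_of_pos (by simpa using hf), List.length_cons]
      have h2 := hammingNorm_add_indicator S s _ (hin f List.mem_cons_self hf)
      have h3 := h.2.2.1
      omega
    · rw [List.filter_cons_of_neg (by simpa using hf)]
      have h2 : S.indicator (s + D.cob j (j + 1) f.2) = S.indicator s := by
        ext x
        by_cases hx : x ∈ S
        · have : D.cob j (j + 1) f.2 x = 0 := by
            by_contra h0
            exact hout f List.mem_cons_self hf x h0 hx
          simp [hx, this]
        · simp [hx]
      rwa [h2] at h1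

/-- Restriction to cells of a color commutes with the coboundary map if the incident cells have the same
color. -/
theorem cob_indicator {l : ℕ} {K : Type*} (f : D.Cochain j) (χ : D.Level j → K) (χ' : D.Level l → K)
    (κ : K) (h : ∀ x y, f x ≠ 0 → D.Incident x.1 y.1 → χ' y = χ x) :
    D.cob j l ({x | χ x = κ}.indicator f) = {y | χ' y = κ}.indicator (D.cob j l f) := by
  classical
  ext y
  simp only [cob_apply, Set.indicator_apply, Set.mem_ofPred_eq]
  split_ifs with hy
  · refine Finset.sum_congr rfl fun x _ => ?_
    by_cases hfx : f x = 0
    · simp [hfx]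
    · by_cases hxy : D.Incident x.1 y.1
      · rw [if_pos ((h x y hfx hxy).symm.trans hy)]
      · have : D.δ y.1 x.1 = 0 := by
          by_contra h0
          exact hxy h0
        simp [this]
  · refine Finset.sum_eq_zero fun x _ => ?_
    by_cases hfx : f x = 0
    · simp [hfx]
    · by_cases hxy : D.Incident x.1 y.1
      · rw [if_neg (fun hx => hy ((h x y hfx hxy).trans hx)), mul_zero]
      · have : D.δ y.1 x.1 = 0 := by
          by_contra h0
          exact hxy h0
        rw [this, zero_mul]

end BasedCochainComplex

/-! ### Connected components of a region of a graph -/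

/-- The edges of `G` inside of `U`. -/
def edgesWithin {V : Type*} (G : SimpleGraph V) (U : Set V) : SimpleGraph V where
  Adj a b := G.Adj a b ∧ a ∈ U ∧ b ∈ U
  symm := ⟨fun _ _ h => ⟨h.1.symm, h.2.2, h.2.1⟩⟩
  loopless := ⟨fun _ h => h.1.ne rfl⟩

theorem IsConnectedSet.component_eq {V : Type*} {G : SimpleGraph V} {U s : Set V}
    (hs : IsConnectedSet G s) (hsU : s ⊆ U) {a b : V} (ha : a ∈ s) (hb : b ∈ s) :
    (edgesWithin G U).connectedComponentMk a = (edgesWithin G U).connectedComponentMk b := by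
  have := hs.2 {v | (edgesWithin G U).connectedComponentMk a =
    (edgesWithin G U).connectedComponentMk v} ⟨a, ha, rfl⟩ fun x hx y hy hxa hxy => ?_
  · exact this hb
  · refine hxa.trans (SimpleGraph.ConnectedComponent.sound (SimpleGraph.Adj.reachable ?_))
    exact ⟨hxy, hsU hx, hsU hy⟩

/-- All vertices are kept in `edgesWithin`, so a vertex outside of `U` forms a component of its own.
For `a` in `U`, `mem_of_component_eq` places the whole component in `U`. -/
theorem isConnectedSet_component {V : Type*} (G : SimpleGraph V) (U : Set V) (a : V) :
    IsConnectedSet G {v | (edgesWithin G U).connectedComponentMk v =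
      (edgesWithin G U).connectedComponentMk a} := by
  refine ⟨⟨a, rfl⟩, ?_⟩
  rintro T ⟨x, hx, hxT⟩ hcl y hy
  have hr : (edgesWithin G U).Reachable x y := SimpleGraph.ConnectedComponent.exact (hx.trans hy.symm)
  rw [SimpleGraph.reachable_iff_reflTransGen] at hr
  have key : ∀ z, Relation.ReflTransGen (edgesWithin G U).Adj x z → z ∈ T ∧
      (edgesWithin G U).connectedComponentMk z = (edgesWithin G U).connectedComponentMk a := by
    intro z hz
    induction hz with
    | refl => exact ⟨hxT, hx⟩
    | @tail b c _ hbc ih =>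
      have hc : (edgesWithin G U).connectedComponentMk c =
          (edgesWithin G U).connectedComponentMk a := by
        rw [← ih.2]
        exact SimpleGraph.ConnectedComponent.sound hbc.symm.reachable
      exact ⟨hcl b ih.2 c hc ih.1 hbc.1, hc⟩
  exact (key y hr).1

theorem mem_of_component_eq {V : Type*} {G : SimpleGraph V} {U : Set V} {a b : V} (ha : a ∈ U)
    (h : (edgesWithin G U).connectedComponentMk b = (edgesWithin G U).connectedComponentMk a) :
    b ∈ U := by
  have hr : (edgesWithin G U).Reachable a b := SimpleGraph.ConnectedComponent.exact h.symm
  rw [SimpleGraph.reachable_iff_reflTransGen] at hr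
  induction hr with
  | refl => exact ha
  | tail _ hbc _ => exact hbc.2.2

/-! ### Small-set flip decoding of a sparse error -/

namespace BasedCochainComplex.Placement

variable {X V : Type*} [Fintype X] {r : ℕ} {D : BasedCochainComplex X r} {j : ℕ}
  {G : SimpleGraph V} (P : Placement D j G)

/-- Small-set flip decoding of a sparse error `u` of degree `j + 1` returns a guess that differs from `u`
by the coboundary of a sparse cochain. -/
theorem exists_sparse_cob_eq [Finite V] {w m : ℕ} (hw1 : 1 ≤ w) (hw : D.HasLocality w)
    (hdec : D.HasSmallSetFlipDecoder m 0 (j + 1)) {η β : ℝ} (hη : η ≤ m) (u : D.Cochain (j + 1))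
    (hu : IsSparse G η β (P.q1 '' {x | u x ≠ 0})) (hβ : 8 * (w : ℝ) ^ 3 * β ≤ 1) (hβ0 : 0 < β)
    {a : D.Cochain (j + 1)} (ha : D.IsSSFlipOutput (D.cob (j + 1) (j + 2) u) a) :
    ∃ g : D.Cochain j, D.cob j (j + 1) g = u + a ∧
      IsSparse G η (8 * (w : ℝ) ^ 3 * β) (P.q0 '' {x | g x ≠ 0}) := by
  classical
  have hwR : (1 : ℝ) ≤ w := by exact_mod_cast hw1
  obtain ⟨hrun, hmax⟩ := ha
  obtain ⟨l, hl, hal⟩ := exists_flipSequence hrun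
  rw [map_zero, add_zero] at hl
  rw [zero_add] at hal
  have hmem := hl.mem
  -- the region in which the error and the flips live
  set U : Set V := (⋃ x ∈ {x | u x ≠ 0}, P.star (Subtype.val x)) ∪ ⋃ f ∈ {f | f ∈ l}, P.above f.1 with hU
  have hstarU : ∀ x, u x ≠ 0 → P.star x.1 ⊆ U := fun x hx v hv =>
    Or.inl (Set.mem_iUnion₂.2 ⟨x, hx, hv⟩)
  have haboveU : ∀ f ∈ l, P.above f.1 ⊆ U := fun f hf v hv =>
    Or.inr (Set.mem_iUnion₂.2 ⟨f, hf, hv⟩)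
  set mk := (edgesWithin G U).connectedComponentMk with hmk
  set χ1 : D.Level (j + 1) → (edgesWithin G U).ConnectedComponent := fun x => mk (P.q1 x) with hχ1
  set χ2 : D.Level (j + 2) → (edgesWithin G U).ConnectedComponent := fun x => mk (P.q2 x) with hχ2
  have hstar : ∀ x, u x ≠ 0 → ∀ v ∈ P.star x.1, mk v = χ1 x := fun x hx v hv =>
    (P.isConnectedSet_star ⟨x.1, P.mem _ (Or.inr (Or.inl x.2))⟩).component_eq (hstarU x hx) hv (P.q1_mem_star x)
  have hflip : ∀ f ∈ l, ∀ v ∈ P.above f.1, ∀ v' ∈ P.above f.1, mk v = mk v' :=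
    fun f hf v hv v' hv' =>
      (P.isConnectedSet_above (hmem f hf).1 hv).component_eq (haboveU f hf) hv hv'
  have hf1 : ∀ f ∈ l, ∀ x, f.2 x ≠ 0 → P.q1 x ∈ P.above f.1 := fun f hf x hx =>
    P.q1_mem_above ((hmem f hf).2.1 x hx)
  have hf2 : ∀ f ∈ l, ∀ y : D.Level (j + 2), D.cob (j + 1) (j + 2) f.2 y ≠ 0 →
      P.q2 y ∈ P.above f.1 := fun f hf y hy => by
    obtain ⟨x, hx, hxy⟩ := exists_incident_of_cob_ne_zero D hy
    exact P.q2_mem_above (((hmem f hf).2.1 x hx).trans (Incident.below hxy))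
  -- every element of the support of `u + a` lies in the region
  have ha_supp : ∀ x, a x ≠ 0 → ∃ f ∈ l, f.2 x ≠ 0 := by
    intro x hx
    by_contra! h
    apply hx
    rw [hal]
    have : ∀ l' : List (X × D.Cochain (j + 1)), (∀ f ∈ l', f.2 x = 0) →
        (l'.map Prod.snd).sum x = 0 := by
      intro l'
      induction l' with
      | nil => simp
      | cons f l' ih =>
        intro h'
        rw [List.map_cons, List.sum_cons, Pi.add_apply, h' f List.mem_cons_self,
          ih fun f' hf' => h' f' (List.mem_cons_of_mem _ hf'), add_zero]
    exact this l h
  have hcomp_u : ∀ x y, u x ≠ 0 → D.Incident x.1 y.1 → χ2 y = χ1 x := fun x y hx hxy =>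
    hstar x hx _ (P.q2_mem_star hxy)
  have hcomp_a : ∀ x y, a x ≠ 0 → D.Incident x.1 y.1 → χ2 y = χ1 x := fun x y hx hxy => by
    obtain ⟨f, hf, hfx⟩ := ha_supp x hx
    exact hflip f hf _ (P.q2_mem_above (((hmem f hf).2.1 x hfx).trans (Incident.below hxy)))
      _ (hf1 f hf x hfx)
  set e : D.Cochain (j + 1) := u + a with he
  have hcomp : ∀ x y, e x ≠ 0 → D.Incident x.1 y.1 → χ2 y = χ1 x := fun x y hx hxy => by
    by_cases hux : u x = 0
    · exact hcomp_a x y (fun h => hx (by rw [he, Pi.add_apply, hux, h, add_zero])) hxy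
    · exact hcomp_u x y hux hxy
  -- the flips in a component
  set L : (edgesWithin G U).ConnectedComponent → List (X × D.Cochain (j + 1)) := fun κ =>
    l.filter fun f => ∃ v ∈ P.above f.1, mk v = κ with hL
  -- The coboundary of a flip lies in a single component, so flips of other components leave the
  -- syndrome in `κ` alone and each flip of `κ` lowers its weight. The initial syndrome in `κ` is
  -- the coboundary of the error in `κ`.
  have hcount : ∀ κ, (L κ).length ≤ hammingNorm ({x | χ1 x = κ}.indicator u) * w := by
    intro κ
    refine (hl.length_filter_le {y | χ2 y = κ} (fun f => ∃ v ∈ P.above f.1, mk v = κ) ?_ ?_).trans ?_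
    · rintro f hf ⟨v, hv, hvκ⟩ x hx
      exact (hflip f hf _ (hf2 f hf x hx) _ hv).trans hvκ
    · intro f hf hnot x hx hxκ
      exact hnot ⟨_, hf2 f hf x hx, hxκ⟩
    · rw [← cob_indicator u χ1 χ2 κ hcomp_u]
      exact hammingNorm_cob_le D hw _
  -- components that contain no error contain no flips
  have hκu : ∀ x, e x ≠ 0 → ∃ x', u x' ≠ 0 ∧ χ1 x' = χ1 x := by
    intro x hx
    by_cases hux : u x = 0
    · have hax : a x ≠ 0 := fun h => hx (by rw [he, Pi.add_apply, hux, h, add_zero])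
      obtain ⟨f, hf, hfx⟩ := ha_supp x hax
      have h1 : f ∈ L (χ1 x) := by
        rw [hL]
        simp only [List.mem_filter, decide_eq_true_eq]
        exact ⟨hf, _, hf1 f hf x hfx, rfl⟩
      have h2 := List.length_pos_of_mem h1
      have h3 := hcount (χ1 x)
      have h4 : hammingNorm ({x' | χ1 x' = χ1 x}.indicator u) ≠ 0 := by
        intro h0
        rw [h0, zero_mul] at h3
        omega
      rw [hammingNorm_ne_zero_iff, Function.ne_iff] at h4
      obtain ⟨x', hx'⟩ := h4
      rw [Pi.zero_apply, Set.indicator_apply_ne_zero] at hx'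
      exact ⟨x', hx'.2, hx'.1⟩
    · exact ⟨x, hux, rfl⟩
  -- Only components with an error are used: a vertex outside of `U` is a nonempty component with no
  -- error to compare its size with.
  let Idx := {κ : (edgesWithin G U).ConnectedComponent // ∃ x, u x ≠ 0 ∧ χ1 x = κ}
  have hfinκ : Finite (edgesWithin G U).ConnectedComponent :=
    Finite.of_surjective mk Quot.mk_surjective
  have hfinIdx : Finite Idx := Subtype.finite
  let Kset : Idx → Set V := fun κ => {v | mk v = κ.1}
  let A : Idx → Set V := fun κ => P.q1 '' {x | u x ≠ 0 ∧ χ1 x = κ.1}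
  have hAcard : ∀ κ, (A κ).ncard = hammingNorm ({x | χ1 x = κ.1}.indicator u) := by
    intro κ
    rw [Set.ncard_image_of_injective _ P.q1_injective, hammingNorm_eq_card, ← Set.ncard_coe_finset]
    congr 1
    ext x
    simp [and_comm]
  have hApos : ∀ κ, 0 < (A κ).ncard := by
    rintro ⟨κ, x, hx, hκ⟩
    exact (Set.ncard_pos (Set.toFinite _)).2 ⟨_, x, ⟨hx, hκ⟩, rfl⟩
  have hKconn : ∀ κ, IsConnectedSet G (Kset κ) := by
    rintro ⟨κ, x, hx, rfl⟩
    exact isConnectedSet_component G U _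
  have hAK : ∀ κ, A κ ⊆ Kset κ := by
    rintro κ _ ⟨x, ⟨-, hx⟩, rfl⟩
    exact hx
  -- The component is covered by one star for each of its `|A|` errors and the upper set of each of
  -- its at most `w |A|` flips. All these sets have at most `w` vertices, which gives `w |A| + w²
  -- |A|`.
  have hKcard : ∀ κ, (Kset κ).ncard ≤ 2 * w ^ 2 * (A κ).ncard := by
    rintro κ
    set F1 : Finset (D.Level (j + 1)) :=
      Finset.univ.filter fun x => ({x | χ1 x = κ.1}.indicator u) x ≠ 0 with hF1
    have hsub : Kset κ ⊆ (⋃ x ∈ F1, P.star (Subtype.val x)) ∪ ⋃ f ∈ (L κ.1).toFinset, P.above f.1 := by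
      intro v hv
      obtain ⟨x, hx, hxκ⟩ := κ.2
      have hvU : v ∈ U := mem_of_component_eq (a := P.q1 x) (hstarU x hx (P.q1_mem_star x))
        (Eq.trans hv hxκ.symm)
      rcases hvU with hvU | hvU
      · obtain ⟨x', hx', hv'⟩ := Set.mem_iUnion₂.1 hvU
        refine Or.inl (Set.mem_iUnion₂.2 ⟨x', ?_, hv'⟩)
        simp only [hF1, Finset.mem_filter, Finset.mem_univ, true_and]
        rw [Set.indicator_apply_ne_zero]
        exact ⟨(hstar x' hx' v hv').symm.trans hv, hx'⟩
      · obtain ⟨f, hf, hv'⟩ := Set.mem_iUnion₂.1 hvU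
        refine Or.inr (Set.mem_iUnion₂.2 ⟨f, ?_, hv'⟩)
        rw [List.mem_toFinset, hL]
        simp only [List.mem_filter, decide_eq_true_eq]
        exact ⟨hf, v, hv', hv⟩
    have h1 := (Set.ncard_le_ncard hsub (Set.toFinite _)).trans (Set.ncard_union_le _ _)
    have h2 : (⋃ x ∈ F1, P.star (Subtype.val x)).ncard ≤ F1.card * w :=
      (ncard_biUnion_le F1 _).trans (by
        rw [← smul_eq_mul]
        exact Finset.sum_le_card_nsmul _ _ _ fun x _ => P.ncard_star_le hw x.1)
    have h3 : (⋃ f ∈ (L κ.1).toFinset, P.above f.1).ncard ≤ (L κ.1).toFinset.card * w :=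
      (ncard_biUnion_le _ _).trans (by
        rw [← smul_eq_mul]
        exact Finset.sum_le_card_nsmul _ _ _ fun f _ => P.ncard_above_le hw f.1)
    have h4 : F1.card = (A κ).ncard := by rw [hAcard]; rfl
    have h5 : (L κ.1).toFinset.card ≤ (A κ).ncard * w := by
      rw [hAcard]
      exact (List.toFinset_card_le _).trans (hcount κ.1)
    calc (Kset κ).ncard ≤ (A κ).ncard * w + (A κ).ncard * w * w := by
          rw [h4] at h2
          have := Nat.mul_le_mul_right w h5
          omega
      _ ≤ 2 * w ^ 2 * (A κ).ncard := by nlinarith [Nat.mul_le_mul_right ((A κ).ncard * w) hw1]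
  -- A component of more than `m ≥ η` vertices would have to satisfy `|A| < β |K| ≤ 2 w² β |A| ≤
  -- |A|`.
  have hKm : ∀ κ, (Kset κ).ncard ≤ m := by
    intro κ
    by_contra hlt
    push Not at hlt
    have h1 : η ≤ (Kset κ).ncard := hη.trans (by exact_mod_cast hlt.le)
    have h2 := hu _ (hKconn κ) h1
    have h3 : (A κ).ncard ≤ (P.q1 '' {x | u x ≠ 0} ∩ Kset κ).ncard := by
      refine Set.ncard_le_ncard (Set.subset_inter ?_ (hAK κ)) (Set.toFinite _)
      exact Set.image_mono fun x hx => hx.1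
    have h3' : ((A κ).ncard : ℝ) ≤ (P.q1 '' {x | u x ≠ 0} ∩ Kset κ).ncard := by exact_mod_cast h3
    have h4 : ((Kset κ).ncard : ℝ) ≤ 2 * w ^ 2 * (A κ).ncard := by exact_mod_cast hKcard κ
    have h5 : β * (Kset κ).ncard ≤ β * (2 * w ^ 2 * (A κ).ncard) := by gcongr
    have h6 : (w : ℝ) ^ 2 ≤ w ^ 3 := by gcongr; norm_num
    have h7 : β * (2 * (w : ℝ) ^ 2) ≤ 1 := by
      have : β * (w : ℝ) ^ 2 ≤ β * w ^ 3 := by gcongr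
      nlinarith [mul_pos hβ0 (pow_pos (lt_of_lt_of_le one_pos hwR) 3)]
    have h8 : β * (2 * (w : ℝ) ^ 2) * (A κ).ncard ≤ 1 * (A κ).ncard := by gcongr
    linarith
  set eκ : Idx → D.Cochain (j + 1) := fun κ => {x | χ1 x = κ.1}.indicator e with heκ
  have heK : ∀ κ x, eκ κ x ≠ 0 → P.q1 x ∈ Kset κ := by
    intro κ x hx
    rw [heκ, Set.indicator_apply_ne_zero] at hx
    exact hx.1
  have heKcard : ∀ κ, hammingNorm (eκ κ) ≤ (Kset κ).ncard := by
    intro κ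
    rw [hammingNorm_eq_card, ← Set.ncard_coe_finset, ← Set.ncard_image_of_injective _ P.q1_injective]
    refine Set.ncard_le_ncard ?_ (Set.toFinite _)
    rintro _ ⟨x, hx, rfl⟩
    exact heK κ x (by simpa using hx)
  -- Otherwise the syndrome-flip property, with zero syndrome noise, gives a flip that lowers the
  -- weight of the residual syndrome restricted to the component. By
  -- `hammingNorm_add_le_of_indicator` it also lowers the whole residual syndrome, although the
  -- decoder has stopped.
  have hδe : ∀ κ, D.cob (j + 1) (j + 2) (eκ κ) = 0 := by
    intro κ
    by_contra h0
    obtain ⟨z, hz, c, hc, hlt⟩ := hdec.2 (eκ κ) h0 ((heKcard κ).trans (hKm κ)) 0 (by simp)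
    refine hmax (a + c) ⟨z, hz, c, hc, rfl, ?_⟩
    rw [add_zero, add_zero, map_add] at hlt
    change hammingNorm (D.cob (j + 1) (j + 2) (eκ κ) + D.cob (j + 1) (j + 2) c) <
      hammingNorm (D.cob (j + 1) (j + 2) (eκ κ)) at hlt
    change hammingNorm (D.cob (j + 1) (j + 2) u + D.cob (j + 1) (j + 2) (a + c)) <
      hammingNorm (D.cob (j + 1) (j + 2) u + D.cob (j + 1) (j + 2) a)
    rw [map_add _ a c, ← add_assoc, ← map_add, ← he]
    rw [heκ, cob_indicator e χ1 χ2 κ.1 hcomp] at hlt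
    have := hammingNorm_add_le_of_indicator {y | χ2 y = κ.1} (D.cob (j + 1) (j + 2) e)
      (D.cob (j + 1) (j + 2) c)
    omega
  have hsol := fun κ => P.exists_cob_eq_of_small hw hdec.1 (eκ κ) (hδe κ)
    ((heKcard κ).trans (hKm κ)) (Kset κ) (hKconn κ) (heK κ)
  choose g J hg hgJ hKJ hJ hJcard using hsol
  have : Fintype Idx := Fintype.ofFinite _
  refine ⟨∑ κ, g κ, ?_, ?_⟩
  -- Every cell of `e` lies in exactly one indexed component, by `hκu`, so the restrictions of `e`
  -- add up to `e`.
  · rw [map_sum]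
    ext x
    rw [Finset.sum_apply]
    simp only [hg, heκ, Set.indicator_apply, Set.mem_ofPred_eq]
    by_cases hx : e x = 0
    · simp [hx]
    · obtain ⟨x', hx', hxx'⟩ := hκu x hx
      rw [Finset.sum_eq_single (⟨χ1 x, x', hx', hxx'⟩ : Idx)]
      · simp
      · intro κ _ hκ
        rw [if_neg]
        intro h
        exact hκ (Subtype.ext h.symm)
      · simp
  -- The constant is `|J| ≤ |K| (1 + w) ≤ 2 w² |A| · 2 w`, so the condition of `IsSparse.spread` is
  -- the hypothesis `hβ` halved.
  · have hk : (0 : ℝ) < 4 * w ^ 3 := by positivity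
    have := hu.spread (k := 4 * (w : ℝ) ^ 3) J A hJ
      (fun κ => Set.image_mono fun x hx => hx.1) (fun κ => (hAK κ).trans (hKJ κ)) ?_ ?_ (by linarith) hk
    · refine this.mono ?_ (by linarith)
      rintro _ ⟨x, hx, rfl⟩
      rw [Set.mem_ofPred_eq, Finset.sum_apply] at hx
      obtain ⟨κ, _, hκ⟩ := Finset.exists_ne_zero_of_sum_ne_zero hx
      exact Set.mem_iUnion.2 ⟨κ, hgJ κ x hκ⟩
    · intro κ κ' hne
      rw [Set.disjoint_left]
      rintro _ ⟨x, ⟨-, hx⟩, rfl⟩ ⟨x', ⟨-, hx'⟩, hxx'⟩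
      obtain rfl := P.q1_injective hxx'
      exact hne (Subtype.ext (hx.symm.trans hx'))
    · intro κ
      have h1 := hJcard κ
      have h2 := Nat.mul_le_mul_right w (heKcard κ)
      have h3 := hKcard κ
      have h4 : (J κ).ncard ≤ 4 * w ^ 3 * (A κ).ncard := by
        have h5 : (Kset κ).ncard * (1 + w) ≤ 2 * w ^ 2 * (A κ).ncard * (1 + w) :=
          Nat.mul_le_mul_right _ h3
        have h6 : 2 * w ^ 2 * (A κ).ncard * (1 + w) ≤ 2 * w ^ 2 * (A κ).ncard * (2 * w) :=
          Nat.mul_le_mul_left _ (by omega)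
        calc (J κ).ncard ≤ (Kset κ).ncard * (1 + w) := by rw [mul_add, mul_one]; omega
          _ ≤ _ := h5.trans h6
          _ = _ := by ring
      exact_mod_cast h4

end BasedCochainComplex.Placement

/-! ### Pauli and Clifford operators acting on vectors -/

section Vectors

/-- The character `(-1)^a`. -/
noncomputable def sgn (a : ZMod 2) : ℂ := if a = 0 then 1 else -1

theorem zmod_two_cases : ∀ a : ZMod 2, a = 0 ∨ a = 1 := by decide

@[simp] theorem sgn_zero : sgn 0 = 1 := by simp [sgn]

@[simp] theorem sgn_one : sgn 1 = -1 := by simp [sgn]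

theorem sgn_add (a b : ZMod 2) : sgn (a + b) = sgn a * sgn b := by
  have h : (1 : ZMod 2) + 1 = 0 := by decide
  rcases zmod_two_cases a with rfl | rfl <;> rcases zmod_two_cases b with rfl | rfl <;> simp [h]

@[simp] theorem sgn_mul_self (a : ZMod 2) : sgn a * sgn a = 1 := by
  rcases zmod_two_cases a with rfl | rfl <;> simp

theorem sgn_ne_zero (a : ZMod 2) : sgn a ≠ 0 := by
  rcases zmod_two_cases a with rfl | rfl <;> simp

theorem sgn_sum {ι : Type*} (s : Finset ι) (f : ι → ZMod 2) :
    sgn (∑ i ∈ s, f i) = ∏ i ∈ s, sgn (f i) := by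
  classical
  induction s using Finset.induction_on with
  | empty => simp
  | insert i s hi ih => rw [Finset.sum_insert hi, Finset.prod_insert hi, sgn_add, ih]

theorem sum_zmod_two {A : Type*} [AddCommMonoid A] (f : ZMod 2 → A) : ∑ b, f b = f 0 + f 1 :=
  Fin.sum_univ_two f

theorem update_add_self {V : Type*} [DecidableEq V] (x : Bits V) (q : V) (s : ZMod 2) :
    Function.update x q (x q + s) = x + Pi.single q s := by
  ext v
  by_cases h : v = q
  · subst h; simp
  · simp [h]

variable {V : Type*}

/-- The action of the Pauli `X^a`. -/
def shift (a : Bits V) (ψ : Bits V → ℂ) : Bits V → ℂ := fun x => ψ (x + a)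

theorem shift_shift (a b : Bits V) (ψ : Bits V → ℂ) : shift a (shift b ψ) = shift (a + b) ψ := by
  ext x
  simp [shift, add_assoc]

variable [Fintype V] [DecidableEq V]

/-- The action of the Pauli `Z^p`. -/
noncomputable def phase (p : Bits V) (ψ : Bits V → ℂ) : Bits V → ℂ := fun x => sgn (p ⬝ᵥ x) * ψ x

/-- The unnormalized Hadamard transform. -/
noncomputable def hadamardTransform (ψ : Bits V → ℂ) : Bits V → ℂ := fun x => ∑ y, sgn (x ⬝ᵥ y) * ψ y

/-- The change of basis that turns preparation of `|+^k⟩` into preparation in the given basis. -/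
noncomputable def PrepBasis.frame : PrepBasis → (Bits V → ℂ) → Bits V → ℂ
  | .plus, ψ => ψ
  | .zero, ψ => hadamardTransform ψ

theorem phase_smul (p : Bits V) (c : ℂ) (ψ : Bits V → ℂ) : phase p (c • ψ) = c • phase p ψ := by
  ext x
  simp [phase, mul_left_comm]

theorem phase_phase (p q : Bits V) (ψ : Bits V → ℂ) : phase p (phase q ψ) = phase (p + q) ψ := by
  ext x
  simp [phase, add_dotProduct, sgn_add, mul_assoc]

theorem shift_phase (a p : Bits V) (ψ : Bits V → ℂ) :
    shift a (phase p ψ) = sgn (p ⬝ᵥ a) • phase p (shift a ψ) := by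
  ext x
  simp [shift, phase, dotProduct_add, sgn_add, mul_assoc, mul_comm (sgn (p ⬝ᵥ x))]

theorem shift_phase_shift (v p u : Bits V) (ψ : Bits V → ℂ) :
    shift v (phase p (shift u ψ)) = sgn (p ⬝ᵥ v) • phase p (shift u (shift v ψ)) := by
  rw [shift_phase, shift_shift, shift_shift, add_comm]

theorem phase_shift_phase_shift (p' u' p u : Bits V) (ψ : Bits V → ℂ) :
    phase p' (shift u' (phase p (shift u ψ))) =
      sgn (p ⬝ᵥ u') • phase (p' + p) (shift (u' + u) ψ) := by
  rw [shift_phase, phase_smul, phase_phase, shift_shift]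

theorem hadamardTransform_smul (c : ℂ) (ψ : Bits V → ℂ) :
    hadamardTransform (c • ψ) = c • hadamardTransform ψ := by
  ext x
  simp [hadamardTransform, Finset.mul_sum, mul_left_comm]

theorem hadamardTransform_add (ψ φ : Bits V → ℂ) :
    hadamardTransform (ψ + φ) = hadamardTransform ψ + hadamardTransform φ := by
  ext x
  simp [hadamardTransform, mul_add, Finset.sum_add_distrib]

theorem hadamardTransform_shift (a : Bits V) (ψ : Bits V → ℂ) :
    hadamardTransform (shift a ψ) = phase a (hadamardTransform ψ) := by
  ext x
  simp only [hadamardTransform, shift, phase, Finset.mul_sum]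
  refine Fintype.sum_equiv (Equiv.addRight a) _ _ fun y => ?_
  simp only [Equiv.coe_addRight, dotProduct_add, sgn_add, dotProduct_comm a x]
  linear_combination -(sgn (x ⬝ᵥ y) * ψ (y + a)) * sgn_mul_self (x ⬝ᵥ a)

theorem hadamardTransform_phase (p : Bits V) (ψ : Bits V → ℂ) :
    hadamardTransform (phase p ψ) = shift p (hadamardTransform ψ) := by
  ext x
  simp only [hadamardTransform, shift, phase]
  refine Finset.sum_congr rfl fun y _ => ?_
  rw [add_dotProduct, sgn_add, mul_assoc]

namespace PrepBasis

variable (b : PrepBasis)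

theorem frame_smul (c : ℂ) (ψ : Bits V → ℂ) : b.frame (c • ψ) = c • b.frame ψ := by
  cases b
  · rfl
  · exact hadamardTransform_smul c ψ

/-- The part of a Pauli operator that acts as a shift in the frame. -/
def shiftPart (x z : Bits V) : Bits V :=
  match b with
  | plus => x
  | zero => z

/-- The part of a Pauli operator that acts as a phase in the frame. -/
def phasePart (x z : Bits V) : Bits V :=
  match b with
  | plus => z
  | zero => x

/-- The Hadamard transform exchanges shifts and phases. The scalar is the sign of putting the two
back in the standard order. -/
theorem phase_shift_frame (x z : Bits V) :
    ∃ c : ℂ, c ≠ 0 ∧ ∀ ψ : Bits V → ℂ, phase z (shift x (b.frame ψ)) =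
      c • b.frame (phase (b.phasePart x z) (shift (b.shiftPart x z) ψ)) := by
  cases b
  · exact ⟨1, one_ne_zero, fun ψ => by simp [frame, shiftPart, phasePart]⟩
  · refine ⟨sgn (x ⬝ᵥ z), sgn_ne_zero _, fun ψ => ?_⟩
    simp only [frame, shiftPart, phasePart]
    rw [← hadamardTransform_phase, ← hadamardTransform_shift, shift_phase, hadamardTransform_smul]

end PrepBasis

/-- The action of a `CNOT`. -/
def cnotAct (c t : V) (ψ : Bits V → ℂ) : Bits V → ℂ :=
  fun x => ψ (Function.update x t (x t + x c))

/-- The action of the projection to an outcome of a `Z` measurement. -/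
def projAct (q : V) (s : ZMod 2) (ψ : Bits V → ℂ) : Bits V → ℂ :=
  fun x => if x q = s then ψ x else 0

theorem projAct_phase_shift (q : V) (s : ZMod 2) (p u : Bits V) (ψ : Bits V → ℂ) :
    projAct q s (phase p (shift u ψ)) = phase p (shift u (projAct q (s + u q) ψ)) := by
  ext x
  simp only [projAct, phase, shift, Pi.add_apply, add_left_inj, mul_ite, mul_zero]

theorem dotProduct_cnot (p x : Bits V) {c t : V} :
    p ⬝ᵥ Function.update x t (x t + x c) = Function.update p c (p c + p t) ⬝ᵥ x := by
  rw [update_add_self x, update_add_self p, dotProduct_add, add_dotProduct]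
  simp

/-- A `CNOT` is a linear map of bit strings. Shift exponents are moved by this map and phase
exponents by its transpose, in which control and target are exchanged. -/
theorem cnotAct_phase_shift {c t : V} (h : c ≠ t) (p u : Bits V) (ψ : Bits V → ℂ) :
    cnotAct c t (phase p (shift u ψ)) = phase (Function.update p c (p c + p t))
      (shift (Function.update u t (u t + u c)) (cnotAct c t ψ)) := by
  ext x
  simp only [cnotAct, phase, shift, dotProduct_cnot]
  congr 2
  ext v
  by_cases hv : v = t
  · subst hv
    have h2 : ∀ a : ZMod 2, a + a = 0 := fun a => ZModModule.add_self a
    simp only [Pi.add_apply, Function.update_self, Function.update_of_ne h]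
    linear_combination -h2 (u c)
  · simp [hv]

theorem cnot_cnot {c t : V} (h : c ≠ t) (x : Bits V) :
    Function.update (Function.update x t (x t + x c)) t
      (Function.update x t (x t + x c) t + Function.update x t (x t + x c) c) = x := by
  ext v
  by_cases hv : v = t
  · subst hv
    simp only [Function.update_self, Function.update_of_ne h]
    rw [add_assoc, ZModModule.add_self, add_zero]
  · simp [hv]

/-- Substituting the involution `y ↦ CNOT y` in the character sum transposes the `CNOT`, which
exchanges control and target. This is why the circuit for `|0^k⟩` becomes the one for `|+^k⟩` in the
frame. -/
theorem hadamardTransform_cnotAct {c t : V} (h : c ≠ t) (ψ : Bits V → ℂ) :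
    cnotAct t c (hadamardTransform ψ) = hadamardTransform (cnotAct c t ψ) := by
  ext x
  simp only [cnotAct, hadamardTransform]
  let e : Bits V ≃ Bits V :=
    ⟨fun y => Function.update y t (y t + y c), fun y => Function.update y t (y t + y c),
      cnot_cnot h, cnot_cnot h⟩
  refine Fintype.sum_equiv e _ _ fun y => ?_
  show _ = sgn (x ⬝ᵥ Function.update y t (y t + y c)) * ψ (e (e y))
  rw [dotProduct_cnot, show e (e y) = y from cnot_cnot h y]

theorem cnotMat_mulVec {c t : V} (h : c ≠ t) (ψ : Bits V → ℂ) :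
    CliffordGate.cnotMat c t *ᵥ ψ = cnotAct c t ψ := by
  ext x
  simp only [Matrix.mulVec, dotProduct, CliffordGate.cnotMat, Matrix.of_apply, cnotAct]
  rw [Finset.sum_eq_single (Function.update x t (x t + x c))]
  · rw [cnot_cnot h, if_pos rfl, one_mul]
  · intro y _ hy
    rw [if_neg, zero_mul]
    intro hx
    apply hy
    rw [hx, cnot_cnot h]
  · simp

theorem onQubit_mulVec (q : V) (A : Matrix (ZMod 2) (ZMod 2) ℂ) (ψ : Bits V → ℂ) (x : Bits V) :
    (onQubit q A *ᵥ ψ) x = ∑ b, A (x q) b * ψ (Function.update x q b) := by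
  simp only [Matrix.mulVec, dotProduct, onQubit, Matrix.of_apply, ite_mul, zero_mul]
  rw [← Finset.sum_filter]
  symm
  refine Finset.sum_bij (fun b _ => Function.update x q b) ?_ ?_ ?_ ?_
  · intro b _
    simp only [Finset.mem_filter, Finset.mem_univ, true_and]
    intro v hv
    simp [hv]
  · intro b _ b' _ h
    simpa using congrFun h q
  · intro y hy
    simp only [Finset.mem_filter, Finset.mem_univ, true_and] at hy
    refine ⟨y q, Finset.mem_univ _, ?_⟩
    ext v
    by_cases hv : v = q
    · subst hv; simp
    · simp [hv, hy v hv]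
  · intro b _
    simp

theorem onQubit_X_mulVec (q : V) (ψ : Bits V → ℂ) :
    onQubit q Pauli.X.mat *ᵥ ψ = shift (Pi.single q 1) ψ := by
  ext x
  have h11 : (1 : ZMod 2) + 1 = 0 := by decide
  rw [onQubit_mulVec, shift, ← update_add_self x, sum_zmod_two]
  rcases zmod_two_cases (x q) with h | h <;> simp [h, Pauli.mat, h11]

theorem onQubit_Z_mulVec (q : V) (ψ : Bits V → ℂ) :
    onQubit q Pauli.Z.mat *ᵥ ψ = phase (Pi.single q 1) ψ := by
  ext x
  rw [onQubit_mulVec, phase, sum_zmod_two]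
  have hx : ∀ s, x q = s → Function.update x q s = x := fun s hs => by
    rw [← hs, Function.update_eq_self]
  rcases zmod_two_cases (x q) with h | h <;> simp [h, Pauli.mat, hx _ h]

theorem onQubit_one_mulVec (q : V) (ψ : Bits V → ℂ) :
    onQubit q 1 *ᵥ ψ = ψ := by
  ext x
  rw [onQubit_mulVec, sum_zmod_two]
  have hx : ∀ s, x q = s → Function.update x q s = x := fun s hs => by
    rw [← hs, Function.update_eq_self]
  rcases zmod_two_cases (x q) with h | h <;> simp [h, hx _ h, Matrix.one_apply]

theorem proj_mulVec (P : Pauli) (q : V) (s : ZMod 2) (ψ : Bits V → ℂ) :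
    CliffordGate.proj P q s *ᵥ ψ = (2 : ℂ)⁻¹ • (ψ + sgn s • (onQubit q P.mat *ᵥ ψ)) := by
  ext x
  nth_rw 2 [← onQubit_one_mulVec q ψ]
  simp only [CliffordGate.proj, onQubit_mulVec, Pi.smul_apply, Pi.add_apply, smul_eq_mul, sgn,
    Matrix.smul_apply, Matrix.add_apply, sum_zmod_two]
  ring

theorem projAct_eq (q : V) (s : ZMod 2) (ψ : Bits V → ℂ) :
    projAct q s ψ = (2 : ℂ)⁻¹ • (ψ + sgn s • phase (Pi.single q 1) ψ) := by
  ext x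
  simp only [projAct, Pi.smul_apply, Pi.add_apply, smul_eq_mul, phase, single_dotProduct, one_mul,
    ← mul_assoc]
  rcases zmod_two_cases (x q) with h | h <;> rcases zmod_two_cases s with rfl | rfl <;>
    simp [h] <;> ring

namespace PrepBasis

variable (b : PrepBasis)

/-- The Pauli basis in which the ancilla qubits are measured. -/
def readoutPauli : PrepBasis → Pauli
  | plus => .Z
  | zero => .X

/-- The Pauli operator by which data qubits are corrected. -/
def correctionPauli : PrepBasis → Pauli
  | plus => .X
  | zero => .Z

theorem onQubit_readoutPauli_frame (q : V) (ψ : Bits V → ℂ) :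
    onQubit q b.readoutPauli.mat *ᵥ b.frame ψ = b.frame (phase (Pi.single q 1) ψ) := by
  cases b
  · exact onQubit_Z_mulVec q ψ
  · exact (onQubit_X_mulVec q _).trans (hadamardTransform_phase _ _).symm

theorem onQubit_correctionPauli_frame (q : V) (ψ : Bits V → ℂ) :
    onQubit q b.correctionPauli.mat *ᵥ b.frame ψ = b.frame (shift (Pi.single q 1) ψ) := by
  cases b
  · exact onQubit_X_mulVec q ψ
  · exact (onQubit_Z_mulVec q _).trans (hadamardTransform_shift _ _).symm

theorem frame_add (ψ φ : Bits V → ℂ) : b.frame (ψ + φ) = b.frame ψ + b.frame φ := by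
  cases b
  · rfl
  · exact hadamardTransform_add _ _

theorem proj_frame (q : V) (s : ZMod 2) (ψ : Bits V → ℂ) :
    CliffordGate.proj b.readoutPauli q s *ᵥ b.frame ψ = b.frame (projAct q s ψ) := by
  rw [proj_mulVec, onQubit_readoutPauli_frame, projAct_eq, frame_smul, frame_add, frame_smul]

/-- The control and target of the coupling. -/
noncomputable def couplingMat (d a : V) : Matrix (Bits V) (Bits V) ℂ :=
  match b with
  | plus => CliffordGate.cnotMat d a
  | zero => CliffordGate.cnotMat a d

theorem couplingMat_frame {d a : V} (h : d ≠ a) (ψ : Bits V → ℂ) :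
    b.couplingMat d a *ᵥ b.frame ψ = b.frame (cnotAct d a ψ) := by
  cases b
  · exact cnotMat_mulVec h ψ
  · exact (cnotMat_mulVec h.symm _).trans (hadamardTransform_cnotAct h ψ)

end PrepBasis

/-- A matrix with real entries. -/
def IsRealMatrix {m n : Type*} (A : Matrix m n ℂ) : Prop := ∀ x y, star (A x y) = A x y

/-- The couplings, readout projections and corrections are all real, so `σ ↦ A σ Aᴴ` acts on both
factors of a rank one operator by the same matrix, without conjugation. -/
theorem IsRealMatrix.vecMul {m n : Type*} [Fintype n] {A : Matrix m n ℂ} (h : IsRealMatrix A)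
    (φ : n → ℂ) : φ ᵥ* Aᴴ = A *ᵥ φ := by
  ext x
  simp only [Matrix.vecMul, Matrix.mulVec, dotProduct, Matrix.conjTranspose_apply, h _ _]
  exact Finset.sum_congr rfl fun y _ => mul_comm _ _

theorem isRealMatrix_onQubit (q : V) {A : Matrix (ZMod 2) (ZMod 2) ℂ} (h : IsRealMatrix A) :
    IsRealMatrix (onQubit q A) := by
  intro x y
  simp only [onQubit, Matrix.of_apply]
  split_ifs
  · exact h _ _
  · simp

namespace PrepBasis

variable (b : PrepBasis)

theorem isRealMatrix_correction (q : V) : IsRealMatrix (onQubit q b.correctionPauli.mat) := by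
  refine isRealMatrix_onQubit q fun x y => ?_
  cases b <;> simp only [correctionPauli, Pauli.mat, Matrix.of_apply] <;> split_ifs <;> simp

theorem isRealMatrix_readout (q : V) (s : ZMod 2) :
    IsRealMatrix (CliffordGate.proj b.readoutPauli q s) := by
  refine isRealMatrix_onQubit q fun x y => ?_
  cases b <;> simp only [readoutPauli, Pauli.mat, Matrix.of_apply, Matrix.smul_apply,
    Matrix.add_apply, Matrix.one_apply] <;> split_ifs <;> simp

theorem isRealMatrix_coupling (d a : V) : IsRealMatrix (b.couplingMat d a) := by
  intro x y
  cases b <;> simp only [couplingMat, CliffordGate.cnotMat, Matrix.of_apply] <;> split_ifs <;> simp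

end PrepBasis

end Vectors

/-! ### Pauli errors on product operators -/

namespace Pauli

/-- The exponent of `X` in a Pauli matrix. -/
def xBit : Pauli → ZMod 2
  | I => 0
  | X => 1
  | Y => 1
  | Z => 0

/-- The exponent of `Z` in a Pauli matrix. -/
def zBit : Pauli → ZMod 2
  | I => 0
  | X => 0
  | Y => 1
  | Z => 1

/-- The scalar that relates a Pauli matrix to `Z^z X^x`. -/
noncomputable def coef : Pauli → ℂ
  | I => 1
  | X => 1
  | Y => -Complex.I
  | Z => 1

/-- The Pauli matrix proportional to `Z^z X^x`. -/
def ofBits (x z : ZMod 2) : Pauli :=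
  if x = 0 then (if z = 0 then I else Z) else (if z = 0 then X else Y)

theorem xBit_ofBits : ∀ x z, (ofBits x z).xBit = x := by decide

theorem zBit_ofBits : ∀ x z, (ofBits x z).zBit = z := by decide

theorem ofBits_ne_I {x z : ZMod 2} (h : ofBits x z ≠ I) : x ≠ 0 ∨ z ≠ 0 := by
  by_contra! h'
  exact h (by simp [ofBits, h'.1, h'.2])

theorem coef_ne_zero (P : Pauli) : P.coef ≠ 0 := by cases P <;> simp [coef]

theorem mat_apply (P : Pauli) (x y : ZMod 2) :
    P.mat x y = P.coef * sgn (P.zBit * x) * if y = x + P.xBit then 1 else 0 := by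
  have h11 : (1 : ZMod 2) + 1 = 0 := by decide
  rcases zmod_two_cases x with rfl | rfl <;> rcases zmod_two_cases y with rfl | rfl <;> cases P <;>
    simp [mat, coef, xBit, zBit, h11]

variable {V : Type*} [Fintype V] [DecidableEq V]

theorem tensor_apply (P : V → Pauli) (x y : Bits V) :
    tensor P x y = (∏ v, (P v).coef) * sgn ((fun v => (P v).zBit) ⬝ᵥ x) *
      if y = x + (fun v => (P v).xBit) then 1 else 0 := by
  simp only [tensor, Matrix.of_apply, mat_apply, Finset.prod_mul_distrib, dotProduct, sgn_sum,
    Finset.prod_ite_zero, Finset.prod_const_one, funext_iff, Pi.add_apply, Finset.mem_univ,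
    true_imp_iff]

theorem tensor_mulVec (P : V → Pauli) (ψ : Bits V → ℂ) :
    tensor P *ᵥ ψ = (∏ v, (P v).coef) •
      phase (fun v => (P v).zBit) (shift (fun v => (P v).xBit) ψ) := by
  ext x
  simp only [Matrix.mulVec, dotProduct, Pi.smul_apply, phase, shift, smul_eq_mul]
  rw [Finset.sum_eq_single (x + fun v => (P v).xBit)]
  · rw [tensor_apply, if_pos rfl, mul_one, mul_assoc]
    rfl
  · intro y _ hy
    rw [tensor_apply, if_neg hy, mul_zero, zero_mul]
  · simp

/-- On the right factor a Pauli operator acts by its transpose. Reversing the order of `Z^z X^x`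
produces the additional sign. -/
theorem vecMul_tensor (P : V → Pauli) (φ : Bits V → ℂ) :
    φ ᵥ* tensor P = ((∏ v, (P v).coef) * sgn ((fun v => (P v).zBit) ⬝ᵥ fun v => (P v).xBit)) •
      phase (fun v => (P v).zBit) (shift (fun v => (P v).xBit) φ) := by
  ext y
  simp only [Matrix.vecMul, dotProduct, Pi.smul_apply, phase, shift, smul_eq_mul]
  rw [Finset.sum_eq_single (y + fun v => (P v).xBit)]
  · rw [tensor_apply, if_pos (by rw [add_assoc, ZModModule.add_self, add_zero]), mul_one,
      dotProduct_add, sgn_add]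
    simp only [dotProduct]
    ring
  · intro x _ hx
    rw [tensor_apply, if_neg, mul_zero, mul_zero]
    rintro rfl
    exact hx (by rw [add_assoc, ZModModule.add_self, add_zero])
  · simp

end Pauli

section Products

variable {V : Type*} [Fintype V] [DecidableEq V] {R : Type*} [Fintype R] [DecidableEq R]

/-- The product of a rank one operator on the qubits and an operator on the reference system. -/
noncomputable def prodOp (ψ φ : Bits V → ℂ) (ρ : Matrix R R ℂ) : Op V R :=
  Matrix.vecMulVec ψ φ ⊗ₖ ρ

theorem prodOp_smul_left (c : ℂ) (ψ φ : Bits V → ℂ) (ρ : Matrix R R ℂ) :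
    prodOp (c • ψ) φ ρ = c • prodOp ψ φ ρ := by
  rw [prodOp, Matrix.smul_vecMulVec, Matrix.smul_kronecker, prodOp]

theorem prodOp_smul_right (c : ℂ) (ψ φ : Bits V → ℂ) (ρ : Matrix R R ℂ) :
    prodOp ψ (c • φ) ρ = c • prodOp ψ φ ρ := by
  rw [prodOp, Matrix.vecMulVec_smul, Matrix.smul_kronecker, prodOp]

theorem sandwich_prodOp (A B : Matrix (Bits V) (Bits V) ℂ) (ψ φ : Bits V → ℂ) (ρ : Matrix R R ℂ) :
    sandwich A B (prodOp ψ φ ρ) = prodOp (A *ᵥ ψ) (φ ᵥ* B) ρ := by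
  rw [sandwich, prodOp, ← Matrix.mul_kronecker_mul, ← Matrix.mul_kronecker_mul, one_mul, mul_one,
    Matrix.mul_vecMulVec, Matrix.vecMulVec_mul, prodOp]

/-- `sandwich` as a linear map. -/
noncomputable def sandwichLin (A B : Matrix (Bits V) (Bits V) ℂ) : Op V R →ₗ[ℂ] Op V R where
  toFun := sandwich A B
  map_add' x y := by simp [sandwich, mul_add, add_mul]
  map_smul' c x := by simp [sandwich]

theorem sandwich_smul (A B : Matrix (Bits V) (Bits V) ℂ) (c : ℂ) (σ : Op V R) :
    sandwich A B (c • σ) = c • sandwich A B σ := map_smul (sandwichLin A B) c σ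

theorem sandwich_zero (A B : Matrix (Bits V) (Bits V) ℂ) : sandwich A B (0 : Op V R) = 0 :=
  map_zero (sandwichLin A B)

theorem sandwich_sum {ι : Type*} (s : Finset ι) (A B : Matrix (Bits V) (Bits V) ℂ)
    (σ : ι → Op V R) : sandwich A B (∑ i ∈ s, σ i) = ∑ i ∈ s, sandwich A B (σ i) :=
  map_sum (sandwichLin A B) σ s

/-- The action of the Pauli `Z^p X^u`, for `E = (p, u)`. -/
noncomputable def pauliAct (E : Bits V × Bits V) (f : Bits V → ℂ) : Bits V → ℂ :=
  phase E.1 (shift E.2 f)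

/-- The product operator obtained from `f` and `f'` by Pauli errors and a change of basis. -/
noncomputable def twisted (b : PrepBasis) (E : Bits V × Bits V) (f : Bits V → ℂ)
    (E' : Bits V × Bits V) (f' : Bits V → ℂ) (ρ : Matrix R R ℂ) : Op V R :=
  prodOp (b.frame (pauliAct E f)) (b.frame (pauliAct E' f')) ρ

/-- The exponents of a Pauli operator in the frame. -/
def PrepBasis.pauliBits (b : PrepBasis) (P : V → Pauli) : Bits V × Bits V :=
  (b.phasePart (fun v => (P v).xBit) (fun v => (P v).zBit),
    b.shiftPart (fun v => (P v).xBit) (fun v => (P v).zBit))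

theorem PrepBasis.pauliBits_eq_zero (b : PrepBasis) (P : V → Pauli) {v : V} (h : P v = .I) :
    (b.pauliBits P).1 v = 0 ∧ (b.pauliBits P).2 v = 0 := by
  cases b <;> simp [pauliBits, phasePart, shiftPart, h, Pauli.xBit, Pauli.zBit]

theorem PrepBasis.exists_pauliBits_eq (b : PrepBasis) (E : Bits V × Bits V) :
    ∃ P : V → Pauli, b.pauliBits P = E ∧ ∀ v, P v ≠ .I → E.1 v ≠ 0 ∨ E.2 v ≠ 0 := by
  cases b
  · refine ⟨fun v => Pauli.ofBits (E.2 v) (E.1 v), ?_, fun v hv => (Pauli.ofBits_ne_I hv).symm⟩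
    simp [pauliBits, phasePart, shiftPart, Pauli.xBit_ofBits, Pauli.zBit_ofBits]
  · refine ⟨fun v => Pauli.ofBits (E.1 v) (E.2 v), ?_, fun v hv => Pauli.ofBits_ne_I hv⟩
    simp [pauliBits, phasePart, shiftPart, Pauli.xBit_ofBits, Pauli.zBit_ofBits]

theorem PrepBasis.tensor_frame (b : PrepBasis) (P : V → Pauli) :
    ∃ c : ℂ, c ≠ 0 ∧ ∀ ψ : Bits V → ℂ,
      Pauli.tensor P *ᵥ b.frame ψ = c • b.frame (pauliAct (b.pauliBits P) ψ) := by
  obtain ⟨c, hc, h⟩ := b.phase_shift_frame (fun v => (P v).xBit) (fun v => (P v).zBit)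
  refine ⟨(∏ v, (P v).coef) * c,
    mul_ne_zero (Finset.prod_ne_zero_iff.2 fun v _ => Pauli.coef_ne_zero _) hc, fun ψ => ?_⟩
  rw [Pauli.tensor_mulVec, h, mul_smul]
  rfl

theorem PrepBasis.frame_tensor (b : PrepBasis) (P : V → Pauli) :
    ∃ c : ℂ, c ≠ 0 ∧ ∀ ψ : Bits V → ℂ,
      b.frame ψ ᵥ* Pauli.tensor P = c • b.frame (pauliAct (b.pauliBits P) ψ) := by
  obtain ⟨c, hc, h⟩ := b.phase_shift_frame (fun v => (P v).xBit) (fun v => (P v).zBit)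
  refine ⟨(∏ v, (P v).coef) * sgn ((fun v => (P v).zBit) ⬝ᵥ fun v => (P v).xBit) * c,
    mul_ne_zero (mul_ne_zero (Finset.prod_ne_zero_iff.2 fun v _ => Pauli.coef_ne_zero _)
      (sgn_ne_zero _)) hc, fun ψ => ?_⟩
  simp only [Pauli.vecMul_tensor, h, mul_smul]
  rfl

/-- A Pauli superoperator acts on `prodOp` by adding its exponents, up to a nonzero scalar. -/
theorem PauliSuperop.exists_apply_prodOp (b : PrepBasis) (F : PauliSuperop V) :
    ∃ c : ℂ, c ≠ 0 ∧ ∀ (ψ φ : Bits V → ℂ) (ρ : Matrix R R ℂ),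
      F.apply (prodOp (b.frame ψ) (b.frame φ) ρ) =
      c • prodOp (b.frame (pauliAct (b.pauliBits F.left) ψ))
        (b.frame (pauliAct (b.pauliBits F.right) φ)) ρ := by
  obtain ⟨c, hc, h⟩ := b.tensor_frame F.left
  obtain ⟨c', hc', h'⟩ := b.frame_tensor F.right
  refine ⟨c * c', mul_ne_zero hc hc', fun ψ φ ρ => ?_⟩
  rw [PauliSuperop.apply, sandwich_prodOp, h, h', prodOp_smul_left, prodOp_smul_right, mul_smul]

theorem pauliAct_pauliAct (E E' : Bits V × Bits V) (f : Bits V → ℂ) :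
    pauliAct E' (pauliAct E f) = sgn (E.1 ⬝ᵥ E'.2) • pauliAct (E' + E) f :=
  phase_shift_phase_shift _ _ _ _ _

/-- The scalar depends on the exponents alone and not on `f`, `f'`, so one scalar serves all values
of the classical register. -/
theorem PauliSuperop.apply_twisted (b : PrepBasis) (F : PauliSuperop V) (E : Bits V × Bits V)
    (E' : Bits V × Bits V) :
    ∃ c : ℂ, ∀ (f f' : Bits V → ℂ) (ρ : Matrix R R ℂ), F.apply (twisted b E f E' f' ρ) =
      c • twisted b (b.pauliBits F.left + E) f (b.pauliBits F.right + E') f' ρ := by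
  obtain ⟨c, -, h⟩ := F.exists_apply_prodOp b (R := R)
  refine ⟨c * (sgn (E.1 ⬝ᵥ (b.pauliBits F.left).2) * sgn (E'.1 ⬝ᵥ (b.pauliBits F.right).2)),
    fun f f' ρ => ?_⟩
  rw [twisted, h, pauliAct_pauliAct, pauliAct_pauliAct, b.frame_smul, b.frame_smul, prodOp_smul_left,
    prodOp_smul_right, twisted, mul_smul, mul_smul]

/-- The conjugation of a Pauli error by a `CNOT`. -/
def cnotError (d a : V) (E : Bits V × Bits V) : Bits V × Bits V :=
  (Function.update E.1 d (E.1 d + E.1 a), Function.update E.2 a (E.2 a + E.2 d))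

/-- The error is conjugated through the gate, while `f` and `f'` evolve as in a run without faults.
-/
theorem sandwich_coupling_twisted (b : PrepBasis) {d a : V} (h : d ≠ a) (E : Bits V × Bits V)
    (f : Bits V → ℂ) (E' : Bits V × Bits V) (f' : Bits V → ℂ) (ρ : Matrix R R ℂ) :
    sandwich (b.couplingMat d a) (b.couplingMat d a)ᴴ (twisted b E f E' f' ρ) =
      twisted b (cnotError d a E) (cnotAct d a f) (cnotError d a E') (cnotAct d a f') ρ := by
  rw [twisted, sandwich_prodOp, (b.isRealMatrix_coupling d a).vecMul, b.couplingMat_frame h,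
    b.couplingMat_frame h, pauliAct, pauliAct, cnotAct_phase_shift h, cnotAct_phase_shift h]
  rfl

/-- A shift error on the measured qubit flips the outcome: recording `s` projects the ideal vector
to `s + E.2 a`. The two factors may be projected to different outcomes. -/
theorem sandwich_readout_twisted (b : PrepBasis) (a : V) (s : ZMod 2) (E : Bits V × Bits V)
    (f : Bits V → ℂ) (E' : Bits V × Bits V) (f' : Bits V → ℂ) (ρ : Matrix R R ℂ) :
    sandwich (CliffordGate.proj b.readoutPauli a s) (CliffordGate.proj b.readoutPauli a s)ᴴ
      (twisted b E f E' f' ρ) =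
      twisted b E (projAct a (s + E.2 a) f) E' (projAct a (s + E'.2 a) f') ρ := by
  rw [twisted, sandwich_prodOp, (b.isRealMatrix_readout a s).vecMul, b.proj_frame, b.proj_frame,
    pauliAct, pauliAct, projAct_phase_shift, projAct_phase_shift]
  rfl

/-- The correction is moved past the error onto the ideal vector. This costs only a sign, so the
exponents of the error stay the same. -/
theorem sandwich_correction_twisted (b : PrepBasis) (d : V) (E : Bits V × Bits V)
    (f : Bits V → ℂ) (E' : Bits V × Bits V) (f' : Bits V → ℂ) (ρ : Matrix R R ℂ) :
    sandwich (onQubit d b.correctionPauli.mat) (onQubit d b.correctionPauli.mat)ᴴ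
      (twisted b E f E' f' ρ) = (sgn (E.1 d) * sgn (E'.1 d)) •
      twisted b E (shift (Pi.single d 1) f) E' (shift (Pi.single d 1) f') ρ := by
  rw [twisted, sandwich_prodOp, (b.isRealMatrix_correction d).vecMul,
    b.onQubit_correctionPauli_frame, b.onQubit_correctionPauli_frame, pauliAct, pauliAct,
    shift_phase_shift, shift_phase_shift, b.frame_smul, b.frame_smul, prodOp_smul_left,
    prodOp_smul_right, mul_smul, dotProduct_single, dotProduct_single, mul_one, mul_one]
  rfl

end Products

/-! ### The gates of state preparation -/

namespace PrepBasis

variable {V : Type*} [Fintype V] [DecidableEq V] {R : Type*} [Fintype R] [DecidableEq R] {M : ℕ}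
  (b : PrepBasis)

theorem apply_coupling (i : Fin M) {d a : V} (h : d ≠ a) (σ : CQOp V M R) :
    (b.coupling d a h).apply i σ = fun x => if x i = 1 then
      sandwich (b.couplingMat d a) (b.couplingMat d a)ᴴ (σ x) else σ x := by
  cases b <;> rfl

theorem apply_readout (i : Fin M) (a : V) (σ : CQOp V M R) :
    (b.readout a).apply i σ = fun y => ∑ x : Bits (Fin M), if Function.update x i (y i) = y then
      sandwich (CliffordGate.proj b.readoutPauli a (y i))
        (CliffordGate.proj b.readoutPauli a (y i))ᴴ (σ x) else 0 := by
  cases b <;> rfl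

theorem apply_correction (i : Fin M) (d : V) (σ : CQOp V M R) :
    (b.correction d).apply i σ = fun x => if x i = 1 then
      sandwich (onQubit d b.correctionPauli.mat) (onQubit d b.correctionPauli.mat)ᴴ (σ x)
      else σ x := by
  cases b <;> rfl

/-- The reset of an ancilla or data qubit. -/
def reset (anc : Prop) [Decidable anc] (q : V) : CliffordGate V :=
  if anc then b.resetAncilla q else b.resetData q

/-- The amplitudes of a reset qubit. -/
noncomputable def amplitude (anc : Prop) [Decidable anc] (s : ZMod 2) : ℂ :=
  match b, decide anc with
  | plus, true => if s = 0 then 1 else 0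
  | zero, false => if s = 0 then 1 else 0
  | plus, false => ((Real.sqrt 2 : ℝ) : ℂ)⁻¹
  | zero, true => ((Real.sqrt 2 : ℝ) : ℂ)⁻¹

theorem sandwich_onQubit_apply (q : V) (A : Matrix (ZMod 2) (ZMod 2) ℂ) (σ : Op V R)
    (x y : Bits V) (p p' : R) :
    sandwich (onQubit q A) (onQubit q A)ᴴ σ (x, p) (y, p') =
      ∑ s, ∑ s', A (x q) s * star (A (y q) s') *
        σ (Function.update x q s, p) (Function.update y q s', p') := by
  have h1 : ∀ z : Bits V × R, ((onQubit q A ⊗ₖ (1 : Matrix R R ℂ)) * σ) (x, p) z =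
      ∑ s, A (x q) s * σ (Function.update x q s, p) z := by
    intro z
    rw [Matrix.mul_apply, Fintype.sum_prod_type, ← onQubit_mulVec q A (fun x' => σ (x', p) z) x]
    simp only [Matrix.mulVec, dotProduct]
    refine Finset.sum_congr rfl fun x' _ => ?_
    rw [Finset.sum_eq_single p]
    · simp [Matrix.kroneckerMap_apply]
    · intro p'' _ hp
      simp [Matrix.kroneckerMap_apply, Matrix.one_apply_ne hp.symm]
    · simp
  have h2 : ∀ S : Bits V → ℂ, ∑ y', S y' * (onQubit q A)ᴴ y' y =
      ∑ s', star (A (y q) s') * S (Function.update y q s') := by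
    intro S
    have h3 := onQubit_mulVec q A (fun y' => star (S y')) y
    have h4 := congrArg star h3
    rw [star_sum] at h4
    simp only [star_mul', star_star] at h4
    rw [← h4]
    simp only [Matrix.mulVec, dotProduct, star_sum, star_mul', star_star, Matrix.conjTranspose_apply]
    exact Finset.sum_congr rfl fun _ _ => mul_comm _ _
  rw [sandwich, Matrix.mul_apply, Fintype.sum_prod_type]
  have h5 : ∀ y' : Bits V, ∑ p'', ((onQubit q A ⊗ₖ (1 : Matrix R R ℂ)) * σ) (x, p) (y', p'') *
      ((onQubit q A)ᴴ ⊗ₖ (1 : Matrix R R ℂ)) (y', p'') (y, p') =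
      (∑ s, A (x q) s * σ (Function.update x q s, p) (y', p')) * (onQubit q A)ᴴ y' y := by
    intro y'
    rw [Finset.sum_eq_single p']
    · rw [h1]
      simp [Matrix.kroneckerMap_apply]
    · intro p'' _ hp
      simp [Matrix.kroneckerMap_apply, Matrix.one_apply_ne hp]
    · simp
  simp only [h5]
  rw [h2, Finset.sum_comm]
  refine Finset.sum_congr rfl fun s' _ => ?_
  rw [Finset.mul_sum]
  exact Finset.sum_congr rfl fun s _ => by ring

/-- All four resets are a partial trace over `q` followed by the preparation of a pure state with
real amplitudes, so a single invariant handles the whole reset step. -/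
theorem channel_reset_apply (anc : Prop) [Decidable anc] (q : V) (σ : Op V R)
    (x y : Bits V) (p p' : R) :
    (b.reset anc q).channel σ (x, p) (y, p') = b.amplitude anc (x q) * b.amplitude anc (y q) *
      ∑ s, σ (Function.update x q s, p) (Function.update y q s, p') := by
  by_cases h : anc <;> cases b <;>
    simp only [reset, amplitude, resetAncilla, resetData, CliffordGate.channel, h, if_true, if_false,
      decide_true, decide_false, Matrix.sum_apply, sandwich_onQubit_apply, CliffordGate.ketZeroBra,
      CliffordGate.ketPlusBra, Matrix.of_apply, sum_zmod_two]
  · by_cases hx : x q = 0 <;> by_cases hy : y q = 0 <;> simp [hx, hy]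
  · simp; ring
  · simp; ring
  · by_cases hx : x q = 0 <;> by_cases hy : y q = 0 <;> simp [hx, hy]

theorem apply_reset (i : Fin M) (anc : Prop) [Decidable anc] (q : V) (σ : CQOp V M R) :
    (b.reset anc q).apply i σ = fun x => if x i = 1 then (b.reset anc q).channel (σ x) else σ x := by
  unfold reset
  split_ifs <;> cases b <;> rfl

end PrepBasis

/-! ### Time steps and folds -/

theorem foldl_finRange_induction {β : Type*} {n : ℕ} (f : β → Fin n → β) (P : ℕ → β → Prop) {x : β}
    (h0 : P 0 x) (hs : ∀ (t : Fin n) (y : β), P t.val y → P (t.val + 1) (f y t)) :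
    P n ((List.finRange n).foldl f x) := by
  induction n generalizing x P with
  | zero => simpa using h0
  | succ n ih =>
    rw [List.finRange_succ, List.foldl_cons, List.foldl_map]
    exact ih (fun y t => f y t.succ) (fun k => P (k + 1)) (hs 0 x h0) fun t y h => hs t.succ y h

section OfGates

variable {V Γ : Type*} [Fintype Γ] {M : ℕ}

/-- The classical bit of a gate of a time step whose gates are indexed by `Γ`. -/
noncomputable def gateBit (hM : Fintype.card Γ ≤ M) (γ : Γ) : Fin M :=
  Fin.castLE hM (Fintype.equivFin Γ γ)

theorem gateBit_injective (hM : Fintype.card Γ ≤ M) : Function.Injective (gateBit hM) := by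
  intro γ γ' h
  exact (Fintype.equivFin Γ).injective (Fin.castLE_injective hM h)

/-- A time step with gates indexed by `Γ`. -/
noncomputable def TimeStep.ofGates (hM : Fintype.card Γ ≤ M)
    (cl : Bits (Fin M) → Bits (Fin M)) (gate : Γ → CliffordGate V)
    (hd : ∀ γ γ', γ ≠ γ' → Disjoint (gate γ).qubits (gate γ').qubits) : TimeStep V M where
  classical := cl
  numGates := Fintype.card Γ
  numGates_le := hM
  gate g := gate ((Fintype.equivFin Γ).symm g)
  disjoint _ _ hgh := hd _ _ fun h' => hgh ((Fintype.equivFin Γ).symm.injective h')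

/-- The invariant is indexed by the set of gates already performed, which makes the order of the
gates within the step irrelevant. Its base case is the state after the classical computation. -/
theorem TimeStep.ofGates_apply_induction [Fintype V] [DecidableEq V] [DecidableEq Γ] {R : Type*}
    [Fintype R] [DecidableEq R] (hM : Fintype.card Γ ≤ M) (cl : Bits (Fin M) → Bits (Fin M))
    (gate : Γ → CliffordGate V)
    (hd : ∀ γ γ', γ ≠ γ' → Disjoint (gate γ).qubits (gate γ').qubits) (σ : CQOp V M R)
    (P : Finset Γ → CQOp V M R → Prop)
    (h0 : P ∅ (fun y => ∑ x : Bits (Fin M), if cl x = y then σ x else 0))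
    (hs : ∀ s γ τ, γ ∉ s → P s τ → P (insert γ s) ((gate γ).apply (gateBit hM γ) τ)) :
    P Finset.univ ((TimeStep.ofGates hM cl gate hd).apply σ) := by
  set f : CQOp V M R → Fin (Fintype.card Γ) → CQOp V M R := fun τ g =>
    (gate ((Fintype.equivFin Γ).symm g)).apply (gateBit hM ((Fintype.equivFin Γ).symm g)) τ with hf
  have key : ∀ (l : List (Fin (Fintype.card Γ))), l.Nodup → ∀ s τ,
      (∀ g ∈ l, (Fintype.equivFin Γ).symm g ∉ s) → P s τ →
      P (s ∪ l.toFinset.image (Fintype.equivFin Γ).symm) (l.foldl f τ) := by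
    intro l
    induction l with
    | nil => intro _ s τ _ h; simpa using h
    | cons g l ih =>
      intro hl s τ hdis h
      rw [List.nodup_cons] at hl
      have h1 := hs s _ τ (hdis g List.mem_cons_self) h
      have h2 := ih hl.2 (insert ((Fintype.equivFin Γ).symm g) s) _ ?_ h1
      · rw [List.foldl_cons]
        convert h2 using 1
        ext γ
        simp only [List.toFinset_cons, Finset.image_insert, Finset.mem_union, Finset.mem_insert]
        tauto
      · intro g' hg' hmem
        rcases Finset.mem_insert.1 hmem with h' | h'
        · have := (Fintype.equivFin Γ).symm.injective h'
          exact hl.1 (this ▸ hg')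
        · exact hdis g' (List.mem_cons_of_mem _ hg') h'
  have := key (List.finRange _) (List.nodup_finRange _) ∅ _ (by simp) h0
  have hbit : ∀ g, gateBit hM ((Fintype.equivFin Γ).symm g) = Fin.castLE hM g := fun g => by
    simp only [gateBit, Equiv.apply_symm_apply]
  simp only [hf, hbit] at this
  have huniv : ∅ ∪ (List.finRange (Fintype.card Γ)).toFinset.image (Fintype.equivFin Γ).symm =
      Finset.univ := by
    ext γ
    simp only [Finset.mem_univ, Finset.empty_union, Finset.mem_image, List.mem_toFinset,
      List.mem_finRange, true_and, iff_true]
    exact ⟨_, Equiv.symm_apply_apply _ γ⟩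
  rw [huniv] at this
  exact this

end OfGates

/-! ### The state preparation circuit -/

/-- The data of a state preparation circuit: which qubits are ancilla qubits, which data qubits are coupled
to which ancilla qubits, an edge coloring, and the Pauli correction for each syndrome. -/
structure PrepLayout (V : Type*) where
  anc : V → Prop
  rel : V → V → Prop
  rel_data : ∀ {d a}, rel d a → ¬ anc d
  rel_anc : ∀ {d a}, rel d a → anc a
  numColors : ℕ
  color : V × V → ℕ
  color_lt : ∀ {d a}, rel d a → color (d, a) < numColors
  color_proper : ∀ {q q' : V × V}, rel q.1 q.2 → rel q'.1 q'.2 → q ≠ q' → color q = color q' →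
    q.1 ≠ q'.1 ∧ q.2 ≠ q'.2
  corr : Bits V → Bits V
  corr_anc : ∀ s v, anc v → corr s v = 0

namespace PrepLayout

open scoped Classical

variable {V : Type*} [Fintype V] [DecidableEq V] (L : PrepLayout V) (b : PrepBasis)

theorem rel_ne {d a : V} (h : L.rel d a) : d ≠ a := fun h' => L.rel_data h (h' ▸ L.rel_anc h)

/-- The number of classical bits. -/
def bits (_ : PrepLayout V) : ℕ := Fintype.card V + Fintype.card (V × V)

/-- The couplings of a given color. -/
abbrev Pairs (t : ℕ) : Type _ := {q : V × V // L.rel q.1 q.2 ∧ L.color q = t}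

abbrev Anc : Type _ := {v : V // L.anc v}

abbrev Data : Type _ := {v : V // ¬ L.anc v}

theorem card_le : Fintype.card V ≤ L.bits := Nat.le_add_right _ _

theorem card_pairs_le (t : ℕ) : Fintype.card (L.Pairs t) ≤ L.bits :=
  (Fintype.card_subtype_le _).trans (Nat.le_add_left _ _)

theorem card_anc_le : Fintype.card L.Anc ≤ L.bits := (Fintype.card_subtype_le _).trans L.card_le

theorem card_data_le : Fintype.card L.Data ≤ L.bits := (Fintype.card_subtype_le _).trans L.card_le

theorem reset_disjoint (q q' : V) (h : q ≠ q') :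
    Disjoint (b.reset (L.anc q) q).qubits (b.reset (L.anc q') q').qubits := by
  have : ∀ q, (b.reset (L.anc q) q).qubits = {q} := fun q => by
    unfold PrepBasis.reset
    split_ifs <;> cases b <;> rfl
  rw [this, this]
  exact Set.disjoint_singleton.2 h

/-- The step that resets all qubits. -/
noncomputable def resetStep : TimeStep V L.bits :=
  TimeStep.ofGates L.card_le (fun _ => 1) (fun q => b.reset (L.anc q) q) (L.reset_disjoint b)

theorem coupling_disjoint (t : ℕ) (q q' : L.Pairs t) (h : q ≠ q') :
    Disjoint (b.coupling q.1.1 q.1.2 (L.rel_ne q.2.1)).qubits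
      (b.coupling q'.1.1 q'.1.2 (L.rel_ne q'.2.1)).qubits := by
  have h1 := L.color_proper q.2.1 q'.2.1 (fun h' => h (Subtype.ext h')) (q.2.2.trans q'.2.2.symm)
  have h2 : q.1.1 ≠ q'.1.2 := fun h' => L.rel_data q.2.1 (h' ▸ L.rel_anc q'.2.1)
  have h3 : q.1.2 ≠ q'.1.1 := fun h' => L.rel_data q'.2.1 (h' ▸ L.rel_anc q.2.1)
  rw [Set.disjoint_left]
  cases b <;> rintro v (rfl | rfl) (h4 | h4) <;> simp_all

/-- The step that performs the couplings of color `t`. -/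
noncomputable def couplingStep (t : ℕ) : TimeStep V L.bits :=
  TimeStep.ofGates (L.card_pairs_le t) (fun _ => 1)
    (fun q : L.Pairs t => b.coupling q.1.1 q.1.2 (L.rel_ne q.2.1)) (L.coupling_disjoint b t)

theorem readout_disjoint (q q' : L.Anc) (h : q ≠ q') :
    Disjoint (b.readout q.1).qubits (b.readout q'.1).qubits := by
  have h1 : q.1 ≠ q'.1 := fun h' => h (Subtype.ext h')
  cases b <;> exact Set.disjoint_singleton.2 h1

/-- The step that measures all ancilla qubits. -/
noncomputable def readoutStep : TimeStep V L.bits :=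
  TimeStep.ofGates L.card_anc_le (fun _ => 1) (fun a : L.Anc => b.readout a.1) (L.readout_disjoint b)

/-- The syndrome stored in the classical register. -/
noncomputable def synd (y : Bits (Fin L.bits)) : Bits V := fun v =>
  if h : L.anc v then y (gateBit L.card_anc_le (⟨v, h⟩ : L.Anc)) else 0

/-- The computation of the correction. -/
noncomputable def decode (y : Bits (Fin L.bits)) : Bits (Fin L.bits) :=
  Function.extend (gateBit L.card_data_le) (fun d : L.Data => L.corr (L.synd y) d.1) 0

theorem correction_disjoint (q q' : L.Data) (h : q ≠ q') :
    Disjoint (b.correction q.1).qubits (b.correction q'.1).qubits := by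
  have h1 : q.1 ≠ q'.1 := fun h' => h (Subtype.ext h')
  cases b <;> exact Set.disjoint_singleton.2 h1

/-- The step that applies the correction. -/
noncomputable def correctionStep : TimeStep V L.bits :=
  TimeStep.ofGates L.card_data_le L.decode (fun d : L.Data => b.correction d.1) (L.correction_disjoint b)

/-- The step at time `t`. -/
noncomputable def stepAt (t : ℕ) : TimeStep V L.bits :=
  if t = 0 then L.resetStep b
  else if t ≤ L.numColors then L.couplingStep b (t - 1)
  else if t = L.numColors + 1 then L.readoutStep b
  else L.correctionStep b

/-- The state preparation circuit. -/
noncomputable def circuit : AdaptiveCircuit V where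
  M := L.bits
  space_le := L.card_le
  T := L.numColors + 3
  step t := L.stepAt b t.val

/-! ### The ideal states -/

/-- The states in which every ancilla qubit holds the parity of the data qubits that have been coupled
to it, the couplings being `K`. -/
noncomputable def parity (K : Set (V × V)) : Bits V → ℂ := fun x =>
  if ∀ a, L.anc a → x a = ∑ d, K.indicator (fun q => x q.1) (d, a) then 1 else 0

/-- All couplings. -/
def allPairs : Set (V × V) := {q | L.rel q.1 q.2}

/-- The state after the measurement of the ancilla qubits in `A` with outcomes `s + u`. -/
noncomputable def measured (A : Finset L.Anc) (s u : Bits V) : Bits V → ℂ := fun x =>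
  if ∀ a ∈ A, x a.1 = s a.1 + u a.1 then L.parity L.allPairs x else 0

/-- A new coupling adds the bit of `d` to the parity that `a` has to hold. The target is an ancilla
qubit, so the data bits entering the parities stay unchanged. -/
theorem cnotAct_parity {K : Set (V × V)} (hK : ∀ q ∈ K, ¬ L.anc q.1) {d a : V} (h : L.rel d a)
    (hda : (d, a) ∉ K) : cnotAct d a (L.parity K) = L.parity (insert (d, a) K) := by
  ext x
  simp only [cnotAct, parity]
  refine if_congr (forall₂_congr fun a' ha' => ?_) rfl rfl
  have h1 : ∀ d', K.indicator (fun q => Function.update x a (x a + x d) q.1) (d', a') =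
      K.indicator (fun q => x q.1) (d', a') := by
    intro d'
    by_cases hd' : (d', a') ∈ K
    · rw [Set.indicator_of_mem hd', Set.indicator_of_mem hd', Function.update_of_ne]
      rintro rfl
      exact hK _ hd' (L.rel_anc h)
    · rw [Set.indicator_of_notMem hd', Set.indicator_of_notMem hd']
  simp only [h1]
  by_cases haa : a' = a
  · subst haa
    have h2 : ∑ d', (insert (d, a') K).indicator (fun q => x q.1) (d', a') =
        (∑ d', K.indicator (fun q => x q.1) (d', a')) + x d := by
      have : ∀ d', (insert (d, a') K).indicator (fun q => x q.1) (d', a') =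
          K.indicator (fun q => x q.1) (d', a') + if d' = d then x d' else 0 := by
        intro d'
        by_cases hdd : d' = d
        · subst hdd
          simp [hda]
        · simp [hdd, Set.indicator_apply]
      simp only [this, Finset.sum_add_distrib, Finset.sum_ite_eq', Finset.mem_univ, if_true]
    rw [h2, Function.update_self]
    constructor
    · intro h3
      rw [← h3, add_assoc, ZModModule.add_self, add_zero]
    · intro h3
      rw [h3, add_assoc, ZModModule.add_self, add_zero]
  · rw [Function.update_of_ne haa]
    have : ∀ d', (insert (d, a) K).indicator (fun q => x q.1) (d', a') =
        K.indicator (fun q => x q.1) (d', a') := by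
      intro d'
      simp [haa, Set.indicator_apply]
    simp only [this]

theorem projAct_measured {A : Finset L.Anc} (a : L.Anc) (s u : Bits V) :
    projAct a.1 (s a.1 + u a.1) (L.measured A s u) = L.measured (insert a A) s u := by
  ext x
  simp only [projAct, measured, Finset.forall_mem_insert, ← ite_and]

/-! ### The errors -/

/-- The errors that faults on the qubits `W` can propagate to. -/
def ErrorFrom (W : Set V) (E : Bits V × Bits V) : Prop :=
  (∀ v, E.1 v ≠ 0 → v ∈ W ∨ ∃ a ∈ W, L.rel v a) ∧
    ∀ v, E.2 v ≠ 0 → v ∈ W ∨ ∃ d ∈ W, L.rel d v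

variable {L}

theorem ErrorFrom.zero (W : Set V) : L.ErrorFrom W 0 := by
  constructor <;> intro v hv <;> exact absurd rfl hv

theorem ErrorFrom.pauliBits_add {W : Set V} {E : Bits V × Bits V} (h : L.ErrorFrom W E)
    {P : V → Pauli} (hP : ∀ v, P v ≠ .I → v ∈ W) : L.ErrorFrom W (b.pauliBits P + E) := by
  have key : ∀ v, v ∉ W → (b.pauliBits P).1 v = 0 ∧ (b.pauliBits P).2 v = 0 := fun v hv =>
    b.pauliBits_eq_zero P (not_not.1 fun h => hv (hP v h))
  constructor
  · intro v hv
    by_cases hW : v ∈ W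
    · exact Or.inl hW
    · refine h.1 v fun h0 => hv ?_
      rw [Prod.fst_add, Pi.add_apply, (key v hW).1, h0, add_zero]
  · intro v hv
    by_cases hW : v ∈ W
    · exact Or.inl hW
    · refine h.2 v fun h0 => hv ?_
      rw [Prod.snd_add, Pi.add_apply, (key v hW).2, h0, add_zero]

/-- Propagation has depth one: a phase on the ancilla qubit `a` can only come from a fault on `a`,
since arriving there from another qubit would make `a` a data qubit. The same holds for shifts on
`d` with the roles exchanged. -/
theorem ErrorFrom.cnot {W : Set V} {E : Bits V × Bits V} (h : L.ErrorFrom W E) {d a : V}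
    (hda : L.rel d a) : L.ErrorFrom W (cnotError d a E) := by
  constructor
  · intro v hv
    by_cases hvd : v = d
    · subst hvd
      by_cases h1 : E.1 v = 0
      · have h2 : E.1 a ≠ 0 := fun h2 => hv (by simp [cnotError, h1, h2])
        rcases h.1 a h2 with h3 | ⟨a', -, h3⟩
        · exact Or.inr ⟨a, h3, hda⟩
        · exact absurd (L.rel_anc hda) (L.rel_data h3)
      · exact h.1 v h1
    · refine h.1 v ?_
      simpa only [cnotError, Function.update_of_ne hvd] using hv
  · intro v hv
    by_cases hva : v = a
    · subst hva
      by_cases h1 : E.2 v = 0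
      · have h2 : E.2 d ≠ 0 := fun h2 => hv (by simp [cnotError, h1, h2])
        rcases h.2 d h2 with h3 | ⟨d', -, h3⟩
        · exact Or.inr ⟨d, h3, hda⟩
        · exact absurd (L.rel_anc h3) (L.rel_data hda)
      · exact h.2 v h1
    · refine h.2 v ?_
      simpa only [cnotError, Function.update_of_ne hva] using hv

end PrepLayout

/-- Overwriting one bit by each of its two values reaches every bit string exactly twice. -/
theorem two_mul_sum_bits {V : Type*} [Fintype V] [DecidableEq V] (q : V) (f : Bits V → ℂ) :
    ∑ x, ∑ s, f (Function.update x q s) = 2 * ∑ x, f x := by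
  have h : ∀ x : Bits V, ∑ s, f (Function.update x q s) = f x + f (x + Pi.single q 1) := by
    intro x
    have h11 : (1 : ZMod 2) + 1 = 0 := by decide
    have hx : Function.update x q (x q) = x := Function.update_eq_self _ _
    rw [sum_zmod_two, ← update_add_self]
    rcases zmod_two_cases (x q) with h | h <;> rw [h] at hx ⊢
    · rw [zero_add, hx]
    · rw [h11, hx, add_comm]
  simp only [h, Finset.sum_add_distrib]
  rw [two_mul]
  congr 1
  exact Fintype.sum_equiv (Equiv.addRight _) _ _ fun _ => rfl

/-- The reduction of an operator to the reference system. -/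
noncomputable def refTrace {V R : Type*} [Fintype V] [DecidableEq V] (σ : Op V R) : Matrix R R ℂ :=
  Matrix.of fun p q => ∑ x, σ (x, p) (x, q)

/-! ### The effect of each time step on states with errors -/

namespace PrepLayout

open scoped Classical

variable {V : Type*} [Fintype V] [DecidableEq V] (L : PrepLayout V) (b : PrepBasis)
  {R : Type*} [Fintype R] [DecidableEq R]

/-- The amplitudes of the reset qubits. -/
noncomputable def resetVec : Bits V → ℂ := fun x => ∏ v, b.amplitude (L.anc v) (x v)

theorem parity_empty (x : Bits V) : L.parity ∅ x = ∏ v, if L.anc v → x v = 0 then 1 else 0 := by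
  simp [parity, Finset.prod_ite_zero]

/-- In either basis the frame shows the data qubits in `|+⟩` and the ancilla qubits in `|0⟩`. The
factor `2⁻¹` per data qubit undoes the unnormalized transform of a constant function of one bit. -/
theorem exists_resetVec_eq : ∃ c : ℂ, L.resetVec b = c • b.frame (L.parity ∅) := by
  cases b
  · refine ⟨∏ v, if L.anc v then 1 else ((Real.sqrt 2 : ℝ) : ℂ)⁻¹, ?_⟩
    ext x
    simp only [resetVec, PrepBasis.frame, Pi.smul_apply, parity_empty, smul_eq_mul,
      ← Finset.prod_mul_distrib]
    refine Finset.prod_congr rfl fun v _ => ?_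
    by_cases h : L.anc v <;> simp [PrepBasis.amplitude, h]
  · refine ⟨∏ v, if L.anc v then ((Real.sqrt 2 : ℝ) : ℂ)⁻¹ else 2⁻¹, ?_⟩
    ext x
    have h1 : hadamardTransform (L.parity ∅) x =
        ∏ v, ∑ s, sgn (x v * s) * if L.anc v → s = 0 then 1 else 0 := by
      rw [Finset.prod_univ_sum, Fintype.piFinset_univ]
      simp only [hadamardTransform, parity_empty, dotProduct, sgn_sum, ← Finset.prod_mul_distrib]
    simp only [resetVec, PrepBasis.frame, Pi.smul_apply, smul_eq_mul, h1, ← Finset.prod_mul_distrib]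
    refine Finset.prod_congr rfl fun v _ => ?_
    rcases zmod_two_cases (x v) with h' | h' <;>
      by_cases h : L.anc v <;> simp [PrepBasis.amplitude, h, h', sum_zmod_two]

/-- The resets prepare the product state, and trace out the qubits. -/
theorem resetStep_apply (σ : CQOp V L.bits R) : ∃ c : ℂ, ∀ y, (L.resetStep b).apply σ y =
    if y = 1 then c • twisted b 0 (L.parity ∅) 0 (L.parity ∅) (refTrace (∑ x, σ x)) else 0 := by
  set σ0 := ∑ x, σ x with hσ0
  -- After the resets of `A`, the operator is the product of the new amplitudes on `A` and a
  -- function `h` that ignores the bits in `A`. Each reset sums over one bit that `h` then ignores,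
  -- so the sum of `h` over the diagonal doubles. At the end `h` is constant and equals the
  -- reduction to the reference system. The register is all ones, so every reset fires.
  have hmain := TimeStep.ofGates_apply_induction (R := R) L.card_le (fun _ => 1)
    (fun q => b.reset (L.anc q) q) (L.reset_disjoint b) σ
    (fun A τ => ∃ h : Bits V → Bits V → R → R → ℂ,
      (∀ y x x' p q, τ y (x, p) (x', q) = if y = 1 then
        (∏ v ∈ A, b.amplitude (L.anc v) (x v) * b.amplitude (L.anc v) (x' v)) * h x x' p q else 0) ∧
      (∀ x z x' z', (∀ v ∉ A, x v = z v) → (∀ v ∉ A, x' v = z' v) → h x x' = h z z') ∧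
      ∀ p q, ∑ x, h x x p q = 2 ^ A.card * ∑ x, σ0 (x, p) (x, q)) ?_ ?_
  · obtain ⟨h, h1, h2, h3⟩ := hmain
    obtain ⟨c, hc⟩ := L.exists_resetVec_eq b
    refine ⟨c * c, fun y => ?_⟩
    have h4 : ∀ x x', h x x' = h 0 0 := fun x x' =>
      h2 x 0 x' 0 (fun v hv => absurd (Finset.mem_univ v) hv)
        (fun v hv => absurd (Finset.mem_univ v) hv)
    have h5 : ∀ p q, h 0 0 p q = ∑ x, σ0 (x, p) (x, q) := by
      intro p q
      have h6 := h3 p q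
      simp only [h4, Finset.sum_const, nsmul_eq_mul, Finset.card_univ, Fintype.card_fun,
        ZMod.card] at h6
      push_cast at h6
      exact mul_left_cancel₀ (pow_ne_zero _ two_ne_zero) h6
    have h6 : (c * c) • twisted b 0 (L.parity ∅) 0 (L.parity ∅) (refTrace σ0) =
        prodOp (L.resetVec b) (L.resetVec b) (refTrace σ0) := by
      have h7 : pauliAct 0 (L.parity ∅) = L.parity ∅ := by
        ext x
        simp [pauliAct, phase, shift]
      rw [twisted, h7, hc, prodOp_smul_left, prodOp_smul_right, mul_smul]
    rw [h6]
    change TimeStep.apply (TimeStep.ofGates _ _ _ _) σ y = _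
    ext ⟨x, p⟩ ⟨x', q⟩
    rw [h1]
    split_ifs
    · rw [h4, h5]
      simp only [prodOp, Matrix.kroneckerMap_apply, Matrix.vecMulVec_apply, refTrace,
        Matrix.of_apply, resetVec, Finset.prod_mul_distrib]
    · rfl
  · refine ⟨fun x x' p q => σ0 (x, p) (x', q), ?_, ?_, ?_⟩
    · intro y x x' p q
      by_cases hy : y = 1
      · subst hy
        simp [hσ0]
      · simp [Ne.symm hy, hy]
    · intro x z x' z' hx hx'
      rw [show x = z from funext fun v => hx v (Finset.notMem_empty v),
        show x' = z' from funext fun v => hx' v (Finset.notMem_empty v)]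
    · simp
  · rintro A v τ hv ⟨h, h1, h2, h3⟩
    refine ⟨fun x x' p q => ∑ s, h (Function.update x v s) (Function.update x' v s) p q, ?_, ?_, ?_⟩
    · intro y x x' p q
      rw [b.apply_reset]
      by_cases hy : y = 1
      · subst hy
        have hprod : ∀ s, (∏ u ∈ A, b.amplitude (L.anc u) (Function.update x v s u) *
            b.amplitude (L.anc u) (Function.update x' v s u)) =
            ∏ u ∈ A, b.amplitude (L.anc u) (x u) * b.amplitude (L.anc u) (x' u) := by
          intro s
          refine Finset.prod_congr rfl fun u hu => ?_
          have huv : u ≠ v := fun h => hv (h ▸ hu)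
          rw [Function.update_of_ne huv, Function.update_of_ne huv]
        simp only [Pi.one_apply, if_true, b.channel_reset_apply, h1, hprod,
          Finset.prod_insert hv, ← Finset.mul_sum]
        ring
      · have h0 : τ y = 0 := by
          ext ⟨x, p⟩ ⟨x', q⟩
          rw [h1, if_neg hy]
          rfl
        simp only [h0, if_neg hy]
        split_ifs
        · rw [b.channel_reset_apply]
          simp
        · rfl
    · intro x z x' z' hx hx'
      have key : ∀ s, h (Function.update x v s) (Function.update x' v s) =
          h (Function.update z v s) (Function.update z' v s) := by
        intro s
        have key' : ∀ x z : Bits V, (∀ u ∉ insert v A, x u = z u) → ∀ u ∉ A,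
            Function.update x v s u = Function.update z v s u := by
          intro x z hx u hu
          by_cases huv : u = v
          · subst huv; simp
          · rw [Function.update_of_ne huv, Function.update_of_ne huv]
            exact hx u fun h => (Finset.mem_insert.1 h).elim huv hu
        exact h2 _ _ _ _ (key' x z hx) (key' x' z' hx')
      funext p q
      simp only [key]
    · intro p q
      rw [two_mul_sum_bits v (fun x => h x x p q), h3, Finset.card_insert_of_notMem hv]
      ring

/-- The couplings of one color. -/
theorem couplingStep_apply {W : Set V} {E E' : Bits V × Bits V} (hE : L.ErrorFrom W E)
    (hE' : L.ErrorFrom W E') (t : ℕ) {ρ : Matrix R R ℂ} {σ : CQOp V L.bits R}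
    (hσ : ∃ c : ℂ, ∀ y, σ y = if y = 1 then
      c • twisted b E (L.parity {q | L.rel q.1 q.2 ∧ L.color q < t})
        E' (L.parity {q | L.rel q.1 q.2 ∧ L.color q < t}) ρ else 0) :
    ∃ E E', L.ErrorFrom W E ∧ L.ErrorFrom W E' ∧ ∃ c : ℂ, ∀ y,
      (L.couplingStep b t).apply σ y = if y = 1 then
        c • twisted b E (L.parity {q | L.rel q.1 q.2 ∧ L.color q < t + 1})
          E' (L.parity {q | L.rel q.1 q.2 ∧ L.color q < t + 1}) ρ else 0 := by
  set K : Finset (L.Pairs t) → Set (V × V) := fun A =>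
    {q | L.rel q.1 q.2 ∧ L.color q < t} ∪ {q | ∃ γ ∈ A, γ.1 = q} with hK
  have hmain := TimeStep.ofGates_apply_induction (R := R) (L.card_pairs_le t) (fun _ => 1)
    (fun q : L.Pairs t => b.coupling q.1.1 q.1.2 (L.rel_ne q.2.1)) (L.coupling_disjoint b t) σ
    (fun A τ => ∃ E E', L.ErrorFrom W E ∧ L.ErrorFrom W E' ∧ ∃ c : ℂ, ∀ y,
      τ y = if y = 1 then c • twisted b E (L.parity (K A)) E' (L.parity (K A)) ρ else 0) ?_ ?_
  · have h1 : K Finset.univ = {q | L.rel q.1 q.2 ∧ L.color q < t + 1} := by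
      ext q
      simp only [hK, Set.mem_union, Set.mem_ofPred_eq, Finset.mem_univ, true_and]
      constructor
      · rintro (⟨h1, h2⟩ | ⟨γ, rfl⟩)
        · exact ⟨h1, by omega⟩
        · exact ⟨γ.2.1, by have := γ.2.2; omega⟩
      · rintro ⟨h1, h2⟩
        by_cases h3 : L.color q = t
        · exact Or.inr ⟨⟨q, h1, h3⟩, rfl⟩
        · exact Or.inl ⟨h1, by omega⟩
    rw [h1] at hmain
    exact hmain
  · obtain ⟨c, hc⟩ := hσ
    have h1 : K ∅ = {q | L.rel q.1 q.2 ∧ L.color q < t} := by simp [hK]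
    refine ⟨E, E', hE, hE', c, fun y => ?_⟩
    rw [h1]
    by_cases hy : y = 1
    · subst hy
      simp only [if_true, hc]
      rw [Finset.sum_ite_eq']
      simp
    · simp [Ne.symm hy, hy]
  · rintro A γ τ hγ ⟨E, E', hE, hE', c, hc⟩
    have h1 : K (insert γ A) = insert (γ.1.1, γ.1.2) (K A) := by
      ext q
      simp only [hK, Set.mem_union, Set.mem_ofPred_eq, Finset.mem_insert, exists_eq_or_imp,
        Set.mem_insert_iff, Prod.mk.eta, eq_comm (a := q)]
      tauto
    have h2 : (γ.1.1, γ.1.2) ∉ K A := by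
      rintro (⟨-, h⟩ | ⟨γ', hγ', h⟩)
      · have := γ.2.2
        simp only [Prod.mk.eta] at h
        omega
      · exact hγ (Subtype.ext h ▸ hγ')
    have h3 : ∀ q ∈ K A, ¬ L.anc q.1 := by
      rintro q (⟨h, -⟩ | ⟨γ', -, rfl⟩)
      · exact L.rel_data h
      · exact L.rel_data γ'.2.1
    refine ⟨cnotError γ.1.1 γ.1.2 E, cnotError γ.1.1 γ.1.2 E', hE.cnot γ.2.1, hE'.cnot γ.2.1, c,
      fun y => ?_⟩
    rw [b.apply_coupling]
    by_cases hy : y = 1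
    · subst hy
      simp only [Pi.one_apply, if_true, hc]
      rw [sandwich_smul, sandwich_coupling_twisted b (L.rel_ne γ.2.1), L.cnotAct_parity h3 γ.2.1 h2,
        h1]
    · simp only [hc, if_neg hy, sandwich_zero, ite_self]

/-- The measurement of the ancilla qubits. -/
theorem readoutStep_apply (E E' : Bits V × Bits V) {ρ : Matrix R R ℂ} {σ : CQOp V L.bits R}
    (hσ : ∃ c : ℂ, ∀ y, σ y = if y = 1 then
      c • twisted b E (L.parity L.allPairs) E' (L.parity L.allPairs) ρ else 0) :
    ∃ c : Bits (Fin L.bits) → ℂ, ∀ y, (L.readoutStep b).apply σ y =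
      c y • twisted b E (L.measured Finset.univ (L.synd y) E.2)
        E' (L.measured Finset.univ (L.synd y) E'.2) ρ := by
  refine TimeStep.ofGates_apply_induction (R := R) L.card_anc_le (fun _ => 1)
    (fun a : L.Anc => b.readout a.1) (L.readout_disjoint b) σ
    (fun A τ => ∃ c : Bits (Fin L.bits) → ℂ, ∀ y, τ y =
      c y • twisted b E (L.measured A (L.synd y) E.2) E' (L.measured A (L.synd y) E'.2) ρ) ?_ ?_
  · obtain ⟨c, hc⟩ := hσ
    refine ⟨fun y => if y = 1 then c else 0, fun y => ?_⟩
    have h1 : ∀ s u, L.measured ∅ s u = L.parity L.allPairs := by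
      intro s u
      ext x
      simp [measured]
    rw [h1, h1]
    by_cases hy : y = 1
    · subst hy
      simp only [if_true, hc]
      rw [Finset.sum_ite_eq']
      simp
    · simp [Ne.symm hy, hy]
  · rintro A a τ ha ⟨c, hc⟩
    set i := gateBit L.card_anc_le a with hi
    refine ⟨fun y => ∑ x, if Function.update x i (y i) = y then c x else 0, fun y => ?_⟩
    have hya : y i = L.synd y a.1 := by
      simp [synd, a.2, hi]
    rw [b.apply_readout, Finset.sum_smul]
    refine Finset.sum_congr rfl fun x _ => ?_
    split_ifs with hx
    -- The registers `x` summed over differ from `y` only in the bit of `a`, which does not belong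
    -- to `A`, so earlier outcomes agree and the sum stays proportional to one operator.
    · have h1 : ∀ u, L.measured A (L.synd x) u = L.measured A (L.synd y) u := by
        intro u
        ext z
        refine if_congr (forall₂_congr fun a' ha' => ?_) rfl rfl
        have h2 : L.synd x a'.1 = L.synd y a'.1 := by
          have h3 : gateBit L.card_anc_le a' ≠ i := fun h3 =>
            ha (gateBit_injective L.card_anc_le h3 ▸ ha')
          have h4 := congrFun hx (gateBit L.card_anc_le a')
          rw [Function.update_of_ne h3] at h4
          simpa [synd, a'.2] using h4
        rw [h2]
      rw [hc, sandwich_smul, sandwich_readout_twisted, h1, h1, hya, L.projAct_measured,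
        L.projAct_measured]
    · rw [zero_smul]

/-- The correction of the data qubits in `A`. -/
noncomputable def corrected (A : Finset L.Data) (y : Bits (Fin L.bits)) : Bits V := fun v =>
  if h : ¬ L.anc v then if (⟨v, h⟩ : L.Data) ∈ A then y (gateBit L.card_data_le (⟨v, h⟩ : L.Data))
    else 0 else 0

theorem corrected_insert {A : Finset L.Data} {d : L.Data} (hd : d ∉ A) (y : Bits (Fin L.bits)) :
    L.corrected (insert d A) y =
      Pi.single d.1 (y (gateBit L.card_data_le d)) + L.corrected A y := by
  ext v
  by_cases hv : v = d.1
  · subst hv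
    simp [corrected, d.2, hd]
  · have h1 : ∀ h : ¬ L.anc v, (⟨v, h⟩ : L.Data) ≠ d := fun h h' => hv (congrArg Subtype.val h')
    simp [corrected, hv, h1]

theorem corrected_decode (y : Bits (Fin L.bits)) :
    L.corrected Finset.univ (L.decode y) = L.corr (L.synd y) := by
  ext v
  by_cases hv : L.anc v
  · simp [corrected, hv, L.corr_anc]
  · simp only [corrected, hv, not_false_eq_true, dite_true, Finset.mem_univ, if_true, decode]
    rw [(gateBit_injective L.card_data_le).extend_apply]

/-- The Pauli correction. -/
theorem correctionStep_apply (E E' : Bits V × Bits V) (f f' : Bits V → Bits V → ℂ)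
    {ρ : Matrix R R ℂ} {σ : CQOp V L.bits R}
    (hσ : ∃ c : Bits (Fin L.bits) → ℂ, ∀ y, σ y =
      c y • twisted b E (f (L.synd y)) E' (f' (L.synd y)) ρ) :
    ∀ y, ∃ c : Bits (Fin L.bits) → ℂ, (L.correctionStep b).apply σ y = ∑ x,
      c x • twisted b E (shift (L.corr (L.synd x)) (f (L.synd x)))
        E' (shift (L.corr (L.synd x)) (f' (L.synd x))) ρ := by
  have hmain := TimeStep.ofGates_apply_induction (R := R) L.card_data_le L.decode
    (fun d : L.Data => b.correction d.1) (L.correction_disjoint b) σ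
    (fun A τ => ∀ y, ∃ c : Bits (Fin L.bits) → ℂ, τ y = ∑ x, if L.decode x = y then
      c x • twisted b E (shift (L.corrected A y) (f (L.synd x)))
        E' (shift (L.corrected A y) (f' (L.synd x))) ρ else 0) ?_ ?_
  · intro y
    obtain ⟨c, hc⟩ := hmain y
    refine ⟨fun x => if L.decode x = y then c x else 0, hc.trans ?_⟩
    refine Finset.sum_congr rfl fun x _ => ?_
    dsimp only
    split_ifs with hx
    · rw [← hx, L.corrected_decode]
    · rw [zero_smul]
  · intro y
    obtain ⟨c, hc⟩ := hσ
    have h1 : L.corrected ∅ y = 0 := by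
      ext v
      simp [corrected]
    have h2 : ∀ g : Bits V → ℂ, shift 0 g = g := fun g => by
      ext x
      simp [shift]
    refine ⟨c, ?_⟩
    simp only [h1, h2, hc]
  · rintro A d τ hd hτ y
    obtain ⟨c, hc⟩ := hτ y
    rw [b.apply_correction, L.corrected_insert hd]
    rcases zmod_two_cases (y (gateBit L.card_data_le d)) with h | h
    · refine ⟨c, ?_⟩
      simp only [h, hc, Pi.single_zero, zero_add]
      rw [if_neg (by decide)]
    · refine ⟨fun x => c x * (sgn (E.1 d.1) * sgn (E'.1 d.1)), ?_⟩
      simp only [h, if_true, hc, sandwich_sum]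
      refine Finset.sum_congr rfl fun x _ => ?_
      split_ifs
      · rw [sandwich_smul, sandwich_correction_twisted, shift_shift, shift_shift, mul_smul, mul_smul,
          mul_smul]
      · exact sandwich_zero _ _

end PrepLayout

/-! ### The output of the whole faulty circuit -/

namespace PrepLayout

open scoped Classical

variable {V : Type*} [Fintype V] [DecidableEq V] (L : PrepLayout V) (b : PrepBasis)
  {R : Type*} [Fintype R] [DecidableEq R]

/-- The term of the output state that belongs to the syndrome `s`. -/
noncomputable def outputTerm (E : Bits V × Bits V) (u : Bits V) (E' : Bits V × Bits V) (u' : Bits V)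
    (ρ : Matrix R R ℂ) (s : Bits V) : Op V R :=
  twisted b E (shift (L.corr s) (L.measured Finset.univ s u))
    E' (shift (L.corr s) (L.measured Finset.univ s u')) ρ

/-- The shifts that faults on the qubits `W` can propagate to. -/
def ShiftFrom (W : Set V) (u : Bits V) : Prop := ∀ v, u v ≠ 0 → v ∈ W ∨ ∃ d ∈ W, L.rel d v

/-- The invariant has one clause for each phase. After `n` steps of the coupling phase the colors
below `n - 1` are done, the first step being the reset. The same exponents must serve all values of
the register, while the scalars may depend on it; this is why membership in a span is claimed. -/
theorem exists_foldl_mem_span {W : Set V} (F : Fin (L.numColors + 3) → PauliSuperop V)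
    (hW : ∀ t, (F t).support ⊆ W) (σ : CQOp V L.bits R) :
    ∃ E u E' u', L.ErrorFrom W E ∧ L.ShiftFrom W u ∧ L.ErrorFrom W E' ∧ L.ShiftFrom W u' ∧
      ∀ y, (List.finRange (L.numColors + 3)).foldl (fun (τ : CQOp V L.bits R) t x =>
          (F t).apply ((L.stepAt b t.val).apply τ x)) σ y ∈
        Submodule.span ℂ (Set.range (L.outputTerm b E u E' u' (refTrace (∑ x, σ x)))) := by
  set ρ : Matrix R R ℂ := refTrace (∑ x, σ x) with hρ
  have hl : ∀ t v, (F t).left v ≠ .I → v ∈ W := fun t v hv => hW t (Or.inl hv)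
  have hr : ∀ t v, (F t).right v ≠ .I → v ∈ W := fun t v hv => hW t (Or.inr hv)
  -- faults preserve the form of the states
  have hfault1 : ∀ t (E E' : Bits V × Bits V) (f f' : Bits V → ℂ) (τ : CQOp V L.bits R),
      L.ErrorFrom W E → L.ErrorFrom W E' →
      (∃ c : ℂ, ∀ y, τ y = if y = 1 then c • twisted b E f E' f' ρ else 0) →
      ∃ E E', L.ErrorFrom W E ∧ L.ErrorFrom W E' ∧
        ∃ c : ℂ, ∀ y, (F t).apply (τ y) = if y = 1 then c • twisted b E f E' f' ρ else 0 := by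
    rintro t E E' f f' τ hE hE' ⟨c, hc⟩
    obtain ⟨c', hc'⟩ := (F t).apply_twisted b E E' (R := R)
    refine ⟨_, _, hE.pauliBits_add b (hl t), hE'.pauliBits_add b (hr t), c * c', fun y => ?_⟩
    rw [hc]
    split_ifs
    · rw [PauliSuperop.apply, sandwich_smul, ← PauliSuperop.apply, hc', mul_smul]
    · exact sandwich_zero _ _
  have hmain := foldl_finRange_induction (n := L.numColors + 3)
    (fun (τ : CQOp V L.bits R) t x => (F t).apply ((L.stepAt b t.val).apply τ x))
    (fun n τ => (n = 0 → τ = σ) ∧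
      (1 ≤ n → n ≤ L.numColors + 1 → ∃ E E', L.ErrorFrom W E ∧ L.ErrorFrom W E' ∧ ∃ c : ℂ, ∀ y,
        τ y = if y = 1 then
          c • twisted b E (L.parity {q | L.rel q.1 q.2 ∧ L.color q < n - 1})
            E' (L.parity {q | L.rel q.1 q.2 ∧ L.color q < n - 1}) ρ else 0) ∧
      (n = L.numColors + 2 → ∃ E u E' u', L.ErrorFrom W E ∧ L.ShiftFrom W u ∧ L.ErrorFrom W E' ∧
        L.ShiftFrom W u' ∧ ∃ c : Bits (Fin L.bits) → ℂ, ∀ y, τ y =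
          c y • twisted b E (L.measured Finset.univ (L.synd y) u)
            E' (L.measured Finset.univ (L.synd y) u') ρ) ∧
      (n = L.numColors + 3 → ∃ E u E' u', L.ErrorFrom W E ∧ L.ShiftFrom W u ∧ L.ErrorFrom W E' ∧
        L.ShiftFrom W u' ∧ ∀ y, τ y ∈ Submodule.span ℂ (Set.range (L.outputTerm b E u E' u' ρ))))
    (x := σ) ⟨fun _ => rfl, by omega, by omega, by omega⟩ ?_
  · exact hmain.2.2.2 rfl
  · rintro ⟨t, ht⟩ τ ⟨h0, h1, h2, -⟩
    dsimp only at h0 h1 h2 ⊢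
    refine ⟨by omega, fun _ hn => ?_, fun hn => ?_, fun hn => ?_⟩
    · by_cases ht0 : t = 0
      · subst ht0
        obtain rfl := h0 rfl
        obtain ⟨c, hc⟩ := L.resetStep_apply b τ
        have hempty : ({q | L.rel q.1 q.2 ∧ L.color q < 0} : Set (V × V)) = ∅ := by simp
        rw [stepAt, if_pos rfl, zero_add, Nat.sub_self, hempty]
        exact hfault1 _ 0 0 _ _ _ (ErrorFrom.zero W) (ErrorFrom.zero W) ⟨c, hc⟩
      · obtain ⟨E, E', hE, hE', hτ⟩ := h1 (by omega) (by omega)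
        obtain ⟨E2, E2', hE2, hE2', hτ2⟩ := L.couplingStep_apply b hE hE' (t - 1) hτ
        rw [stepAt, if_neg ht0, if_pos (by omega)]
        rw [show t - 1 + 1 = t + 1 - 1 by omega] at hτ2
        exact hfault1 _ E2 E2' _ _ _ hE2 hE2' hτ2
    · obtain ⟨E, E', hE, hE', hτ⟩ := h1 (by omega) (by omega)
      have hall : ({q | L.rel q.1 q.2 ∧ L.color q < t - 1} : Set (V × V)) = L.allPairs := by
        ext q
        refine ⟨fun h => h.1, fun h => ⟨h, ?_⟩⟩
        have := L.color_lt h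
        rw [show t - 1 = L.numColors by omega]
        exact this
      rw [hall] at hτ
      obtain ⟨c, hc⟩ := L.readoutStep_apply b E E' hτ
      obtain ⟨c', hc'⟩ := (F ⟨t, ht⟩).apply_twisted b E E' (R := R)
      -- The error in the syndrome is the shift exponent before the fault that follows the
      -- measurement. From here on that fault and later ones change `E` but no longer `u`.
      refine ⟨_, E.2, _, E'.2, hE.pauliBits_add b (hl ⟨t, ht⟩), hE.2,
        hE'.pauliBits_add b (hr ⟨t, ht⟩), hE'.2, fun y => c y * c', fun y => ?_⟩
      rw [stepAt, if_neg (by omega), if_neg (by omega), if_pos (by omega), hc, PauliSuperop.apply,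
        sandwich_smul, ← PauliSuperop.apply, hc', mul_smul]
    · obtain ⟨E, u, E', u', hE, hu, hE', hu', hτ⟩ := h2 (by omega)
      have hcorr := L.correctionStep_apply b E E' (fun s => L.measured Finset.univ s u)
        (fun s => L.measured Finset.univ s u') hτ
      obtain ⟨c', hc'⟩ := (F ⟨t, ht⟩).apply_twisted b E E' (R := R)
      refine ⟨_, u, _, u', hE.pauliBits_add b (hl ⟨t, ht⟩), hu,
        hE'.pauliBits_add b (hr ⟨t, ht⟩), hu', fun y => ?_⟩
      obtain ⟨c, hc⟩ := hcorr y
      rw [stepAt, if_neg (by omega), if_neg (by omega), if_neg (by omega), hc, PauliSuperop.apply,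
        sandwich_sum]
      refine Submodule.sum_mem _ fun x _ => ?_
      rw [sandwich_smul, ← PauliSuperop.apply, hc']
      exact Submodule.smul_mem _ _ (Submodule.smul_mem _ _ (Submodule.subset_span ⟨L.synd x, rfl⟩))

/-- The output of the faulty circuit is a combination of the ideal output states for the various syndromes,
all deviated by the same Pauli operators and the same syndrome errors. -/
theorem exists_run_mem_span {W : Set V} (F : Fin (L.circuit b).T → PauliSuperop V)
    (hW : ∀ t, (F t).support ⊆ W) (σ : CQOp V (L.circuit b).M R) :
    ∃ E u E' u', L.ErrorFrom W E ∧ L.ShiftFrom W u ∧ L.ErrorFrom W E' ∧ L.ShiftFrom W u' ∧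
      ∀ y, (L.circuit b).run F σ y ∈
        Submodule.span ℂ (Set.range (L.outputTerm b E u E' u' (refTrace (∑ x, σ x)))) :=
  L.exists_foldl_mem_span b F hW σ

end PrepLayout

/-! ### Edge coloring -/

/-- Greedy coloring of a finite symmetric relation. -/
theorem exists_greedy_coloring {Q : Type*} [Fintype Q] [DecidableEq Q] (r : Q → Q → Prop)
    [DecidableRel r] (hr : ∀ q q', r q q' → r q' q) (n : ℕ)
    (hn : ∀ q, (Finset.univ.filter fun q' => r q q').card < n) :
    ∃ col : Q → ℕ, (∀ q, col q < n) ∧ ∀ q q', q ≠ q' → r q q' → col q ≠ col q' := by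
  have key : ∀ s : Finset Q, ∃ col : Q → ℕ, (∀ q, col q < n) ∧
      ∀ q ∈ s, ∀ q' ∈ s, q ≠ q' → r q q' → col q ≠ col q' := by
    intro s
    induction s using Finset.induction_on with
    | empty => exact ⟨fun _ => 0, fun q => (Nat.zero_le _).trans_lt (hn q), by simp⟩
    | insert q s hq ih =>
      obtain ⟨col, hlt, hcol⟩ := ih
      -- Fewer than `n` elements are related to `q`, so their colors do not exhaust the `n`
      -- available ones.
      obtain ⟨k, hk, hk'⟩ : ∃ k ∈ Finset.range n,
          k ∉ (Finset.univ.filter fun q' => r q q').image col := by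
        refine Finset.exists_mem_notMem_of_card_lt_card ?_
        rw [Finset.card_range]
        exact Finset.card_image_le.trans_lt (hn q)
      have hk'' : ∀ q', r q q' → k ≠ col q' := fun q' hq' h =>
        hk' (Finset.mem_image.2 ⟨q', by simpa using hq', h.symm⟩)
      refine ⟨Function.update col q k, ?_, ?_⟩
      · intro q'
        by_cases h : q' = q
        · subst h
          simpa using hk
        · rw [Function.update_of_ne h]
          exact hlt q'
      · intro q1 h1 q2 h2 hne hr12
        by_cases h1q : q1 = q
        · subst h1q
          rw [Function.update_self, Function.update_of_ne hne.symm]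
          exact hk'' _ hr12
        · by_cases h2q : q2 = q
          · subst h2q
            rw [Function.update_self, Function.update_of_ne hne]
            exact (hk'' _ (hr _ _ hr12)).symm
          · rw [Function.update_of_ne h1q, Function.update_of_ne h2q]
            exact hcol q1 ((Finset.mem_insert.1 h1).resolve_left h1q) q2
              ((Finset.mem_insert.1 h2).resolve_left h2q) hne hr12
  obtain ⟨col, h1, h2⟩ := key Finset.univ
  exact ⟨col, h1, fun q q' => h2 q (Finset.mem_univ _) q' (Finset.mem_univ _)⟩

/-- Edge coloring of a relation with bounded degrees. -/
theorem exists_edge_coloring {V : Type*} [Fintype V] (rel : V → V → Prop) (w : ℕ)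
    (h1 : ∀ d, {a | rel d a}.ncard ≤ w) (h2 : ∀ a, {d | rel d a}.ncard ≤ w) :
    ∃ col : V × V → ℕ, (∀ q : V × V, rel q.1 q.2 → col q < 2 * w + 1) ∧
      ∀ q q' : V × V, rel q.1 q.2 → rel q'.1 q'.2 → q ≠ q' → col q = col q' →
        q.1 ≠ q'.1 ∧ q.2 ≠ q'.2 := by
  classical
  obtain ⟨col, hlt, hcol⟩ := exists_greedy_coloring (Q := {q : V × V // rel q.1 q.2})
    (fun q q' => q.1.1 = q'.1.1 ∨ q.1.2 = q'.1.2) (fun q q' h => h.imp Eq.symm Eq.symm) (2 * w + 1) (by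
      intro q
      -- At most `w` pairs share the first entry with `q` and at most `w` share the second, `q`
      -- itself being counted in both; one further color suffices.
      rw [Nat.lt_succ_iff, Finset.filter_or, two_mul]
      refine (Finset.card_union_le _ _).trans (add_le_add ?_ ?_)
      · refine le_trans ?_ (h1 q.1.1)
        rw [← Set.ncard_coe_finset, ← Set.InjOn.ncard_image (f := fun q' => q'.1.2)]
        · refine Set.ncard_le_ncard ?_ (Set.toFinite _)
          rintro _ ⟨q', hq', rfl⟩
          have hq' : q.1.1 = q'.1.1 := by simpa using hq'
          show rel q.1.1 q'.1.2
          rw [hq']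
          exact q'.2
        · intro q' hq' q'' hq'' h
          have hq' : q.1.1 = q'.1.1 := by simpa using hq'
          have hq'' : q.1.1 = q''.1.1 := by simpa using hq''
          exact Subtype.ext (Prod.ext (hq'.symm.trans hq'') h)
      · refine le_trans ?_ (h2 q.1.2)
        rw [← Set.ncard_coe_finset, ← Set.InjOn.ncard_image (f := fun q' => q'.1.1)]
        · refine Set.ncard_le_ncard ?_ (Set.toFinite _)
          rintro _ ⟨q', hq', rfl⟩
          have hq' : q.1.2 = q'.1.2 := by simpa using hq'
          show rel q'.1.1 q.1.2
          rw [hq']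
          exact q'.2
        · intro q' hq' q'' hq'' h
          have hq' : q.1.2 = q'.1.2 := by simpa using hq'
          have hq'' : q.1.2 = q''.1.2 := by simpa using hq''
          exact Subtype.ext (Prod.ext h (hq'.symm.trans hq'')))
  refine ⟨fun q => if h : rel q.1 q.2 then col ⟨q, h⟩ else 0, ?_, ?_⟩
  · intro q hq
    simp only [hq, dite_true]
    exact hlt _
  · intro q q' hq hq' hne h
    simp only [hq, hq', dite_true] at h
    by_contra hcon
    exact hcol ⟨q, hq⟩ ⟨q', hq'⟩ (fun h => hne (congrArg Subtype.val h)) (by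
      by_contra! h'
      exact hcon h') h

/-! ### The gates found in each time step -/

namespace PrepLayout

variable {V : Type*} [Fintype V] [DecidableEq V] (L : PrepLayout V) (b : PrepBasis)

theorem stepAt_zero : L.stepAt b 0 = L.resetStep b := if_pos rfl

theorem stepAt_coupling {t : ℕ} (h0 : 0 < t) (h : t ≤ L.numColors) :
    L.stepAt b t = L.couplingStep b (t - 1) := by
  rw [stepAt, if_neg h0.ne', if_pos h]

theorem stepAt_readout {t : ℕ} (h : t = L.numColors + 1) : L.stepAt b t = L.readoutStep b := by
  rw [stepAt, if_neg (by omega), if_neg (by omega), if_pos h]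

theorem stepAt_correction {t : ℕ} (h : L.numColors + 1 < t) : L.stepAt b t = L.correctionStep b := by
  rw [stepAt, if_neg (by omega), if_neg (by omega), if_neg (by omega)]

/-- Here and below the step is a variable `st` with an equation, because the type of the gate index
depends on the step and cannot be rewritten in place. -/
theorem classical_bit_eq_one {st : TimeStep V L.bits}
    (h : st = L.resetStep b ∨ ∃ t, st = L.couplingStep b t) (x : Bits (Fin L.bits))
    (g : Fin st.numGates) : st.classical x (st.bit g) = 1 := by
  obtain rfl | ⟨t, rfl⟩ := h <;> rfl

open scoped Classical

theorem exists_gate_resetStep {st : TimeStep V L.bits} (h : st = L.resetStep b) (q : V) :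
    ∃ g, st.gate g = b.reset (L.anc q) q := by
  subst h
  exact ⟨Fintype.equivFin _ q, congrArg (fun q => b.reset (L.anc q) q) (Equiv.symm_apply_apply _ _)⟩

theorem gate_resetStep {st : TimeStep V L.bits} (h : st = L.resetStep b) (g : Fin st.numGates) :
    ∃ q, st.gate g = b.reset (L.anc q) q := by
  subst h
  exact ⟨_, rfl⟩

theorem gate_couplingStep {t : ℕ} {st : TimeStep V L.bits} (h : st = L.couplingStep b t)
    (g : Fin st.numGates) : ∃ q : L.Pairs t, st.gate g = b.coupling q.1.1 q.1.2 (L.rel_ne q.2.1) := by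
  subst h
  exact ⟨_, rfl⟩

theorem exists_gate_couplingStep {t : ℕ} {st : TimeStep V L.bits} (h : st = L.couplingStep b t)
    (q : L.Pairs t) : ∃ g, st.gate g = b.coupling q.1.1 q.1.2 (L.rel_ne q.2.1) := by
  subst h
  exact ⟨Fintype.equivFin _ q, congrArg (fun q : L.Pairs t =>
    b.coupling q.1.1 q.1.2 (L.rel_ne q.2.1)) (Equiv.symm_apply_apply _ _)⟩

theorem gate_readoutStep {st : TimeStep V L.bits} (h : st = L.readoutStep b) (g : Fin st.numGates) :
    ∃ a : L.Anc, st.gate g = b.readout a.1 := by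
  subst h
  exact ⟨_, rfl⟩

theorem exists_gate_readoutStep {st : TimeStep V L.bits} (h : st = L.readoutStep b) (a : L.Anc) :
    ∃ g, st.gate g = b.readout a.1 ∧ ∀ y, y (st.bit g) = L.synd y a.1 := by
  subst h
  refine ⟨Fintype.equivFin _ a, congrArg (fun a : L.Anc => b.readout a.1)
    (Equiv.symm_apply_apply _ _), fun y => ?_⟩
  rw [synd, dif_pos a.2]
  rfl

theorem gate_correctionStep {st : TimeStep V L.bits} (h : st = L.correctionStep b)
    (g : Fin st.numGates) : ∃ d : L.Data, st.gate g = b.correction d.1 := by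
  subst h
  exact ⟨_, rfl⟩

theorem exists_gate_correctionStep {st : TimeStep V L.bits} (h : st = L.correctionStep b)
    (d : L.Data) : ∃ g, st.gate g = b.correction d.1 ∧
      ∀ y, st.classical y (st.bit g) = L.corr (L.synd y) d.1 := by
  subst h
  refine ⟨Fintype.equivFin _ d, congrArg (fun d : L.Data => b.correction d.1)
    (Equiv.symm_apply_apply _ _), fun y => ?_⟩
  show L.decode y (gateBit L.card_data_le d) = _
  rw [decode, (gateBit_injective L.card_data_le).extend_apply]

theorem mem_qubits_reset (anc : Prop) [Decidable anc] (q : V) : q ∈ (b.reset anc q).qubits := by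
  unfold PrepBasis.reset
  split_ifs <;> cases b <;> exact Set.mem_singleton _

theorem coupling_ne_reset {d a : V} (h : d ≠ a) (anc : Prop) [Decidable anc] (q : V) :
    b.reset anc q ≠ b.coupling d a h := by
  unfold PrepBasis.reset
  split_ifs <;> cases b <;> simp [PrepBasis.resetAncilla, PrepBasis.resetData, PrepBasis.coupling]

theorem coupling_inj {d a d' a' : V} {h : d ≠ a} {h' : d' ≠ a'}
    (heq : b.coupling d a h = b.coupling d' a' h') : d = d' ∧ a = a' := by
  cases b <;> simp only [PrepBasis.coupling, CliffordGate.cnot.injEq] at heq <;> tauto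

/-- Resets, readouts and corrections differ from couplings as gates, and a coupling determines its
pair and hence its color. So the gate fixes the time at which it occurs; the summand one accounts
for the reset step. -/
theorem eq_color_of_gate {t : ℕ} {g : Fin (L.stepAt b t).numGates} {d a : V} {h : d ≠ a}
    (hg : (L.stepAt b t).gate g = b.coupling d a h) : t = L.color (d, a) + 1 := by
  rcases Nat.eq_zero_or_pos t with rfl | h0
  · obtain ⟨q, hq⟩ := L.gate_resetStep b (L.stepAt_zero b) g
    exact absurd (hq.symm.trans hg) (coupling_ne_reset b h _ _)
  · by_cases h1 : t ≤ L.numColors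
    · obtain ⟨q, hq⟩ := L.gate_couplingStep b (L.stepAt_coupling b h0 h1) g
      obtain ⟨rfl, rfl⟩ := coupling_inj b (hq.symm.trans hg)
      have := q.2.2
      simp only [Prod.mk.eta]
      omega
    · by_cases h2 : t = L.numColors + 1
      · obtain ⟨q, hq⟩ := L.gate_readoutStep b (L.stepAt_readout b h2) g
        rw [hq] at hg
        cases b <;> simp [PrepBasis.readout, PrepBasis.coupling] at hg
      · obtain ⟨q, hq⟩ := L.gate_correctionStep b (L.stepAt_correction b (by omega)) g
        rw [hq] at hg
        cases b <;> simp [PrepBasis.correction, PrepBasis.coupling] at hg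

theorem existsUnique_gate_eq_coupling {d a : V} (h : L.rel d a) :
    ∃! p : (Σ t : Fin (L.circuit b).T, Fin ((L.circuit b).step t).numGates),
      ((L.circuit b).step p.1).gate p.2 = b.coupling d a (L.rel_ne h) := by
  have hc := L.color_lt h
  obtain ⟨g, hg⟩ := L.exists_gate_couplingStep b
    (L.stepAt_coupling b (t := L.color (d, a) + 1) (by omega) (by omega)) ⟨(d, a), h, rfl⟩
  have hT : L.color (d, a) + 1 < (L.circuit b).T := by
    show _ < L.numColors + 3
    omega
  refine ⟨⟨⟨L.color (d, a) + 1, hT⟩, g⟩, hg, ?_⟩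
  rintro ⟨⟨t, ht⟩, g'⟩ hg'
  obtain rfl := L.eq_color_of_gate b hg'
  congr 1
  -- Two gates of one step act on disjoint sets of qubits, so the same coupling cannot occur twice
  -- in it.
  by_contra hne
  have hdis := ((L.circuit b).step ⟨L.color (d, a) + 1, ht⟩).disjoint g' g hne
  rw [hg'] at hdis
  have hg2 : ((L.circuit b).step ⟨L.color (d, a) + 1, ht⟩).gate g =
    b.coupling d a (L.rel_ne h) := hg
  rw [hg2, disjoint_self] at hdis
  have : d ∈ (b.coupling d a (L.rel_ne h)).qubits := by
    cases b
    · exact Or.inl rfl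
    · exact Or.inr rfl
  rw [hdis] at this
  exact this

end PrepLayout

/-! ### The circuit of a complex and its single-shot structure -/

namespace BasedCochainComplex

open scoped Classical

variable {X : Type*} [Fintype X] {r : ℕ} (D : BasedCochainComplex X r) (j : ℕ)

/-- The small-set flip decoding algorithm terminates. -/
theorem exists_isSSFlipOutput {i : ℕ} (s : D.Cochain (i + 1)) :
    ∃ a : D.Cochain i, D.IsSSFlipOutput s a := by
  -- Termination: the weight of the residual syndrome drops with each flip.
  have key : ∀ n, ∀ a : D.Cochain i, hammingNorm (s + D.cob i (i + 1) a) = n →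
      ∃ a', Relation.ReflTransGen (D.SSFlipStep s) a a' ∧ ∀ a'', ¬ D.SSFlipStep s a' a'' := by
    intro n
    induction n using Nat.strong_induction_on with
    | _ n ih =>
      intro a ha
      by_cases h : ∃ a', D.SSFlipStep s a a'
      · obtain ⟨a', h⟩ := h
        have hlt := h
        obtain ⟨z, hz, c, hc, _, hlt⟩ := hlt
        obtain ⟨a'', h1, h2⟩ := ih _ (ha ▸ hlt) a' rfl
        exact ⟨a'', Relation.ReflTransGen.head h h1, h2⟩
      · push Not at h
        exact ⟨a, Relation.ReflTransGen.refl, h⟩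
  exact key _ 0 rfl

/-- The output of small-set flip decoding. -/
noncomputable def ssFlipOutput {i : ℕ} (s : D.Cochain (i + 1)) : D.Cochain i :=
  (D.exists_isSSFlipOutput s).choose

theorem isSSFlipOutput_ssFlipOutput {i : ℕ} (s : D.Cochain (i + 1)) :
    D.IsSSFlipOutput s (D.ssFlipOutput s) := (D.exists_isSSFlipOutput s).choose_spec

/-- A solution of the linear system `δ x = t`, if there is one. -/
noncomputable def solution (t : D.Cochain (j + 1)) : D.Cochain j :=
  if h : ∃ x, D.cob j (j + 1) x = t then h.choose else 0

theorem cob_solution {t : D.Cochain (j + 1)} (h : ∃ x, D.cob j (j + 1) x = t) :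
    D.cob j (j + 1) (D.solution j t) = t := by
  rw [solution, dif_pos h]
  exact h.choose_spec

/-- The qubits of the preparation circuit: the cells of degree `j` and those incident to them. -/
noncomputable def prepSet : Finset X :=
  Finset.univ.filter fun x => D.deg x = j ∨ D.deg x = j + 1 ∧ ∃ d, D.deg d = j ∧ D.Incident d x

variable {D j}

theorem deg_of_mem_prepSet {x : X} (h : x ∈ D.prepSet j) : D.deg x = j ∨ D.deg x = j + 1 := by
  rw [prepSet, Finset.mem_filter] at h
  exact h.2.imp id And.left

theorem mem_prepSet_of_deg {x : X} (h : D.deg x = j) : x ∈ D.prepSet j :=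
  Finset.mem_filter.2 ⟨Finset.mem_univ _, Or.inl h⟩

theorem deg_of_incident {d a : X} (hd : D.deg d = j) (h : D.Incident d a) : D.deg a = j + 1 :=
  (D.deg_eq _ _ h).trans (by rw [hd])

theorem mem_prepSet_of_incident {d a : X} (hd : D.deg d = j) (h : D.Incident d a) :
    a ∈ D.prepSet j :=
  Finset.mem_filter.2 ⟨Finset.mem_univ _, Or.inr ⟨deg_of_incident hd h, d, hd, h⟩⟩

theorem card_prepSet_le {w : ℕ} (hw1 : 1 ≤ w) (hw : D.HasLocality w) :
    (D.prepSet j).card ≤ 2 * (Fintype.card (D.Level j) * w) := by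
  have hsub : D.prepSet j ⊆ (Finset.univ.filter fun x => D.deg x = j) ∪
      (Finset.univ.filter fun x => D.deg x = j).biUnion
        fun d => Finset.univ.filter fun a => D.Incident d a := by
    intro x hx
    rw [prepSet, Finset.mem_filter] at hx
    simp only [Finset.mem_union, Finset.mem_biUnion, Finset.mem_filter, Finset.mem_univ, true_and]
    exact hx.2.imp id fun h => h.2
  have h1 : (Finset.univ.filter fun x => D.deg x = j).card = Fintype.card (D.Level j) := by
    rw [Fintype.card_subtype]
  have h2 := (Finset.card_le_card hsub).trans (Finset.card_union_le _ _)
  have h3 := Finset.card_biUnion_le_card_mul (Finset.univ.filter fun x => D.deg x = j)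
    (fun d => Finset.univ.filter fun a => D.Incident d a) w fun d _ => by
      refine le_trans ?_ (hw d)
      rw [← Set.ncard_coe_finset]
      refine Set.ncard_le_ncard ?_ (Set.toFinite _)
      intro a ha
      exact Or.inr (Incident.below (by simpa using ha))
  rw [h1] at h2 h3
  have h4 : Fintype.card (D.Level j) ≤ Fintype.card (D.Level j) * w := Nat.le_mul_of_pos_right _ hw1
  omega

/-- The cochain of degree `j + 1` of the outcomes of the measurements of the ancilla qubits. -/
noncomputable def ancCochain (s : Bits ↥(D.prepSet j)) : D.Cochain (j + 1) := fun a =>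
  if h : a.1 ∈ D.prepSet j then s ⟨a.1, h⟩ else 0

/-- The cochain of degree `j` of the values of the data qubits. -/
def dataCochain (x : Bits ↥(D.prepSet j)) : D.Cochain j := fun d =>
  x ⟨d.1, mem_prepSet_of_deg d.2⟩

/-- The correction computed from a syndrome. -/
noncomputable def correctionOf (s : D.Cochain (j + 1)) : D.Cochain j :=
  D.solution j (s + D.ssFlipOutput (D.cob (j + 1) (j + 2) s))

theorem exists_prep_coloring {w : ℕ} (hw : D.HasLocality w) :
    ∃ col : ↥(D.prepSet j) × ↥(D.prepSet j) → ℕ,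
      (∀ q : ↥(D.prepSet j) × ↥(D.prepSet j), (D.deg q.1.1 = j ∧ D.Incident q.1.1 q.2.1) →
        col q < 2 * w + 1) ∧
      ∀ q q' : ↥(D.prepSet j) × ↥(D.prepSet j), (D.deg q.1.1 = j ∧ D.Incident q.1.1 q.2.1) →
        (D.deg q'.1.1 = j ∧ D.Incident q'.1.1 q'.2.1) → q ≠ q' → col q = col q' →
        q.1 ≠ q'.1 ∧ q.2 ≠ q'.2 := by
  refine exists_edge_coloring (fun d a : ↥(D.prepSet j) => D.deg d.1 = j ∧ D.Incident d.1 a.1) w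
    (fun d => ?_) (fun a => ?_)
  · refine le_trans ?_ (hw d.1)
    rw [← Set.ncard_image_of_injective _ Subtype.val_injective]
    refine Set.ncard_le_ncard ?_ (Set.toFinite _)
    rintro _ ⟨a, ⟨-, h⟩, rfl⟩
    exact Or.inr (Incident.below h)
  · refine le_trans ?_ (hw a.1)
    rw [← Set.ncard_image_of_injective _ Subtype.val_injective]
    refine Set.ncard_le_ncard ?_ (Set.toFinite _)
    rintro _ ⟨d, ⟨-, h⟩, rfl⟩
    exact Or.inl (Incident.below h)

variable (j) in
/-- The layout of single-shot state preparation. -/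
noncomputable def layout {w : ℕ} (hw : D.HasLocality w) : PrepLayout ↥(D.prepSet j) where
  anc v := D.deg v.1 = j + 1
  rel d a := D.deg d.1 = j ∧ D.Incident d.1 a.1
  rel_data h := by
    rw [h.1]
    omega
  rel_anc h := deg_of_incident h.1 h.2
  numColors := 2 * w + 1
  color := (exists_prep_coloring hw).choose
  color_lt h := (exists_prep_coloring hw).choose_spec.1 _ h
  color_proper h h' := (exists_prep_coloring hw).choose_spec.2 _ _ h h'
  corr s v := if h : D.deg v.1 = j then correctionOf (ancCochain s) ⟨v.1, h⟩ else 0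
  corr_anc s v h := dif_neg (by rw [h]; omega)

theorem isSingleShotPreparation [DecidableEq X] (b : PrepBasis) {w : ℕ} (hw : D.HasLocality w) :
    IsSingleShotPreparation D j b ((D.layout j hw).circuit b) := by
  set L := D.layout j hw with hL
  have hdeg : ∀ q : ↥(D.prepSet j), D.deg q.1 = j ∨ D.deg q.1 = j + 1 := fun q =>
    deg_of_mem_prepSet q.2
  have hdata : ∀ q : ↥(D.prepSet j), ¬ L.anc q → D.deg q.1 = j := fun q h => (hdeg q).resolve_right h
  constructor
  · show 3 ≤ L.numColors + 3
    omega
  · intro q hq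
    exact deg_of_mem_prepSet hq
  · intro x hx
    exact mem_prepSet_of_deg hx
  · rintro ⟨t, ht⟩ hlt x g
    have ht' : t + 2 < L.numColors + 3 := hlt
    refine L.classical_bit_eq_one b ?_ x g
    rcases Nat.eq_zero_or_pos t with rfl | h0
    · exact Or.inl (L.stepAt_zero b)
    · exact Or.inr ⟨_, L.stepAt_coupling b (t := t) h0 (by omega)⟩
  · rintro ⟨t, ht⟩ rfl g
    obtain ⟨q, hq⟩ := L.gate_resetStep b (L.stepAt_zero b) g
    refine ⟨q, ?_⟩
    by_cases h : L.anc q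
    · exact Or.inr ⟨h, hq.trans (if_pos h)⟩
    · exact Or.inl ⟨hdata q h, hq.trans (if_neg h)⟩
  · rintro ⟨t, ht⟩ rfl q
    obtain ⟨g, hg⟩ := L.exists_gate_resetStep b (L.stepAt_zero b) q
    refine ⟨g, ?_⟩
    have := PrepLayout.mem_qubits_reset b (L.anc q) q
    rw [← hg] at this
    exact this
  · rintro ⟨t, ht⟩ h0 hlt g
    have ht' : t + 2 < L.numColors + 3 := hlt
    obtain ⟨q, hq⟩ := L.gate_couplingStep b (L.stepAt_coupling b (t := t) h0 (by omega)) g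
    exact ⟨q.1.1, q.1.2, L.rel_ne q.2.1, q.2.1.1, q.2.1.2, hq⟩
  · intro x y hx hxy
    have hrel : L.rel ⟨x, mem_prepSet_of_deg hx⟩ ⟨y, mem_prepSet_of_incident hx hxy⟩ := ⟨hx, hxy⟩
    exact ⟨_, _, L.rel_ne hrel, rfl, rfl, L.existsUnique_gate_eq_coupling b hrel⟩
  · rintro ⟨t, ht⟩ htT g
    have ht' : t + 2 = L.numColors + 3 := htT
    obtain ⟨a, ha⟩ := L.gate_readoutStep b (L.stepAt_readout b (t := t) (by omega)) g
    exact ⟨a.1, a.2, ha⟩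
  · rintro ⟨t, ht⟩ htT a hadeg
    have ht' : t + 2 = L.numColors + 3 := htT
    obtain ⟨g, hg, -⟩ := L.exists_gate_readoutStep b (L.stepAt_readout b (t := t) (by omega))
      ⟨a, hadeg⟩
    exact ⟨g, hg⟩
  · rintro ⟨t, ht⟩ htT g
    have ht' : t + 1 = L.numColors + 3 := htT
    obtain ⟨d, hd⟩ := L.gate_correctionStep b (L.stepAt_correction b (t := t) (by omega)) g
    exact ⟨d.1, hdata _ d.2, hd⟩
  · rintro ⟨t, ht⟩ htT d hddeg
    have ht' : t + 1 = L.numColors + 3 := htT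
    obtain ⟨g, hg, -⟩ := L.exists_gate_correctionStep b (L.stepAt_correction b (t := t) (by omega))
      ⟨d, fun h : D.deg d.1 = j + 1 => by omega⟩
    exact ⟨g, hg⟩
  · refine ⟨D.ssFlipOutput, D.isSSFlipOutput_ssFlipOutput, ?_⟩
    rintro ⟨t, ht⟩ ⟨t', ht'⟩ htT htT' y s x hs hs' hx hsol
    have h1 : t + 2 = L.numColors + 3 := htT
    have h2 : t' + 1 = L.numColors + 3 := htT'
    -- The register determines `s` on the ancilla cells, and both sides vanish on the other cells;
    -- in the same way it determines `x` on all data cells.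
    have hs2 : s = ancCochain (L.synd y) := by
      funext a
      by_cases ha : a.1 ∈ D.prepSet j
      · obtain ⟨g, hg, hgy⟩ := L.exists_gate_readoutStep b (L.stepAt_readout b (t := t) (by omega))
          ⟨⟨a.1, ha⟩, a.2⟩
        rw [ancCochain, dif_pos ha]
        exact (hs a ha g hg).trans (hgy y)
      · rw [ancCochain, dif_neg ha]
        exact hs' a ha
    have hx2 : x = correctionOf s := by
      funext d
      have hd := mem_prepSet_of_deg d.2
      obtain ⟨g, hg, hgy⟩ := L.exists_gate_correctionStep b
        (L.stepAt_correction b (t := t') (by omega))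
        ⟨⟨d.1, hd⟩, fun h : D.deg d.1 = j + 1 => by have := d.2; omega⟩
      refine (hx d hd g hg).trans ((hgy y).trans ?_)
      rw [hs2]
      exact dif_pos d.2
    rw [hx2]
    exact D.cob_solution j hsol

end BasedCochainComplex

/-! ### Tensor products of states of a block and of the other qubits -/

section Tensor

open scoped Classical

variable {B V R : Type*} [Fintype B] [DecidableEq B] [Fintype V] [DecidableEq V] (e : B ↪ V)

/-- The qubits outside of the block. -/
abbrev Outside : Type _ := ↥(Set.range e)ᶜ

/-- The qubits of the block together with the other qubits. -/
noncomputable def blockSum : B ⊕ Outside e ≃ V :=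
  (Equiv.sumCongr (Equiv.ofInjective e e.injective) (Equiv.refl _)).trans
    (Equiv.Set.sumCompl (Set.range e))

/-- The bits of the block together with the other bits. -/
noncomputable def splitBits : Bits V ≃ Bits B × Bits (Outside e) :=
  (Equiv.arrowCongr (blockSum e).symm (Equiv.refl _)).trans (Equiv.sumArrowEquivProdArrow _ _ _)

/-- The restriction to the qubits outside of the block. -/
def outer (x : Bits V) : Bits (Outside e) := fun v => x v.1

theorem sum_split {M : Type*} [AddCommMonoid M] (f : V → M) :
    ∑ v, f v = ∑ b, f (e b) + ∑ v : Outside e, f v.1 := by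
  rw [← (blockSum e).sum_comp, Fintype.sum_sum_type]
  rfl

theorem sum_bits_mul_bits (f : Bits B → ℂ) (g : Bits (Outside e) → ℂ) :
    ∑ x : Bits V, f (x ∘ e) * g (outer e x) = (∑ x, f x) * ∑ z, g z := by
  rw [Finset.sum_mul_sum, ← Fintype.sum_prod_type']
  exact Fintype.sum_equiv (splitBits e) _ _ fun _ => rfl

/-- The tensor product of a vector on the block and a vector on the other qubits. -/
def tensorVec (α : Bits B → ℂ) (β : Bits (Outside e) → ℂ) : Bits V → ℂ :=
  fun x => α (x ∘ e) * β (outer e x)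

theorem dotProduct_split (p x : Bits V) :
    p ⬝ᵥ x = (p ∘ e) ⬝ᵥ (x ∘ e) + outer e p ⬝ᵥ outer e x :=
  sum_split e fun v => p v * x v

theorem shift_tensorVec (a : Bits V) (α : Bits B → ℂ) (β : Bits (Outside e) → ℂ) :
    shift a (tensorVec e α β) = tensorVec e (shift (a ∘ e) α) (shift (outer e a) β) := rfl

theorem phase_tensorVec (p : Bits V) (α : Bits B → ℂ) (β : Bits (Outside e) → ℂ) :
    phase p (tensorVec e α β) = tensorVec e (phase (p ∘ e) α) (phase (outer e p) β) := by
  ext x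
  simp only [phase, tensorVec, dotProduct_split e p x, sgn_add]
  ring

theorem hadamardTransform_tensorVec (α : Bits B → ℂ) (β : Bits (Outside e) → ℂ) :
    hadamardTransform (tensorVec e α β) =
      tensorVec e (hadamardTransform α) (hadamardTransform β) := by
  ext x
  simp only [hadamardTransform, tensorVec]
  rw [← sum_bits_mul_bits]
  refine Finset.sum_congr rfl fun y _ => ?_
  rw [dotProduct_split e x y, sgn_add]
  ring

theorem PrepBasis.frame_tensorVec (b : PrepBasis) (α : Bits B → ℂ) (β : Bits (Outside e) → ℂ) :
    b.frame (tensorVec e α β) = tensorVec e (b.frame α) (b.frame β) := by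
  cases b
  · rfl
  · exact hadamardTransform_tensorVec e α β

/-- The restriction of the exponents of a Pauli operator to the block. -/
def blockBits (E : Bits V × Bits V) : Bits B × Bits B := (E.1 ∘ e, E.2 ∘ e)

theorem pauliAct_tensorVec (E : Bits V × Bits V) (α : Bits B → ℂ) (β : Bits (Outside e) → ℂ) :
    pauliAct E (tensorVec e α β) =
      tensorVec e (pauliAct (blockBits e E) α) (pauliAct (outer e E.1, outer e E.2) β) := by
  rw [pauliAct, shift_tensorVec, phase_tensorVec]
  rfl

/-- The partial trace as a linear map. -/
noncomputable def traceOutLin : Op V R →ₗ[ℂ] Op B R where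
  toFun := traceOut e
  map_add' σ τ := by
    ext a c
    simp only [traceOut, Matrix.of_apply, Matrix.add_apply, ← Finset.sum_add_distrib]
    refine Finset.sum_congr rfl fun x _ => Finset.sum_congr rfl fun y _ => ?_
    split_ifs <;> simp
  map_smul' k σ := by
    ext a c
    simp only [traceOut, Matrix.of_apply, Matrix.smul_apply, smul_eq_mul, Finset.mul_sum,
      RingHom.id_apply]
    refine Finset.sum_congr rfl fun x _ => Finset.sum_congr rfl fun y _ => ?_
    split_ifs <;> simp

/-- The partial trace contracts the outer factors of the two sides to the scalar `∑ z, β z * β' z`.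
No conjugation occurs since the right factor is stored unconjugated. -/
theorem traceOut_prodOp_tensorVec (α α' : Bits B → ℂ) (β β' : Bits (Outside e) → ℂ)
    (ρ : Matrix R R ℂ) :
    traceOut e (prodOp (tensorVec e α β) (tensorVec e α' β') ρ) =
      (∑ z, β z * β' z) • prodOp α α' ρ := by
  ext ⟨a, p⟩ ⟨c, q⟩
  have h1 : ∀ x y : Bits V, (∀ v, v ∉ Set.range e → x v = y v) ↔ outer e x = outer e y :=
    fun x y => ⟨fun h => funext fun v => h v.1 v.2, fun h v hv => congrFun h ⟨v, hv⟩⟩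
  have h2 : ∀ x y : Bits V, (if x ∘ e = a ∧ y ∘ e = c ∧ ∀ v, v ∉ Set.range e → x v = y v then
      prodOp (tensorVec e α β) (tensorVec e α' β') ρ (x, p) (y, q) else 0) =
      (if x ∘ e = a then α (x ∘ e) else 0) * (β (outer e x) * (
        (if y ∘ e = c then α' (y ∘ e) else 0) *
          if outer e x = outer e y then β' (outer e y) else 0)) * ρ p q := by
    intro x y
    simp only [h1]
    by_cases h3 : x ∘ e = a <;> by_cases h4 : y ∘ e = c <;> by_cases h5 : outer e x = outer e y <;>
      simp [h3, h4, h5, prodOp, tensorVec, Matrix.vecMulVec, Matrix.kroneckerMap_apply]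
    left
    ring
  simp only [traceOut, Matrix.of_apply, h2, ← Finset.sum_mul, ← Finset.mul_sum]
  have h6 : ∀ x : Bits V, (∑ y : Bits V, (if y ∘ e = c then α' (y ∘ e) else 0) *
      if outer e x = outer e y then β' (outer e y) else 0) = α' c * β' (outer e x) := by
    intro x
    rw [sum_bits_mul_bits e (fun t => if t = c then α' t else 0)
      fun z => if outer e x = z then β' z else 0]
    simp
  simp only [h6]
  rw [sum_bits_mul_bits e (fun t => if t = a then α t else 0) fun z => β z * (α' c * β' z)]
  simp only [Finset.sum_ite_eq', Finset.mem_univ, if_true, prodOp, Matrix.smul_apply,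
    Matrix.kroneckerMap_apply, Matrix.vecMulVec_apply, smul_eq_mul, Finset.sum_mul, Finset.mul_sum]
  refine Finset.sum_congr rfl fun z _ => ?_
  ring

end Tensor

theorem pauliAct_shift {V : Type*} [Fintype V] (E : Bits V × Bits V) (a : Bits V)
    (f : Bits V → ℂ) : pauliAct E (shift a f) = pauliAct (E.1, E.2 + a) f := by
  rw [pauliAct, shift_shift]
  rfl

/-! ### The corrected states as shifted superpositions of cocycles -/

namespace BasedCochainComplex

open scoped Classical

variable {X : Type*} [Fintype X] [DecidableEq X] {r : ℕ} {D : BasedCochainComplex X r} {j : ℕ}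

/-- Once all couplings are done, the parity held by an ancilla qubit is the value of the coboundary
of the data string there. -/
theorem sum_allPairs {w : ℕ} (hw : D.HasLocality w) (x : Bits ↥(D.prepSet j)) (a : ↥(D.prepSet j))
    (ha : D.deg a.1 = j + 1) :
    ∑ d, (D.layout j hw).allPairs.indicator (fun q => x q.1) (d, a) =
      D.cob j (j + 1) (dataCochain x) ⟨a.1, ha⟩ := by
  rw [cob_apply]
  symm
  refine Fintype.sum_of_injective (D.levelEmb fun _ => mem_prepSet_of_deg)
    (Function.Embedding.injective _) _ _ ?_ ?_
  · intro d hd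
    refine Set.indicator_of_notMem ?_ _
    intro h
    exact hd ⟨⟨d.1, h.1⟩, rfl⟩
  · intro d
    by_cases h : D.Incident d.1 a.1
    · have h1 : D.δ a.1 d.1 = 1 := (zmod_two_cases _).resolve_left h
      rw [Set.indicator_of_mem (show (D.levelEmb (fun _ => mem_prepSet_of_deg) d, a) ∈
        (D.layout j hw).allPairs from ⟨d.2, h⟩), h1, one_mul]
      rfl
    · rw [Set.indicator_of_notMem (fun h' => h h'.2), not_not.1 h, zero_mul]

/-- Extending the syndrome by zero to cells that carry no qubit loses nothing: coboundaries of
`j`-cochains vanish there. -/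
theorem cob_eq_zero_of_notMem (c : D.Cochain j) (a : D.Level (j + 1)) (ha : a.1 ∉ D.prepSet j) :
    D.cob j (j + 1) c a = 0 := by
  by_contra h
  obtain ⟨x, -, hx⟩ := D.exists_incident_of_cob_ne_zero h
  exact ha (mem_prepSet_of_incident x.2 hx)

theorem ancCochain_add (s u : Bits ↥(D.prepSet j)) :
    ancCochain (s + u) = ancCochain s + ancCochain u := by
  ext a
  by_cases h : a.1 ∈ D.prepSet j <;> simp [ancCochain, h]

theorem cochain_add_eq_zero_iff {l : ℕ} {c c' : D.Cochain l} : c + c' = 0 ↔ c = c' := by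
  rw [add_eq_zero_iff_eq_neg, ZModModule.neg_eq_self]

/-- Fixing all ancilla bits turns the parity conditions into the single cochain equation `δ x = s +
u`. -/
theorem measured_univ_apply {w : ℕ} (hw : D.HasLocality w) (s u x : Bits ↥(D.prepSet j)) :
    (D.layout j hw).measured Finset.univ s u x =
      if (∀ a : ↥(D.prepSet j), D.deg a.1 = j + 1 → x a = s a + u a) ∧
        D.cob j (j + 1) (dataCochain x) = ancCochain s + ancCochain u then 1 else 0 := by
  have h1 : (∀ a ∈ (Finset.univ : Finset (D.layout j hw).Anc), x a.1 = s a.1 + u a.1) ↔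
      ∀ a : ↥(D.prepSet j), D.deg a.1 = j + 1 → x a = s a + u a :=
    ⟨fun h a ha => h ⟨a, ha⟩ (Finset.mem_univ _), fun h a _ => h a.1 a.2⟩
  have h2 : (∀ a : ↥(D.prepSet j), D.deg a.1 = j + 1 → x a = s a + u a) →
      ((∀ a, (D.layout j hw).anc a → x a = ∑ d, (D.layout j hw).allPairs.indicator
        (fun q => x q.1) (d, a)) ↔
      D.cob j (j + 1) (dataCochain x) = ancCochain s + ancCochain u) := by
    intro h
    rw [← ancCochain_add]
    constructor
    · intro h'
      ext a
      by_cases ha : a.1 ∈ D.prepSet j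
      · rw [ancCochain, dif_pos ha, Pi.add_apply, ← h ⟨a.1, ha⟩ a.2, h' ⟨a.1, ha⟩ a.2, sum_allPairs hw x ⟨a.1, ha⟩ a.2]
      · rw [ancCochain, dif_neg ha, cob_eq_zero_of_notMem _ _ ha]
    · intro h' a ha
      rw [sum_allPairs hw x a ha, h', ancCochain, dif_pos a.2, h a ha]
      rfl
  rw [PrepLayout.measured, PrepLayout.parity]
  by_cases h3 : ∀ a : ↥(D.prepSet j), D.deg a.1 = j + 1 → x a = s a + u a
  · rw [if_pos (h1.2 h3)]
    refine if_congr ?_ rfl rfl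
    rw [h2 h3, and_iff_right h3]
  · rw [if_neg (fun h => h3 (h1.1 h)), if_neg fun h => h3 h.1]

theorem shift_corr_measured_apply {w : ℕ} (hw : D.HasLocality w) (s u x : Bits ↥(D.prepSet j)) :
    shift ((D.layout j hw).corr s) ((D.layout j hw).measured Finset.univ s u) x =
      if (∀ a : ↥(D.prepSet j), D.deg a.1 = j + 1 → x a = s a + u a) ∧
        D.cob j (j + 1) (dataCochain x + correctionOf (ancCochain s)) =
          ancCochain s + ancCochain u then 1 else 0 := by
  rw [shift, measured_univ_apply]
  have h1 : ∀ a : ↥(D.prepSet j), D.deg a.1 = j + 1 →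
      (x + (D.layout j hw).corr s) a = x a := fun a ha => by
    rw [Pi.add_apply, (D.layout j hw).corr_anc s a ha, add_zero]
  have h2 : dataCochain (x + (D.layout j hw).corr s) =
      dataCochain x + correctionOf (ancCochain s) := by
    ext d
    simp only [dataCochain, Pi.add_apply]
    congr 1
    exact dif_pos d.2
  rw [h2]
  refine if_congr (and_congr_left' ?_) rfl rfl
  exact forall₂_congr fun a ha => by rw [h1 a ha]

section Block

variable {B : Type*} [Fintype B] [DecidableEq B] (e : B ↪ ↥(D.prepSet j)) (ε : B ≃ D.Level j)

/-- The indicator of the cocycles. -/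
noncomputable def cocycleVec (x : Bits B) : ℂ := if D.cob j (j + 1) (x ∘ ε.symm) = 0 then 1 else 0

theorem dataCochain_eq {e : B ↪ ↥(D.prepSet j)} {ε : B ≃ D.Level j} (he : ∀ v, (e v).1 = (ε v).1) (x : Bits ↥(D.prepSet j)) :
    dataCochain x = (x ∘ e) ∘ ε.symm := by
  funext d
  refine congrArg x (Subtype.ext ?_)
  rw [he, Equiv.apply_symm_apply]

/-- The state after the correction, if a solution of the linear system exists. -/
theorem shift_corr_measured_eq_tensorVec {w : ℕ} (hw : D.HasLocality w)
    (he : ∀ v, (e v).1 = (ε v).1) (s u : Bits ↥(D.prepSet j)) (g : D.Cochain j)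
    (hg : D.cob j (j + 1) g = ancCochain u +
      D.ssFlipOutput (D.cob (j + 1) (j + 2) (ancCochain u))) :
    ∃ β : Bits (Outside e) → ℂ,
      shift ((D.layout j hw).corr s) ((D.layout j hw).measured Finset.univ s u) =
        tensorVec e (shift (g ∘ ε) (cocycleVec ε)) β := by
  by_cases hy : ∃ y, D.cob j (j + 1) y = ancCochain s + ancCochain u
  · obtain ⟨y, hy⟩ := hy
    -- Since `s + u` is a coboundary, the decoder input is determined by `u`, so its output does not
    -- depend on `s`.
    have hδ : D.cob (j + 1) (j + 2) (ancCochain s) = D.cob (j + 1) (j + 2) (ancCochain u) := by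
      have h1 := D.cob_cob j (j + 1) y
      rw [hy, map_add] at h1
      exact cochain_add_eq_zero_iff.1 h1
    -- The linear system is solvable, since `δ (y + g) = (s + u) + (u + a) = s + a`.
    have hκ : D.cob j (j + 1) (correctionOf (ancCochain s)) = ancCochain s +
        D.ssFlipOutput (D.cob (j + 1) (j + 2) (ancCochain u)) := by
      rw [correctionOf, hδ]
      refine D.cob_solution j ⟨y + g, ?_⟩
      rw [map_add, hy, hg, add_assoc, ← add_assoc (ancCochain u), ZModModule.add_self, zero_add]
    refine ⟨fun z => if ∀ (a : ↥(D.prepSet j)) (ha : D.deg a.1 = j + 1) (h : a ∈ (Set.range e)ᶜ),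
      z ⟨a, h⟩ = s a + u a then 1 else 0, ?_⟩
    ext x
    have hout : ∀ a : ↥(D.prepSet j), D.deg a.1 = j + 1 → a ∈ (Set.range e)ᶜ := by
      rintro _ ha ⟨v, rfl⟩
      rw [he, (ε v).2] at ha
      omega
    have h1 : (∀ a : ↥(D.prepSet j), D.deg a.1 = j + 1 → x a = s a + u a) ↔
        ∀ (a : ↥(D.prepSet j)) (ha : D.deg a.1 = j + 1) (h : a ∈ (Set.range e)ᶜ),
          outer e x ⟨a, h⟩ = s a + u a :=
      ⟨fun h a ha _ => h a ha, fun h a ha => h a ha (hout a ha)⟩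
    -- Inserting `δ x' = s + a` for the correction `x'` leaves `δ x = u + a = δ g`, from which `s`
    -- has disappeared.
    have h2 : D.cob j (j + 1) (dataCochain x + correctionOf (ancCochain s)) =
        ancCochain s + ancCochain u ↔ D.cob j (j + 1) ((x ∘ e + g ∘ ε) ∘ ε.symm) = 0 := by
      have h3 : (x ∘ e + g ∘ ε) ∘ ε.symm = dataCochain x + g := by
        rw [dataCochain_eq he]
        ext d
        simp
      rw [h3, map_add, map_add, hκ, hg, ← cochain_add_eq_zero_iff]
      have h4 : ∀ z s a u : D.Cochain (j + 1), z + (s + a) + (s + u) = s + s + (z + (u + a)) := by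
        intros
        abel
      rw [h4, ZModModule.add_self, zero_add]
    rw [shift_corr_measured_apply, tensorVec, shift, cocycleVec]
    by_cases h4 : D.cob j (j + 1) ((x ∘ e + g ∘ ε) ∘ ε.symm) = 0
    · rw [if_pos h4, one_mul]
      refine if_congr ?_ rfl rfl
      rw [h1, and_iff_left (h2.2 h4)]
    · rw [if_neg h4, zero_mul, if_neg fun h => h4 (h2.1 h.2)]
  -- If `s + u` is not a coboundary, no data string is compatible with the outcome and the vector
  -- vanishes.
  · refine ⟨0, ?_⟩
    ext x
    rw [shift_corr_measured_apply, if_neg fun h => hy ⟨_, h.2⟩]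
    simp [tensorVec]

/-- For every syndrome `s` the reduced state is a multiple of one and the same operator; only the
scalar and the traced out ancilla factors depend on `s`. -/
theorem traceOut_outputTerm {R : Type*} [Fintype R] [DecidableEq R] {w : ℕ} (hw : D.HasLocality w)
    (he : ∀ v, (e v).1 = (ε v).1) (b : PrepBasis) (E E' : Bits ↥(D.prepSet j) × Bits ↥(D.prepSet j))
    (u u' : Bits ↥(D.prepSet j)) (g g' : D.Cochain j)
    (hg : D.cob j (j + 1) g = ancCochain u +
      D.ssFlipOutput (D.cob (j + 1) (j + 2) (ancCochain u)))
    (hg' : D.cob j (j + 1) g' = ancCochain u' +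
      D.ssFlipOutput (D.cob (j + 1) (j + 2) (ancCochain u'))) (ρ : Matrix R R ℂ)
    (s : Bits ↥(D.prepSet j)) :
    ∃ c : ℂ, traceOut e ((D.layout j hw).outputTerm b E u E' u' ρ s) =
      c • twisted b (E.1 ∘ e, E.2 ∘ e + g ∘ ε) (cocycleVec ε)
        (E'.1 ∘ e, E'.2 ∘ e + g' ∘ ε) (cocycleVec ε) ρ := by
  obtain ⟨β, hβ⟩ := shift_corr_measured_eq_tensorVec e ε hw he s u g hg
  obtain ⟨β', hβ'⟩ := shift_corr_measured_eq_tensorVec e ε hw he s u' g' hg'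
  refine ⟨∑ z, b.frame (pauliAct (outer e E.1, outer e E.2) β) z *
    b.frame (pauliAct (outer e E'.1, outer e E'.2) β') z, ?_⟩
  rw [PrepLayout.outputTerm, hβ, hβ', twisted, pauliAct_tensorVec, pauliAct_tensorVec,
    b.frame_tensorVec, b.frame_tensorVec, traceOut_prodOp_tensorVec, pauliAct_shift,
    pauliAct_shift]
  rfl

end Block

end BasedCochainComplex

/-! ### Sparsity of the deviation of the output -/

namespace BasedCochainComplex

open scoped Classical

variable {X : Type*} [Fintype X] [DecidableEq X] {r : ℕ} {D : BasedCochainComplex X r} {j : ℕ}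
  {V : Type*} [Finite V] {G : SimpleGraph V} (P : Placement D j G)

/-- The vertices of the cells in `W` and of the cells incident to them. -/
def Placement.around (W : Set X) : Set V :=
  ⋃ x : {x : {x : X // P.p x} // x.1 ∈ W}, P.star x.1.1

/-- Stars are connected, have at most `w` vertices and contain the distinct singletons of their
centers, so `IsSparse.spread` applies with `k = w`. -/
theorem Placement.isSparse_around {w : ℕ} (hw1 : 1 ≤ w) (hw : D.HasLocality w) {η β : ℝ}
    {W : Set X} (h : IsSparse G η β (placed P.pos id W)) (hβ : w * β ≤ 1 / 2) :
    IsSparse G η (2 * w * β) (P.around W) := by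
  refine h.spread (fun x : {x : {x : X // P.p x} // x.1 ∈ W} => P.star x.1.1)
    (fun x => {P.pos x.1}) (fun x => P.isConnectedSet_star x.1) ?_ ?_ ?_ ?_ hβ
    (by exact_mod_cast hw1)
  · rintro x _ rfl
    exact ⟨x.1, ⟨x.1.1, x.2, rfl⟩, rfl⟩
  · rintro x _ rfl
    exact P.pos_mem_star x.1
  · intro x y hxy
    rw [Set.disjoint_singleton]
    exact fun h => hxy (Subtype.ext (P.inj h))
  · intro x
    rw [Set.ncard_singleton, Nat.cast_one, mul_one]
    exact_mod_cast P.ncard_star_le hw x.1.1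

theorem Placement.pos_mem_around {W : Set X} {x : {x : X // P.p x}} {y : X} (hy : y ∈ W)
    (hpy : P.p y) (h : x.1 = y ∨ D.Incident y x.1 ∨ D.Incident x.1 y) :
    P.pos x ∈ P.around W :=
  Set.mem_iUnion.2 ⟨⟨⟨y, hpy⟩, hy⟩, x, ⟨x.1, h, rfl⟩, rfl⟩

variable {B : Type*} [Fintype B] [DecidableEq B] (e : B ↪ ↥(D.prepSet j)) (ε : B ≃ D.Level j)

theorem Placement.mem_of_mem_prepSet {x : X} (h : x ∈ D.prepSet j) : P.p x :=
  P.mem x ((deg_of_mem_prepSet h).imp id Or.inl)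

/-- The output of the faulty preparation circuit is a Pauli deviation of the state that is, in the frame of
the basis, the superposition of the cocycles. -/
theorem exists_pauliSuperop_traceOut_run {R : Type*} [Fintype R] [DecidableEq R] {w m : ℕ}
    (hw1 : 1 ≤ w) (hw : D.HasLocality w) (hdec : D.HasSmallSetFlipDecoder m 0 (j + 1))
    (he : ∀ v, (e v).1 = (ε v).1) (b : PrepBasis) {η β : ℝ} (hη : η ≤ m) (hβ0 : 0 < β)
    (hβ : 96 * (w : ℝ) ^ 5 * β ≤ 1)
    (F : Fin ((D.layout j hw).circuit b).T → PauliSuperop ↥(D.prepSet j))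
    (hF : ∀ t, IsSparse G η β (placed P.pos Subtype.val (F t).support))
    (σ : CQOp ↥(D.prepSet j) ((D.layout j hw).circuit b).M R) :
    ∃ F' : PauliSuperop B,
      IsSparse G η (204 * (w : ℝ) ^ 5 * β) (placed P.pos (fun v => (ε v).1) F'.support) ∧
      ∃ c : ℂ, traceOut e (∑ y, ((D.layout j hw).circuit b).run F σ y) =
        c • F'.apply (prodOp (b.frame (cocycleVec ε)) (b.frame (cocycleVec ε))
          (refTrace (∑ x, σ x))) := by
  have hw1' : (1 : ℝ) ≤ w := by exact_mod_cast hw1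
  set W : Set ↥(D.prepSet j) := ⋃ t, (F t).support with hW
  have hT : (((D.layout j hw).circuit b).T : ℝ) ≤ 6 * w := by
    have : ((D.layout j hw).circuit b).T = 2 * w + 1 + 3 := rfl
    rw [this]
    push_cast
    linarith
  have hTpos : 0 < ((D.layout j hw).circuit b).T := Nat.succ_pos _
  obtain ⟨E, u, E', u', hE, hu, hE', hu', hrun⟩ :=
    (D.layout j hw).exists_run_mem_span b F (fun t => Set.subset_iUnion (fun t => (F t).support) t) σ
  -- the neighborhood of the faults
  have hWs : IsSparse G η (6 * w * β) (placed P.pos id (Subtype.val '' W)) := by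
    refine (IsSparse.iUnion_fin hTpos hF).mono ?_ (by gcongr)
    rintro _ ⟨x, ⟨_, ⟨v, hv, rfl⟩, hx⟩, rfl⟩
    obtain ⟨t, ht⟩ := Set.mem_iUnion.1 hv
    exact Set.mem_iUnion.2 ⟨t, x, ⟨v, ht, hx⟩, rfl⟩
  have hpow : (w : ℝ) ^ 2 ≤ w ^ 5 := pow_le_pow_right₀ hw1' (by norm_num)
  have hpow4 : (w : ℝ) ^ 2 * β ≤ w ^ 5 * β := by gcongr
  have hNs := P.isSparse_around hw1 hw hWs (by nlinarith)
  have hβ' : 2 * (w : ℝ) * (6 * w * β) = 12 * w ^ 2 * β := by ring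
  rw [hβ'] at hNs
  set N := P.around (Subtype.val '' W) with hN
  have hmemN : ∀ (x : {x : X // P.p x}) (v : ↥(D.prepSet j)), v ∈ W →
      (x.1 = v.1 ∨ D.Incident v.1 x.1 ∨ D.Incident x.1 v.1) → P.pos x ∈ N := fun x v hv h =>
    P.pos_mem_around ⟨v, hv, rfl⟩ (P.mem_of_mem_prepSet v.2) h
  -- A syndrome error sits on a faulty ancilla qubit or next to a faulty data qubit, hence in the
  -- neighborhood `N`.
  have hsynd : ∀ u, (D.layout j hw).ShiftFrom W u →
      IsSparse G η (12 * w ^ 2 * β) (P.q1 '' {x | ancCochain u x ≠ 0}) := by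
    intro u hu
    refine hNs.mono ?_ le_rfl
    rintro _ ⟨a, ha, rfl⟩
    have ha' : ancCochain u a ≠ 0 := ha
    by_cases hmem : a.1 ∈ D.prepSet j
    · rw [ancCochain, dif_pos hmem] at ha'
      obtain h | ⟨d, hd, h⟩ := hu _ ha'
      · exact hmemN _ _ h (Or.inl rfl)
      · exact hmemN _ _ hd (Or.inr (Or.inl h.2))
    · rw [ancCochain, dif_neg hmem] at ha'
      exact absurd rfl ha'
  -- This is the requirement of `exists_sparse_cob_eq` at density `12w²β`, and the source of the
  -- constant `96w⁵`.
  have hβ1 : 8 * (w : ℝ) ^ 3 * (12 * w ^ 2 * β) ≤ 1 := by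
    rw [show 8 * (w : ℝ) ^ 3 * (12 * w ^ 2 * β) = 96 * w ^ 5 * β by ring]
    exact hβ
  have hβ2 : 0 < 12 * (w : ℝ) ^ 2 * β := by positivity
  obtain ⟨g, hg, hgs⟩ := P.exists_sparse_cob_eq hw1 hw hdec hη _ (hsynd u hu) hβ1 hβ2
    (D.isSSFlipOutput_ssFlipOutput _)
  obtain ⟨g', hg', hgs'⟩ := P.exists_sparse_cob_eq hw1 hw hdec hη _ (hsynd u' hu') hβ1 hβ2
    (D.isSSFlipOutput_ssFlipOutput _)
  -- the deviation
  obtain ⟨Q, hQ, hQI⟩ := b.exists_pauliBits_eq (E.1 ∘ e, E.2 ∘ e + g ∘ ε)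
  obtain ⟨Q', hQ', hQI'⟩ := b.exists_pauliBits_eq (E'.1 ∘ e, E'.2 ∘ e + g' ∘ ε)
  refine ⟨⟨Q, Q'⟩, ?_, ?_⟩
  -- The deviation is contained in `N` together with the supports of `g` and `g'`: `12 + 96 + 96 =
  -- 204`, with `w² ≤ w⁵`.
  · have hpow3 : 12 * (w : ℝ) ^ 2 * β + 8 * w ^ 3 * (12 * w ^ 2 * β) +
        8 * w ^ 3 * (12 * w ^ 2 * β) ≤ 204 * w ^ 5 * β := by
      rw [show 8 * (w : ℝ) ^ 3 * (12 * w ^ 2 * β) = 96 * (w ^ 5 * β) by ring]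
      linarith
    refine ((hNs.union hgs).union hgs').mono ?_ hpow3
    have key : ∀ (E : Bits ↥(D.prepSet j) × Bits ↥(D.prepSet j)) (g : D.Cochain j)
        (x : {x : X // P.p x}) (v : B), x.1 = (ε v).1 → (D.layout j hw).ErrorFrom W E →
        (E.1 ∘ e) v ≠ 0 ∨ (E.2 ∘ e + g ∘ ε) v ≠ 0 →
        P.pos x ∈ N ∨ P.pos x ∈ P.q0 '' {x | g x ≠ 0} := by
      intro E g x v hx hE h
      have h1 : E.1 (e v) ≠ 0 ∨ E.2 (e v) ≠ 0 ∨ g (ε v) ≠ 0 := by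
        by_contra! h0
        rcases h with h | h
        · exact h h0.1
        · exact h (by simp [h0.2.1, h0.2.2])
      have hx' : x.1 = (e v).1 := hx.trans (he v).symm
      rcases h1 with h1 | h1 | h1
      · obtain h2 | ⟨a, ha, h2⟩ := hE.1 _ h1
        · exact Or.inl (hmemN x _ h2 (Or.inl hx'))
        · exact Or.inl (hmemN x _ ha (Or.inr (Or.inr (hx' ▸ h2.2))))
      · obtain h2 | ⟨d, hd, h2⟩ := hE.2 _ h1
        · exact Or.inl (hmemN x _ h2 (Or.inl hx'))
        · exact Or.inl (hmemN x _ hd (Or.inr (Or.inl (hx' ▸ h2.2))))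
      · exact Or.inr ⟨ε v, h1, congrArg P.pos (Subtype.ext hx.symm)⟩
    rintro _ ⟨x, ⟨v, hv, hx⟩, rfl⟩
    rcases hv with hv | hv
    · exact Or.inl (key E g x v hx.symm hE (hQI v hv))
    · rcases key E' g' x v hx.symm hE' (hQI' v hv) with h | h
      · exact Or.inl (Or.inl h)
      · exact Or.inr h
  · obtain ⟨c, hc0, hc⟩ := (⟨Q, Q'⟩ : PauliSuperop B).exists_apply_prodOp b (R := R)
    rw [hc, hQ, hQ']
    set ρ := refTrace (∑ x, σ x)
    set τ := twisted b (E.1 ∘ e, E.2 ∘ e + g ∘ ε) (cocycleVec ε)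
      (E'.1 ∘ e, E'.2 ∘ e + g' ∘ ε) (cocycleVec ε) ρ with hτ
    change ∃ c' : ℂ, _ = c' • c • τ
    -- The partial trace is linear and sends every spanning operator into one line, so scalars
    -- depending on the register do not matter.
    have h1 : traceOutLin e (∑ y, ((D.layout j hw).circuit b).run F σ y) ∈ Submodule.span ℂ {τ} := by
      have h2 : Submodule.span ℂ (Set.range ((D.layout j hw).outputTerm b E u E' u' ρ)) ≤
          (Submodule.span ℂ {τ}).comap (traceOutLin e) := by
        rw [Submodule.span_le]
        rintro _ ⟨s, rfl⟩
        obtain ⟨c, hc⟩ := traceOut_outputTerm e ε hw he b E E' u u' g g' hg hg' ρ s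
        rw [SetLike.mem_coe, Submodule.mem_comap]
        change traceOut e _ ∈ _
        rw [hc]
        exact Submodule.smul_mem _ _ (Submodule.mem_span_singleton_self τ)
      exact h2 (Submodule.sum_mem _ fun y _ => hrun y)
    obtain ⟨c', hc'⟩ := Submodule.mem_span_singleton.1 h1
    -- The Pauli operator realizes its exponents only up to the scalar `c`, which has to be nonzero
    -- here to be divided out.
    refine ⟨c' * c⁻¹, ?_⟩
    rw [smul_smul, mul_assoc, inv_mul_cancel₀ hc0, mul_one]
    exact hc'.symm

end BasedCochainComplex

/-! ### Encoded states and the gadget -/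

section Encoded

variable {R : Type*} [Fintype R] [DecidableEq R]

theorem refTrace_smul {V : Type*} [Fintype V] [DecidableEq V] (c : ℂ) (σ : Op V R) :
    refTrace (c • σ) = c • refTrace σ := by
  ext p q
  simp [refTrace, Finset.mul_sum]

theorem refTrace_traceOut_ofIsEmpty {V : Type*} [Fintype V] [DecidableEq V] (σ : Op V R) :
    refTrace (traceOut (Function.Embedding.ofIsEmpty : Fin 0 ↪ V) σ) = refTrace σ := by
  ext p q
  simp only [refTrace, traceOut, Matrix.of_apply]
  rw [Fintype.sum_unique]
  refine Finset.sum_congr rfl fun x _ => ?_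
  rw [Finset.sum_eq_single x]
  · rw [if_pos ⟨Subsingleton.elim _ _, Subsingleton.elim _ _, fun _ _ => rfl⟩]
  · rintro y - hy
    rw [if_neg]
    rintro ⟨-, -, h⟩
    exact hy (funext fun v => (h v fun ⟨i, _⟩ => i.elim0).symm)
  · simp

theorem PauliSuperop.apply_fin_zero (F : PauliSuperop (Fin 0)) (σ : Op (Fin 0) R) :
    F.apply σ = σ := by
  have h : ∀ P : Fin 0 → Pauli, Pauli.tensor P = 1 := by
    intro P
    ext x y
    rw [Subsingleton.elim x y]
    simp [Pauli.tensor]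
  rw [PauliSuperop.apply, h, h, sandwich, Matrix.one_kronecker_one, Matrix.one_mul, Matrix.mul_one]

theorem encode_trivial (ρ : Op (Fin 0) R) : DecoratedCode.trivial.encode ρ = ρ := by
  simp [DecoratedCode.encode, DecoratedCode.trivial]

/-- The circuit gets no input: only the state of the reference system matters. -/
theorem exists_refTrace_eq_smul {V : Type*} [Fintype V] [DecidableEq V] {M : ℕ}
    {ρ : Op (Fin 0) R} {σ : CQOp V M R}
    (h : IsPauliDeviation DecoratedCode.trivial Function.Embedding.ofIsEmpty ρ σ) :
    ∃ c : ℂ, refTrace (∑ x, σ x) = c • refTrace ρ := by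
  obtain ⟨F, -, c, hc⟩ := h
  refine ⟨c, ?_⟩
  rw [← refTrace_traceOut_ofIsEmpty, hc, PauliSuperop.apply_fin_zero, encode_trivial, refTrace_smul]

theorem tensorId_prepareChannel {k : ℕ} (ψ : Bits (Fin k) → ℂ) (ρ : Op (Fin 0) R) :
    tensorId (prepareChannel ψ) ρ = prodOp ψ (star ψ) (refTrace ρ) := by
  ext ⟨x, p⟩ ⟨y, q⟩
  simp only [tensorId, prepareChannel, prodOp, refTrace, Matrix.of_apply, Matrix.trace,
    LinearMap.smulRight_apply, Matrix.traceLinearMap_apply, Matrix.smul_apply, smul_eq_mul,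
    Matrix.kroneckerMap_apply, Matrix.diag_apply]
  exact mul_comm _ _

theorem DecoratedCode.encode_prodOp {B : Type*} [Fintype B] [DecidableEq B] {k : ℕ}
    (D : DecoratedCode B k) (ψ : Bits (Fin k) → ℂ) (ρ : Matrix R R ℂ) :
    D.encode (prodOp ψ (star ψ) ρ) = prodOp (D.enc *ᵥ ψ) (star (D.enc *ᵥ ψ)) ρ := by
  rw [DecoratedCode.encode, prodOp, Matrix.conjTranspose_kronecker, Matrix.conjTranspose_one,
    ← Matrix.mul_kronecker_mul, ← Matrix.mul_kronecker_mul, Matrix.one_mul, Matrix.mul_one,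
    Matrix.mul_vecMulVec, Matrix.vecMulVec_mul, prodOp, Matrix.star_mulVec]

end Encoded

theorem star_sgn (a : ZMod 2) : star (sgn a) = sgn a := by
  rcases zmod_two_cases a with rfl | rfl <;> simp

theorem PrepBasis.star_frame {B : Type*} [Fintype B] [DecidableEq B] (b : PrepBasis)
    {f : Bits B → ℂ} (h : star f = f) : star (b.frame f) = b.frame f := by
  cases b
  · exact h
  · ext x
    simp only [PrepBasis.frame, hadamardTransform, Pi.star_apply, star_sum, star_mul', star_sgn]
    exact Finset.sum_congr rfl fun y _ => congrArg (sgn (x ⬝ᵥ y) * ·) (congrFun h y)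

namespace BasedCochainComplex

variable {X : Type*} [Fintype X] [DecidableEq X] {r : ℕ} {D : BasedCochainComplex X r} {j : ℕ}

theorem star_cocycleVec {B : Type*} (ε : B ≃ D.Level j) : star (cocycleVec ε) = cocycleVec ε := by
  ext x
  simp only [cocycleVec, Pi.star_apply]
  split_ifs <;> simp

/-- The gadget property of single-shot preparation. -/
theorem isPauliFaultTolerantGadget_layout {V : Type*} [Finite V] {G : SimpleGraph V}
    (P : Placement D j G) {B : Type*} [Fintype B] [DecidableEq B] (e : B ↪ ↥(D.prepSet j))
    (ε : B ≃ D.Level j) (he : ∀ v, (e v).1 = (ε v).1) {w m : ℕ} (hw1 : 1 ≤ w)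
    (hw : D.HasLocality w) (hdec : D.HasSmallSetFlipDecoder m 0 (j + 1)) (b : PrepBasis)
    {η β : ℝ} (hη : η ≤ m) (hβ0 : 0 < β) (hβ : 96 * (w : ℝ) ^ 5 * β ≤ 1) {k : ℕ}
    (code : DecoratedCode B k) (bad : Set (Set (↥(D.prepSet j) × Fin ((D.layout j hw).circuit b).T)))
    (hcode : ∀ A, IsSparse G η (204 * (w : ℝ) ^ 5 * β) (placed P.pos (fun v => (ε v).1) A) →
      Avoids code.bad A)
    (hbad : ∀ F : Fin ((D.layout j hw).circuit b).T → PauliSuperop ↥(D.prepSet j),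
      Avoids bad (faultSupport F) → ∀ t, IsSparse G η β (placed P.pos Subtype.val (F t).support))
    (ψ : Bits (Fin k) → ℂ) {c : ℂ} (hc0 : c ≠ 0)
    (hc : code.enc *ᵥ ψ = c • b.frame (cocycleVec ε)) :
    IsPauliFaultTolerantGadget ((D.layout j hw).circuit b) bad DecoratedCode.trivial
      Function.Embedding.ofIsEmpty code e (prepareChannel ψ) := by
  intro ℓ ρ _ _ σ hσ F hF
  obtain ⟨c1, hc1⟩ := exists_refTrace_eq_smul hσ
  obtain ⟨F', hF', c2, hc2⟩ :=
    exists_pauliSuperop_traceOut_run P e ε hw1 hw hdec he b hη hβ0 hβ F (hbad F hF) σ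
  -- The encoded state is `c` times the cocycle vector on the left and `star c` times it on the
  -- right; this factor removes both.
  refine ⟨F', hcode _ hF', c2 * c1 * (c * star c)⁻¹, ?_⟩
  have hs : c * star c ≠ 0 := mul_ne_zero hc0 (star_ne_zero.2 hc0)
  have h1 : prodOp (b.frame (cocycleVec ε)) (b.frame (cocycleVec ε)) (refTrace (∑ x, σ x)) =
      c1 • prodOp (b.frame (cocycleVec ε)) (b.frame (cocycleVec ε)) (refTrace ρ) := by
    rw [hc1, prodOp, Matrix.kronecker_smul, prodOp]
  rw [hc2, h1, tensorId_prepareChannel, code.encode_prodOp, hc, star_smul,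
    b.star_frame (star_cocycleVec ε), prodOp_smul_left, prodOp_smul_right, smul_smul,
    PauliSuperop.apply, PauliSuperop.apply, sandwich_smul, sandwich_smul, smul_smul, smul_smul,
    mul_assoc (c2 * c1), inv_mul_cancel₀ hs, mul_one]

end BasedCochainComplex

/-! ### Character sums -/

section CharacterSums

open scoped Classical

variable {B : Type*} [Fintype B] [DecidableEq B]

/-- The indicator of a set of bit strings. -/
noncomputable def indicatorVec (S : Set (Bits B)) (x : Bits B) : ℂ := if x ∈ S then 1 else 0

theorem sum_sgn_dotProduct (S : Submodule (ZMod 2) (Bits B)) (a : Bits B) :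
    ∑ x : S, sgn (a ⬝ᵥ x.1) = if ∀ x ∈ S, a ⬝ᵥ x = 0 then (Nat.card S : ℂ) else 0 := by
  split_ifs with h
  · rw [Finset.sum_congr rfl fun x _ => by rw [h x.1 x.2, sgn_zero], Nat.card_eq_fintype_card]
    simp
  · push Not at h
    obtain ⟨x, hx, hax⟩ := h
    have h1 : a ⬝ᵥ x = 1 := (zmod_two_cases _).resolve_left hax
    -- Translation by an element of `S` that is not orthogonal to `a` permutes the terms and changes
    -- all signs, so the sum is its own negative.
    have h2 := Equiv.sum_comp (Equiv.addRight (⟨x, hx⟩ : S)) fun y : S => sgn (a ⬝ᵥ y.1)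
    simp only [Equiv.coe_addRight, Submodule.coe_add, dotProduct_add, h1, sgn_add, sgn_one,
      mul_neg, mul_one, Finset.sum_neg_distrib] at h2
    exact self_eq_neg.1 h2.symm

theorem hadamardTransform_indicatorVec (S : Submodule (ZMod 2) (Bits B)) :
    hadamardTransform (indicatorVec (S : Set (Bits B))) =
      (Nat.card S : ℂ) • indicatorVec {a | ∀ x ∈ S, a ⬝ᵥ x = 0} := by
  ext a
  have h : ∑ x, sgn (a ⬝ᵥ x) * indicatorVec (S : Set (Bits B)) x = ∑ x : S, sgn (a ⬝ᵥ x.1) := by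
    simp only [indicatorVec, mul_ite, mul_one, mul_zero, SetLike.mem_coe]
    rw [← Finset.sum_filter]
    exact Finset.sum_subtype _ (by simp) _
  rw [hadamardTransform, h, sum_sgn_dotProduct]
  simp [indicatorVec]

theorem hadamardTransform_hadamardTransform (ψ : Bits B → ℂ) :
    hadamardTransform (hadamardTransform ψ) = (2 : ℂ) ^ Fintype.card B • ψ := by
  ext x
  simp only [hadamardTransform, Finset.mul_sum]
  rw [Finset.sum_comm]
  have h : ∀ z : Bits B, ∑ y : Bits B, sgn (x ⬝ᵥ y) * (sgn (y ⬝ᵥ z) * ψ z) =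
      if x = z then (2 : ℂ) ^ Fintype.card B * ψ z else 0 := by
    intro z
    have h1 := sum_sgn_dotProduct (⊤ : Submodule (ZMod 2) (Bits B)) (x + z)
    have h2 : (∀ y ∈ (⊤ : Submodule (ZMod 2) (Bits B)), (x + z) ⬝ᵥ y = 0) ↔ x = z := by
      rw [← ZModModule.sub_eq_add, ← sub_eq_zero (a := x), ← dotProduct_eq_zero_iff]
      simp
    have h3 : ∑ y : (⊤ : Submodule (ZMod 2) (Bits B)), sgn ((x + z) ⬝ᵥ y.1) =
        ∑ y : Bits B, sgn ((x + z) ⬝ᵥ y) :=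
      Fintype.sum_equiv (Equiv.subtypeUnivEquiv fun _ => Submodule.mem_top) _ _ fun _ => rfl
    rw [h3] at h1
    have h4 : ∑ y : Bits B, sgn (x ⬝ᵥ y) * (sgn (y ⬝ᵥ z) * ψ z) =
        (∑ y : Bits B, sgn ((x + z) ⬝ᵥ y)) * ψ z := by
      rw [Finset.sum_mul]
      refine Finset.sum_congr rfl fun y _ => ?_
      rw [add_dotProduct, sgn_add, dotProduct_comm y z, mul_assoc]
    rw [h4, h1]
    simp only [h2]
    split_ifs <;> simp
  simp [h]

/-- Obtained by inverting the transform of the indicator of `S`, which avoids any dimension count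
for the orthogonal complement. -/
theorem hadamardTransform_indicatorVec_orthogonal (S : Submodule (ZMod 2) (Bits B)) :
    hadamardTransform (indicatorVec {a | ∀ x ∈ S, a ⬝ᵥ x = 0}) =
      ((Nat.card S : ℂ)⁻¹ * (2 : ℂ) ^ Fintype.card B) • indicatorVec (S : Set (Bits B)) := by
  have h0 : (Nat.card S : ℂ) ≠ 0 := by exact_mod_cast Nat.card_pos.ne'
  rw [mul_smul, ← hadamardTransform_hadamardTransform, hadamardTransform_indicatorVec,
    hadamardTransform_smul, smul_smul, inv_mul_cancel₀ h0, one_smul]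

end CharacterSums

namespace BasedCochainComplex

variable {X : Type*} [Fintype X] [DecidableEq X] {r : ℕ} (C : BasedCochainComplex X r)

/-! ### The encoded states -/

theorem inv_sqrt_card_coboundaries_ne_zero (i : ℕ) :
    ((Real.sqrt (Nat.card (C.coboundaries i)) : ℝ) : ℂ)⁻¹ ≠ 0 := by
  have : 0 < (Nat.card (C.coboundaries i) : ℝ) := by exact_mod_cast Nat.card_pos
  exact inv_ne_zero (Complex.ofReal_ne_zero.2 (Real.sqrt_pos.2 this).ne')

/-- Each cocycle lies in exactly one cohomology class, so exactly one logical string contributes to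
its amplitude and all cocycles get the same one. -/
theorem encMatrix_mulVec_plusState {i k : ℕ} (Enc : (Fin k → ZMod 2) ≃ₗ[ZMod 2] C.Cohomology i) :
    C.encMatrix Enc *ᵥ plusState k =
      (((Real.sqrt (Nat.card (C.coboundaries i)) : ℝ) : ℂ)⁻¹ *
        (((Real.sqrt 2 : ℝ) : ℂ)⁻¹) ^ k) • cocycleVec (Equiv.refl (C.Level i)) := by
  ext z
  simp only [Matrix.mulVec, dotProduct, encMatrix, Matrix.of_apply, plusState, Pi.smul_apply,
    smul_eq_mul, cocycleVec]
  by_cases hz : C.cob i (i + 1) z = 0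
  · have h1 : ∀ x, C.Represents z (Enc x) ↔ x = Enc.symm (Submodule.Quotient.mk ⟨z, hz⟩) := by
      intro x
      rw [LinearEquiv.eq_symm_apply]
      exact ⟨fun ⟨_, h⟩ => h.symm, fun h => ⟨hz, h.symm⟩⟩
    rw [Finset.sum_eq_single (Enc.symm (Submodule.Quotient.mk ⟨z, hz⟩))]
    · rw [if_pos ((h1 _).2 rfl), if_pos (show C.cob i (i + 1) (z ∘ (Equiv.refl _).symm) = 0 from hz),
        mul_one]
    · intro x _ hx
      rw [if_neg fun h => hx ((h1 x).1 h), zero_mul]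
    · simp
  · rw [if_neg (show ¬ C.cob i (i + 1) (z ∘ (Equiv.refl _).symm) = 0 from hz), mul_zero]
    refine Finset.sum_eq_zero fun x _ => ?_
    rw [if_neg fun h => hz h.1, zero_mul]

theorem represents_zero_iff {i : ℕ} (z : C.Cochain i) :
    C.Represents z 0 ↔ z ∈ C.coboundaries i := by
  constructor
  · rintro ⟨hz, h⟩
    rwa [Submodule.Quotient.mk_eq_zero] at h
  · intro h
    exact ⟨C.coboundaries_le i h, (Submodule.Quotient.mk_eq_zero _).2 h⟩

theorem encMatrix_mulVec_zeroState {i k : ℕ} (Enc : (Fin k → ZMod 2) ≃ₗ[ZMod 2] C.Cohomology i) :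
    C.encMatrix Enc *ᵥ zeroState k =
      ((Real.sqrt (Nat.card (C.coboundaries i)) : ℝ) : ℂ)⁻¹ •
        indicatorVec (C.coboundaries i : Set (C.Cochain i)) := by
  classical
  ext z
  simp only [Matrix.mulVec, dotProduct, encMatrix, Matrix.of_apply, zeroState, mul_ite, mul_one,
    mul_zero, Finset.sum_ite_eq', Finset.mem_univ, if_true, Pi.smul_apply, smul_eq_mul,
    indicatorVec]
  refine if_congr ?_ rfl rfl
  rw [map_zero, represents_zero_iff, SetLike.mem_coe]

/-! ### The dual complex -/

variable {C}

theorem dual_below_iff {x y : X} : C.dual.Below x y ↔ C.Below y x := by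
  rw [Below, Below, ← Relation.reflTransGen_swap]
  rfl

theorem HasLocality.dual {w : ℕ} (h : C.HasLocality w) : C.dual.HasLocality w := by
  intro x
  simp only [dual_below_iff]
  simpa only [or_comm] using h x

theorem dual_deg_eq_iff {i : ℕ} (hi : i ≤ r) (x : X) : C.dual.deg x = r - i ↔ C.deg x = i := by
  have := C.deg_le x
  change r - C.deg x = r - i ↔ _
  omega

/-- The cells of degree `i` as the cells of degree `r - i` of the dual complex. -/
def levelDual {i : ℕ} (hi : i ≤ r) : C.Level i ≃ C.dual.Level (r - i) :=
  Equiv.subtypeEquivRight fun x => (dual_deg_eq_iff hi x).symm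

/-- The cocycles of the dual complex are the vectors orthogonal to the coboundaries. -/
theorem cob_dual_eq_zero_iff {i : ℕ} (hi1 : 1 ≤ i) (hi : i ≤ r) (x : C.Cochain i) :
    C.dual.cob (r - i) (r - i + 1) (x ∘ (levelDual hi).symm) = 0 ↔
      ∀ z ∈ C.coboundaries i, x ⬝ᵥ z = 0 := by
  have h1 : ∀ (u : X) (hu : C.deg u = i - 1) (hu' : C.dual.deg u = r - i + 1),
      C.dual.cob (r - i) (r - i + 1) (x ∘ (levelDual hi).symm) ⟨u, hu'⟩ =
        (x ᵥ* C.δ.submatrix (Subtype.val : C.Level i → X) (Subtype.val : C.Level (i - 1) → X))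
          ⟨u, hu⟩ := by
    intro u hu hu'
    rw [cob_apply, ← (levelDual hi).sum_comp]
    refine Finset.sum_congr rfl fun v _ => ?_
    rw [Function.comp_apply, Equiv.symm_apply_apply]
    exact mul_comm _ _
  have h2 : (∀ z ∈ C.coboundaries i, x ⬝ᵥ z = 0) ↔
      x ᵥ* C.δ.submatrix (Subtype.val : C.Level i → X) (Subtype.val : C.Level (i - 1) → X) = 0 := by
    rw [← dotProduct_eq_zero_iff]
    constructor
    · intro h c
      rw [← Matrix.dotProduct_mulVec]
      exact h _ ⟨c, rfl⟩
    · rintro h _ ⟨c, rfl⟩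
      have := h c
      rw [← Matrix.dotProduct_mulVec] at this
      exact this
  -- The truncated subtractions are harmless because degrees are at most `r` and `1 ≤ i ≤ r`.
  have hdeg : ∀ u, C.deg u = i - 1 ↔ C.dual.deg u = r - i + 1 := by
    intro u
    have := C.deg_le u
    change _ ↔ r - C.deg u = _
    omega
  rw [h2]
  constructor
  · intro h
    ext u
    rw [← h1 u.1 u.2 ((hdeg _).1 u.2), h]
    rfl
  · intro h
    ext u
    rw [h1 u.1 ((hdeg _).2 u.2) u.2, h]
    rfl

theorem cocycleVec_levelDual {i : ℕ} (hi1 : 1 ≤ i) (hi : i ≤ r) :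
    cocycleVec (levelDual (C := C) hi) =
      indicatorVec {a : C.Cochain i | ∀ x ∈ C.coboundaries i, a ⬝ᵥ x = 0} := by
  ext x
  have h := cob_dual_eq_zero_iff hi1 hi x
  rw [cocycleVec, indicatorVec]
  by_cases hx : ∀ z ∈ C.coboundaries i, x ⬝ᵥ z = 0
  · exact (if_pos (h.2 hx)).trans (if_pos hx).symm
  · exact (if_neg fun h' => hx (h.1 h')).trans (if_neg hx).symm

/-! ### Placements -/

variable {V : Type*} {G : SimpleGraph V}

/-- The placement of the cells given by a copy of the connectivity graph. -/
def placementOfCopy {i : ℕ} (ι : (C.connectivityGraph {i, i + 1, i + 2}).Copy G)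
    (h : ∀ x y, C.Incident x.1 y.1 → G.Adj (ι x) (ι y)) : Placement C i G where
  p x := C.deg x ∈ ({i, i + 1, i + 2} : Set ℕ)
  mem _ hx := hx
  pos := ι
  inj := ι.injective
  adj_of_above _ _ hne z hz hx hy := ι.toHom.map_adj ⟨hne, Or.inl ⟨z, hz, hx, hy⟩⟩
  adj_of_incident _ _ hxy := h _ _ hxy

/-- The placement of the cells of the dual complex given by a copy of the connectivity graph. -/
def dualPlacementOfCopy {i : ℕ} (hi2 : 2 ≤ i) (hi : i ≤ r)
    (ι : (C.connectivityGraph {i, i - 1, i - 2}).Copy G)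
    (h : ∀ x y, C.Incident x.1 y.1 → G.Adj (ι x) (ι y)) : Placement C.dual (r - i) G where
  p x := C.deg x ∈ ({i, i - 1, i - 2} : Set ℕ)
  mem x hx := by
    have h1 := C.deg_le x
    change r - C.deg x = _ ∨ r - C.deg x = _ ∨ r - C.deg x = _ at hx
    change C.deg x = _ ∨ C.deg x = _ ∨ C.deg x = _
    omega
  pos := ι
  inj := ι.injective
  adj_of_above _ _ hne z hz hx hy := by
    -- A cell of degree `0` of the dual complex is a cell of degree `r` of `C`, so lying above it in
    -- the dual means lying below a common top cell.
    refine ι.toHom.map_adj ⟨hne, Or.inr ⟨z, ?_, dual_below_iff.1 hx, dual_below_iff.1 hy⟩⟩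
    have h1 := C.deg_le z
    change r - C.deg z = 0 at hz
    omega
  adj_of_incident _ _ hxy := (h _ _ hxy).symm

end BasedCochainComplex

/-! ### The bounds -/

section Bounds

/-- The densities reached have order `w⁵`. The factor `10` is all that is used of `(w + 10) 2 ^ (w +
10)`, and it absorbs the constants `96` and `204` into `50 · 10` and `100 · 10`. -/
theorem pow_five_mul_ten_le {w : ℕ} (hw1 : 1 ≤ w) :
    (w : ℝ) ^ 5 * 10 ≤ (w : ℝ) ^ 7 * (w + 10) * 2 ^ (w + 10) := by
  have hw1' : (1 : ℝ) ≤ w := by exact_mod_cast hw1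
  calc (w : ℝ) ^ 5 * 10 = (w : ℝ) ^ 5 * 10 * 1 := (mul_one _).symm
    _ ≤ (w : ℝ) ^ 7 * (w + 10) * 2 ^ (w + 10) := by
        gcongr
        · norm_num
        · linarith
        · exact one_le_pow₀ one_le_two

theorem mul_pow_five_le_one {w : ℕ} (hw1 : 1 ≤ w) {γ : ℝ} (hγ0 : 0 < γ)
    (hγ : γ ≤ 1 / (50 * w ^ 7 * (w + 10) * 2 ^ (w + 10))) : 96 * (w : ℝ) ^ 5 * γ ≤ 1 := by
  have hw1' : (1 : ℝ) ≤ w := by exact_mod_cast hw1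
  have h1 := pow_five_mul_ten_le hw1
  rw [le_div_iff₀ (by positivity)] at hγ
  have h2 : 96 * (w : ℝ) ^ 5 ≤ 50 * w ^ 7 * (w + 10) * 2 ^ (w + 10) := by
    have : (0 : ℝ) ≤ (w : ℝ) ^ 5 := by positivity
    linarith
  calc 96 * (w : ℝ) ^ 5 * γ ≤ 50 * w ^ 7 * (w + 10) * 2 ^ (w + 10) * γ := by gcongr
    _ ≤ 1 := by linarith

theorem mul_pow_five_le {w : ℕ} (hw1 : 1 ≤ w) {γ : ℝ} (hγ0 : 0 < γ) :
    204 * (w : ℝ) ^ 5 * γ ≤ 100 * w ^ 7 * (w + 10) * 2 ^ (w + 10) * γ := by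
  have h1 := pow_five_mul_ten_le hw1
  have h2 : 204 * (w : ℝ) ^ 5 ≤ 100 * w ^ 7 * (w + 10) * 2 ^ (w + 10) := by
    have : (0 : ℝ) ≤ (w : ℝ) ^ 5 := by positivity
    linarith
  gcongr

end Bounds

theorem proposition7p1 :
    ∃ K : ℕ,
      -- preparation of the logical `|+^k⟩` state of the level-`i` code
      (∀ {X : Type*} {V : Type*} [Fintype X] [DecidableEq X] [Finite V] (r i w m k : ℕ)
        (C : BasedCochainComplex X r) (Enc : (Fin k → ZMod 2) ≃ₗ[ZMod 2] C.Cohomology i)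
        (Grun : SimpleGraph V) (ι : (C.connectivityGraph {i, i + 1, i + 2}).Copy Grun)
        (η γ : ℝ),
        1 ≤ i → i + 2 ≤ r → 1 ≤ w → C.HasLocality w →
        C.HasSmallSetFlipDecoder m 0 (i + 1) →
        (∀ x y, C.Incident x.1 y.1 → Grun.Adj (ι x) (ι y)) →
        0 < η → η ≤ m →
        0 < γ → γ ≤ 1 / (50 * w ^ 7 * (w + 10) * 2 ^ (w + 10)) →
        ∃ (S : Finset X) (hS : ∀ x, C.deg x = i → x ∈ S) (Q : AdaptiveCircuit ↥S),
          S.card ≤ K * (Fintype.card (C.Level i) * w) ∧ Q.T ≤ K * w ∧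
          IsSingleShotPreparation C i .plus Q ∧
          IsPauliFaultTolerantGadget Q
            (timeCopies (C.inducedBad ι (fun q : ↥S => q.1) (badSets Grun η γ)) Q.T)
            DecoratedCode.trivial Function.Embedding.ofIsEmpty
            (C.decoratedCode Enc (C.inducedBad ι Subtype.val
              (badSets Grun η (100 * w ^ 7 * (w + 10) * 2 ^ (w + 10) * γ))))
            (C.levelEmb hS) (prepareChannel (plusState k))) ∧
      -- preparation of the logical `|0^k⟩` state of the level-`i` code, with the roles of
      -- the complex and its dual exchanged
      (∀ {X : Type*} {V : Type*} [Fintype X] [DecidableEq X] [Finite V] (r i w m k : ℕ)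
        (C : BasedCochainComplex X r) (Enc : (Fin k → ZMod 2) ≃ₗ[ZMod 2] C.Cohomology i)
        (Grun : SimpleGraph V) (ι : (C.connectivityGraph {i, i - 1, i - 2}).Copy Grun)
        (η γ : ℝ),
        2 ≤ i → i + 1 ≤ r → 1 ≤ w → C.HasLocality w →
        C.dual.HasSmallSetFlipDecoder m 0 (r - i + 1) →
        (∀ x y, C.Incident x.1 y.1 → Grun.Adj (ι x) (ι y)) →
        0 < η → η ≤ m →
        0 < γ → γ ≤ 1 / (50 * w ^ 7 * (w + 10) * 2 ^ (w + 10)) →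
        ∃ (S : Finset X) (hS : ∀ x, C.deg x = i → x ∈ S) (Q : AdaptiveCircuit ↥S),
          S.card ≤ K * (Fintype.card (C.Level i) * w) ∧ Q.T ≤ K * w ∧
          IsSingleShotPreparation C.dual (r - i) .zero Q ∧
          IsPauliFaultTolerantGadget Q
            (timeCopies (C.inducedBad ι (fun q : ↥S => q.1) (badSets Grun η γ)) Q.T)
            DecoratedCode.trivial Function.Embedding.ofIsEmpty
            (C.decoratedCode Enc (C.inducedBad ι Subtype.val
              (badSets Grun η (100 * w ^ 7 * (w + 10) * 2 ^ (w + 10) * γ))))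
            (C.levelEmb hS) (prepareChannel (zeroState k))) := by
  -- The circuit has at most `2nw` qubits and `2w + 4 ≤ 6w` steps.
  refine ⟨6, ?_, ?_⟩
  · intro X V _ _ _ r i w m k C Enc Grun ι η γ _ _ hw1 hw hdec hinc _ hηm hγ0 hγ
    refine ⟨C.prepSet i, fun _ => BasedCochainComplex.mem_prepSet_of_deg,
      (C.layout i hw).circuit .plus, ?_, ?_, BasedCochainComplex.isSingleShotPreparation .plus hw, ?_⟩
    · have := BasedCochainComplex.card_prepSet_le (D := C) (j := i) hw1 hw
      omega
    · change 2 * w + 1 + 3 ≤ _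
      omega
    · refine BasedCochainComplex.isPauliFaultTolerantGadget_layout
        (BasedCochainComplex.placementOfCopy ι hinc) _ (Equiv.refl _) (fun _ => rfl) hw1 hw hdec .plus
        hηm hγ0 (mul_pow_five_le_one hw1 hγ0 hγ) _ _ (fun A hA => ?_) (fun F hF t => ?_) _ ?_
        (C.encMatrix_mulVec_plusState Enc)
      · exact (BasedCochainComplex.avoids_inducedBad_iff Grun ι Subtype.val _ _ A).2
          (hA.mono subset_rfl (mul_pow_five_le hw1 hγ0))
      · exact (BasedCochainComplex.avoids_inducedBad_iff Grun ι _ _ _ _).1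
          (BasedCochainComplex.avoids_timeCopies hF t)
      · exact mul_ne_zero (C.inv_sqrt_card_coboundaries_ne_zero i)
          (pow_ne_zero _ (inv_ne_zero (by simp)))
  · intro X V _ _ _ r i w m k C Enc Grun ι η γ hi2 hir hw1 hw hdec hinc _ hηm hγ0 hγ
    have hi : i ≤ r := by omega
    have hS : ∀ x, C.deg x = i → x ∈ C.dual.prepSet (r - i) := fun x hx =>
      BasedCochainComplex.mem_prepSet_of_deg ((BasedCochainComplex.dual_deg_eq_iff hi x).2 hx)
    refine ⟨C.dual.prepSet (r - i), hS, (C.dual.layout (r - i) hw.dual).circuit .zero, ?_, ?_,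
      BasedCochainComplex.isSingleShotPreparation .zero hw.dual, ?_⟩
    · have := BasedCochainComplex.card_prepSet_le (D := C.dual) (j := r - i) hw1 hw.dual
      rw [← Fintype.card_congr (BasedCochainComplex.levelDual hi)] at this
      omega
    · change 2 * w + 1 + 3 ≤ _
      omega
    · have hcard : (Nat.card (C.coboundaries i) : ℂ) ≠ 0 := by exact_mod_cast Nat.card_pos.ne'
      have hN : (Nat.card (C.coboundaries i) : ℂ)⁻¹ * 2 ^ Fintype.card (C.Level i) ≠ 0 :=
        mul_ne_zero (inv_ne_zero hcard) (pow_ne_zero _ two_ne_zero)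
      refine BasedCochainComplex.isPauliFaultTolerantGadget_layout
        (BasedCochainComplex.dualPlacementOfCopy hi2 hi ι hinc) (C.levelEmb hS)
        (BasedCochainComplex.levelDual hi) (fun _ => rfl) hw1 hw.dual hdec .zero
        hηm hγ0 (mul_pow_five_le_one hw1 hγ0 hγ) _ _ (fun A hA => ?_) (fun F hF t => ?_) _
        -- The normalization of the encoded state times the inverse of the factor that the
        -- unnormalized Hadamard transform produces.
        (c := ((Real.sqrt (Nat.card (C.coboundaries i)) : ℝ) : ℂ)⁻¹ *
          ((Nat.card (C.coboundaries i) : ℂ)⁻¹ * 2 ^ Fintype.card (C.Level i))⁻¹) ?_ ?_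
      · exact (BasedCochainComplex.avoids_inducedBad_iff Grun ι Subtype.val _ _ A).2
          (hA.mono subset_rfl (mul_pow_five_le hw1 hγ0))
      · exact (BasedCochainComplex.avoids_inducedBad_iff Grun ι _ _ _ _).1
          (BasedCochainComplex.avoids_timeCopies hF t)
      · exact mul_ne_zero (C.inv_sqrt_card_coboundaries_ne_zero i) (inv_ne_zero hN)
      -- In the frame, the superposition of the dual cocycles becomes that of the coboundaries of
      -- `C`, which is the encoding of `|0^k⟩`.
      · rw [PrepBasis.frame, BasedCochainComplex.cocycleVec_levelDual (by omega) hi,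
          hadamardTransform_indicatorVec_orthogonal, mul_smul, smul_smul _ _ (indicatorVec _),
          inv_mul_cancel₀ hN, one_smul]
        exact C.encMatrix_mulVec_zeroState Enc
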